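/- **Setting.** Let $k\ge 1$, and let $n=2k$ in type $C_k$, $n=2k+1$ in type $B_k$. Let $\Omega_n=\sum_{i=1}^n(-1)^{i+1}E_{i,n+1-i}$ and let $G$ be the adjoint group, i.e. the image in $PGL_n(\mathbb C)$ of $\{A\in SL_n(\mathbb C): A\Omega_nA^t=\Omega_n\}$; so $G=PSp_{2k}$ in type $C$ and $G=SO_{2k+1}$ in type $B$. Let $B_\pm\subset G$ be the upper and lower triangular Borel subgroups, $T$ the diagonal torus, $W=N_G(T)/T$ with simple reflections $s_1,\dots,s_k$ (the double edge of the Dynkin diagram joins $k-1$ and $k$), and $G^{u,v}=B_+uB_+\cap B_-vB_-$ for $u,v\in W$. Let $\mathbf i=i_1\dots i_m$, $i_p\in\{\pm1,\dots,\pm k\}$, be a reduced double word representing $(u,v)\in W\times W$ (negative letters give $u$, positive letters give $v$). *Fock–Goncharov coordinates.* Let $F_i=E_i^t$, where $E_i=E_{i,i+1}+E_{n-i,n-i+1}$ for $i<k$, and $E_k=E_{k,k+1}$ in type $C$, $E_k=\sqrt2(E_{k,k+1}+E_{k+1,k+2})$ in type $B$. Let $H^1,\dots,H^k$ be the fundamental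 coweights (the basis of the Cartan subalgebra dual to the simple roots), $X_i=\exp E_i$, $X_{-i}=\exp F_i$, $Y_i(t)=\exp(H^i\log t)$. For $t\in(\mathbb C^*)^{k+m}$, with components $t^0_1,\dots,t^0_k,t_1,\dots,t_m$, put $$\Phi_{\mathbf i}(t)=Y_1(t^0_1)\cdots Y_k(t^0_k)\prod_{p=1}^{m}X_{i_p}Y_{|i_p|}(t_p)\in G .$$ The numbers $t$ are the Fock–Goncharov coordinates of the point $\Phi_{\mathbf i}(t)$. *The graph.* $\Gamma_{\mathbf i}$ is the plabic graph in a rectangle obtained by concatenating, from left to right, the graphs $\Gamma_{i_1},\dots,\Gamma_{i_m}$. The graph $\Gamma_{\pm i}$ consists of $n$ horizontal wires, numbered from the bottom up, with a vertical edge between wires $i,i+1$ and another between wires $n-i,n-i+1$ (these are the same edge if $n=2k$, $i=k$); for $\Gamma_i$ the lower end of each is white and the upper end black, for $\Gamma_{-i}$ the opposite. If $n=2k+1$ and $i=k$, then in addition the middle wire carries a square face with left and right vertices white and lying on the wire (the midline), and bottom and top vertices black, which replace the ends on the middle wire of the two vertical edges. A projective weighting assigns non-zero complex weights to all faces except the uppermost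 and the lowermost one. It is move-symmetric if it is reproduced by performing the square moves at all squares with two opposite vertices on the midline and then reflecting in the midline. Here the square move (the change of face weights that preserves boundary measurements when the colours of the square are switched) replaces the weight $y_0$ of the square by $y_0^{-1}$, and multiplies the weight of a neighbouring face by $1+y_0$ or by $(1+y_0^{-1})^{-1}$, according to whether the common side, run through counter-clockwise around the square, goes from black to white or from white to black. Let $\tilde{\mathcal F}^{ms}(\Gamma_{\mathbf i})$ be the space of projective move-symmetric weightings. The boundary measurement $\mathrm{Meas}(\mathcal Y)\in PGL_n$ is the class of the matrix of weighted sums over directed paths from source $a$ to sink $b$, for any perfect orientation and any edge weights inducing the face weights $\mathcal Y$. *Face weight coordinates.* They are indexed by the faces above or on the midline, other than the uppermost one and, in type $B$, other than the squares. In type $C$ the coordinate of the face $f$ is its weight $y_f$. In type $B$ it is $\sqrt{y_fy_{f'}}:=\sqrt{c_f}\,y_f$, where $f'$ is the mirror image of $f$ and $y_{f'}=c_fy_f$ with $c_f>0$ depending only on $\Gamma_{\mathbf i}$. The faces are matched with the variables $t$: $t^0_i$ corresponds to the leftmost face between wires $n-i$ and $n-i+1$, and $t_p$ to the face between wires $n-|i_p|$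 and $n-|i_p|+1$ immediately to the right of $\Gamma_{i_p}$. **Proposition.** The matching just described is a bijection between the variables and the indexing faces; for each face $f$ other than the uppermost and lowermost ones there is a real $c_f>0$ with $y_{f'}=c_fy_f$ for all $\mathcal Y\in\tilde{\mathcal F}^{ms}(\Gamma_{\mathbf i})$; and the face weight coordinates identify $\tilde{\mathcal F}^{ms}(\Gamma_{\mathbf i})$ with $(\mathbb C^*)^{k+m}$. For every $\mathcal Y\in\tilde{\mathcal F}^{ms}(\Gamma_{\mathbf i})$ the element $\mathrm{Meas}(\mathcal Y)$ is well defined and lies in $G^{u,v}$, and for $t\in(\mathbb C^*)^{k+m}$ one has $\Phi_{\mathbf i}(t)=\mathrm{Meas}(\mathcal Y)$ if and only if $t$ is the vector of face weight coordinates of $\mathcal Y$. The image of $\mathrm{Meas}$ is Zariski dense in $G^{u,v}$. Thus the boundary measurement map identifies the face weight coordinates and the Fock–Goncharov coordinates associated with $\mathbf i$ on $G^{u,v}$. -/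

import Mathlib

open scoped MatrixGroups

/-! ### Plabic graphs in a rectangle -/

/-- The points of an `n`-valent graph in a rectangle: internal vertices, the `n` sources on the left
side and the `n` sinks on the right side.  Sources and sinks are numbered from the bottom up;
`i : Fin n` stands for the label `i + 1`. -/
inductive PlabicPoint (V : Type) (n : ℕ) : Type
  | inner (v : V)
  | source (i : Fin n)
  | sink (i : Fin n)

/-- A finite plabic graph in a rectangle.  Each edge carries a reference direction, whose only role
is to name its two ends and its two sides; the planar embedding is recorded by the faces lying on
the left and on the right of each edge with respect to that direction. -/
structure PlabicGraph (n : ℕ) where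
  V : Type
  E : Type
  F : Type
  fintypeE : Fintype E
  IsWhite : V → Prop
  tail : E → PlabicPoint V n
  head : E → PlabicPoint V n
  left : E → F
  right : E → F
  /-- the uppermost face -/
  top : F
  /-- the lowermost face -/
  bot : F

namespace PlabicGraph

variable {n : ℕ} (Γ : PlabicGraph n)

instance : Fintype Γ.E := Γ.fintypeE

/-- An orientation: `true` keeps the reference direction of an edge, `false` reverses it. -/
abbrev Orientation := Γ.E → Bool

variable {Γ}

def tailOf (o : Γ.Orientation) (e : Γ.E) : PlabicPoint Γ.V n := if o e then Γ.tail e else Γ.head e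
def headOf (o : Γ.Orientation) (e : Γ.E) : PlabicPoint Γ.V n := if o e then Γ.head e else Γ.tail e
def leftOf (o : Γ.Orientation) (e : Γ.E) : Γ.F := if o e then Γ.left e else Γ.right e
def rightOf (o : Γ.Orientation) (e : Γ.E) : Γ.F := if o e then Γ.right e else Γ.left e

/-- Perfect orientations: sources and sinks are univalent (with one outgoing, respectively one
incoming edge), a white vertex has exactly one incoming edge, a black vertex has exactly one
outgoing edge. -/
structure IsPerfect (o : Γ.Orientation) : Prop where
  source_out : ∀ i, ∃! e, tailOf o e = .source i
  source_in : ∀ i e, headOf o e ≠ .source i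
  sink_in : ∀ i, ∃! e, headOf o e = .sink i
  sink_out : ∀ i e, tailOf o e ≠ .sink i
  white : ∀ v, Γ.IsWhite v → ∃! e, headOf o e = .inner v
  black : ∀ v, ¬ Γ.IsWhite v → ∃! e, tailOf o e = .inner v

/-- `IsPath o x y l`: the list of edges `l` is a directed path from `x` to `y`. -/
def IsPath (o : Γ.Orientation) : PlabicPoint Γ.V n → PlabicPoint Γ.V n → List Γ.E → Prop
  | x, y, [] => x = y
  | x, y, e :: l => tailOf o e = x ∧ IsPath o (headOf o e) y l

/-- There are no directed cycles. -/
def IsAcyclic (o : Γ.Orientation) : Prop := ∀ x l, IsPath o x x l → l = []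

/-- The boundary measurement matrix of a network without directed cycles: the `(i, j)` entry is the
sum of the weights of all directed paths from source `i` to sink `j`.  (Without directed cycles a
path is self-avoiding, so a path from the left side to the right side has winding index `0` and
enters the sum with the sign `+1`.) -/
noncomputable def boundaryMatrix (o : Γ.Orientation) (wt : Γ.E → ℂˣ) :
    Matrix (Fin n) (Fin n) ℂ :=
  fun i j => ∑ᶠ l : {l : List Γ.E // IsPath o (.source i) (.sink j) l},
    ((l : List Γ.E).map fun e => (wt e : ℂ)).prod

open Classical in
/-- The weight of the face `f`: an edge contributes its weight if it is directed counter-clockwise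
around `f` (that is, `f` is on its left), and the inverse of its weight if it is directed
clockwise. -/
noncomputable def faceWeight (o : Γ.Orientation) (wt : Γ.E → ℂˣ) (f : Γ.F) : ℂˣ :=
  (∏ e, if leftOf o e = f then wt e else 1) * ∏ e, if rightOf o e = f then (wt e)⁻¹ else 1

variable (Γ) in
/-- All faces except the uppermost and the lowermost ones. -/
abbrev ProjFace := {f : Γ.F // f ≠ Γ.top ∧ f ≠ Γ.bot}

variable (Γ) in
/-- Projective weightings: non-zero weights on all faces but the uppermost and lowermost ones. -/
abbrev ProjWeighting := Γ.ProjFace → ℂˣ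

/-- `g` is the boundary measurement, in `PGL n`, of the projective weighting `Y`: there are a perfect
orientation and edge weights inducing `Y`, and every such choice has no directed cycles and has
an invertible boundary measurement matrix whose class is `g`. -/
def IsMeas (Y : Γ.ProjWeighting) (g : PGL(n, ℂ)) : Prop :=
  (∃ o : Γ.Orientation, IsPerfect o ∧ ∃ wt : Γ.E → ℂˣ, ∀ f : Γ.ProjFace, faceWeight o wt f = Y f) ∧
  ∀ o : Γ.Orientation, IsPerfect o → IsAcyclic o ∧
    ∀ wt : Γ.E → ℂˣ, (∀ f : Γ.ProjFace, faceWeight o wt f = Y f) →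
      ∃ A : GL (Fin n) ℂ, (A : Matrix (Fin n) (Fin n) ℂ) = boundaryMatrix o wt ∧
        Matrix.ProjGenLinGroup.mk A = g

open Classical in
/-- The weight of a face, with the (disregarded) uppermost and lowermost faces given weight `1`. -/
noncomputable def extend (Y : Γ.ProjWeighting) (f : Γ.F) : ℂ :=
  if h : f ≠ Γ.top ∧ f ≠ Γ.bot then Y ⟨f, h⟩ else 1

def IsBlackPoint : PlabicPoint Γ.V n → Prop
  | .inner v => ¬ Γ.IsWhite v
  | _ => False

open Classical in
/-- The factor by which the square move at a face of weight `y` changes the weight of the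
neighbour across a side of the square, where `x` is the vertex at which that side starts when the
square is run through counter-clockwise. -/
noncomputable def moveFactor (x : PlabicPoint Γ.V n) (y : ℂ) : ℂ :=
  if IsBlackPoint x then 1 + y else (1 + y⁻¹)⁻¹

open Classical in
/-- The face weights after square moves at all faces in `S` (no two of which share a side). -/
noncomputable def squareMoves (S : Set Γ.F) (y : Γ.F → ℂ) (f : Γ.F) : ℂ :=
  if f ∈ S then (y f)⁻¹ else
    y f * (∏ e, if Γ.left e = f ∧ Γ.right e ∈ S then moveFactor (Γ.head e) (y (Γ.right e)) else 1) *
      ∏ e, if Γ.right e = f ∧ Γ.left e ∈ S then moveFactor (Γ.tail e) (y (Γ.left e)) else 1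

/-- Move-symmetry of a projective weighting, where `S` is the set of square faces with two opposite
vertices on the midline and `ρ` is the action on faces of the reflection in the midline: the square
moves at `S` are defined, and after them and the reflection one gets the initial weights. -/
def IsMoveSymmetric (S : Set Γ.F) (ρ : Γ.F → Γ.F) (Y : Γ.ProjWeighting) : Prop :=
  (∀ f ∈ S, 1 + extend Y f ≠ 0) ∧
  ∀ f : Γ.ProjFace, squareMoves S (extend Y) (ρ f) = Y f

end PlabicGraph

/-! ### Types `B` and `C`, double words -/

/-- The types `B_k` and `C_k`. -/
inductive TypeBC : Type
  | B
  | C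

/-- The dimension of the defining representation: `2k + 1` in type `B_k`, `2k` in type `C_k`. -/
def TypeBC.dim : TypeBC → ℕ → ℕ
  | .B, k => 2 * k + 1
  | .C, k => 2 * k

/-- Letters of double words: `pos = true` is the letter `idx + 1`, `pos = false` is the letter
`-(idx + 1)`. -/
structure DoubleLetter (k : ℕ) where
  idx : Fin k
  pos : Bool

/-- The absolute value, in `{1, …, k}`, of a letter. -/
def DoubleLetter.abs {k : ℕ} (x : DoubleLetter k) : ℕ := x.idx + 1

/-! ### The graph of a double word

There are `n` horizontal wires `a : Fin n`, numbered from the bottom up, and `n + 1` horizontal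
strips `r : Fin (n + 1)`; wire `a` separates strip `a` (below it) from strip `a + 1` (above it).
The graph of a letter `±i` has vertical edges (rungs) in the strips `i` and `n - i`.  In type `B`
the two rungs of `±k` end in the lower and the upper vertex of a square centred on the middle wire. -/

section WordGraph

variable {k : ℕ} (ty : TypeBC)

/-- The graph of the letter `x` has a rung in strip `r`. -/
def HasRung (x : DoubleLetter k) (r : ℕ) : Prop := r = x.abs ∨ r + x.abs = ty.dim k

/-- The graph of the letter `x` has vertices on wire `a`. -/
def Touches (x : DoubleLetter k) (a : ℕ) : Prop := HasRung ty x a ∨ HasRung ty x (a + 1)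

/-- The graph of the letter `x` has a square on the midline. -/
def HasSquare (x : DoubleLetter k) : Prop := ty = .B ∧ x.abs = k

variable {m : ℕ} (w : Fin m → DoubleLetter k)

/-- Rungs: the letter they come from and their strip. -/
abbrev RungIdx := {x : Fin m × Fin (ty.dim k + 1) // HasRung ty (w x.1) x.2}

/-- Squares are indexed by the letters they come from. -/
abbrev SquareIdx := {p : Fin m // HasSquare ty (w p)}

/-- Horizontal edges: a wire, and the place where the edge begins, which is the left side of
the rectangle (`⊥`) or a letter touching the wire. -/
abbrev WireIdx :=
  {x : Fin (ty.dim k) × WithBot (Fin m) // ∀ p : Fin m, x.2 = p → Touches ty (w p) x.1}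

/-- Faces inside strips: a strip, and the place where the face begins, which is the left side
of the rectangle (`⊥`) or a letter with a rung in the strip. -/
abbrev StripIdx :=
  {x : Fin (ty.dim k + 1) × WithBot (Fin m) // ∀ p : Fin m, x.2 = p → HasRung ty (w p) x.1}

/-- Vertices: lower and upper ends of rungs; left and right vertices of squares.  (The bottom vertex
of a square is the upper end of a rung, its top vertex is the lower end of a rung.) -/
inductive WordVertex : Type
  | lo (x : RungIdx ty w)
  | hi (x : RungIdx ty w)
  | sqLeft (p : SquareIdx ty w)
  | sqRight (p : SquareIdx ty w)

/-- Edges.  The last four are the sides of the squares, named by their ends. -/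
inductive WordEdge : Type
  | wire (x : WireIdx ty w)
  | rung (x : RungIdx ty w)
  | leftTop (p : SquareIdx ty w)
  | leftBottom (p : SquareIdx ty w)
  | topRight (p : SquareIdx ty w)
  | bottomRight (p : SquareIdx ty w)

inductive WordFace : Type
  | strip (x : StripIdx ty w)
  | square (p : SquareIdx ty w)

open Classical in
noncomputable instance WordEdge.instFintype : Fintype (WordEdge ty w) :=
  Fintype.ofInjective
    (β := WireIdx ty w ⊕ RungIdx ty w ⊕ SquareIdx ty w × Fin 4)
    (fun e => match e with
      | .wire x => .inl x
      | .rung x => .inr (.inl x)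
      | .leftTop p => .inr (.inr (p, 0))
      | .leftBottom p => .inr (.inr (p, 1))
      | .topRight p => .inr (.inr (p, 2))
      | .bottomRight p => .inr (.inr (p, 3)))
    (by intro a b h; cases a <;> cases b <;> simp_all)

variable {ty w}

theorem HasSquare.lowerRung {x : DoubleLetter k} (h : HasSquare ty x) : HasRung ty x k :=
  Or.inl h.2.symm

theorem HasSquare.upperRung {x : DoubleLetter k} (h : HasSquare ty x) : HasRung ty x (k + 1) := by
  right; rw [h.1, h.2]; simp only [TypeBC.dim]; omega

/-- The rung below the square. -/
def SquareIdx.lower (p : SquareIdx ty w) : RungIdx ty w :=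
  ⟨(p.1, ⟨k, by rw [p.2.1]; simp only [TypeBC.dim]; omega⟩), p.2.lowerRung⟩

/-- The rung above the square. -/
def SquareIdx.upper (p : SquareIdx ty w) : RungIdx ty w :=
  ⟨(p.1, ⟨k + 1, by
    rw [p.2.1]; simp only [TypeBC.dim]; have := (w p.1).idx.2; omega⟩), p.2.upperRung⟩

/-- The colours.  The bottom and top vertices of a square are black, the left and right ones are
white.  Otherwise, for a positive letter the lower end of a rung is white and the upper end is
black; for a negative letter it is the other way around. -/
def WordVertex.IsWhite : WordVertex ty w → Prop
  | .lo x => ¬ (∃ p : SquareIdx ty w, x = p.upper) ∧ (w x.1.1).pos = true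
  | .hi x => ¬ (∃ p : SquareIdx ty w, x = p.lower) ∧ (w x.1.1).pos = false
  | .sqLeft _ => True
  | .sqRight _ => True

open Classical in
/-- The vertex at which wire `a`, coming from the left, meets the graph of the letter `w p`. -/
noncomputable def entryVertex (p : Fin m) (a : Fin (ty.dim k)) (h : Touches ty (w p) a) :
    WordVertex ty w :=
  if hs : HasSquare ty (w p) ∧ (a : ℕ) = k then .sqLeft ⟨p, hs.1⟩
  else if hl : HasRung ty (w p) (a + 1) then .lo ⟨(p, a.succ), by simpa using hl⟩
  else .hi ⟨(p, a.castSucc), by simpa using h.resolve_right hl⟩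

open Classical in
/-- The vertex at which wire `a` leaves the graph of the letter `w p` to the right. -/
noncomputable def exitVertex (p : Fin m) (a : Fin (ty.dim k)) (h : Touches ty (w p) a) :
    WordVertex ty w :=
  if hs : HasSquare ty (w p) ∧ (a : ℕ) = k then .sqRight ⟨p, hs.1⟩
  else if hl : HasRung ty (w p) (a + 1) then .lo ⟨(p, a.succ), by simpa using hl⟩
  else .hi ⟨(p, a.castSucc), by simpa using h.resolve_right hl⟩

/-- The beginning of a horizontal edge. -/
noncomputable def WireIdx.tail (x : WireIdx ty w) :
    PlabicPoint (WordVertex ty w) (ty.dim k) :=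
  match hx : x.1.2 with
  | ⊥ => .source x.1.1
  | (p : Fin m) => .inner (exitVertex p x.1.1 (x.2 p hx))

open Classical in
/-- The first letter after the beginning of a horizontal edge that touches its wire (`⊤` if there is
none). -/
noncomputable def WireIdx.next (x : WireIdx ty w) : WithTop (Fin m) :=
  (Finset.univ.filter fun q : Fin m => Touches ty (w q) x.1.1 ∧ x.1.2 < (q : WithBot (Fin m))).min

theorem WireIdx.touches_next (x : WireIdx ty w) (q : Fin m) (h : x.next = q) :
    Touches ty (w q) x.1.1 := by
  classical
  have := Finset.mem_of_min h
  exact (Finset.mem_filter.mp this).2.1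

/-- The end of a horizontal edge. -/
noncomputable def WireIdx.head (x : WireIdx ty w) :
    PlabicPoint (WordVertex ty w) (ty.dim k) :=
  match hx : x.next with
  | ⊤ => .sink x.1.1
  | (q : Fin m) => .inner (entryVertex q x.1.1 (x.touches_next q hx))

open Classical in
/-- The face in strip `r` that begins at the last rung satisfying `P` (at the left side of the
rectangle if there is none). -/
noncomputable def lastFace (r : Fin (ty.dim k + 1)) (P : Fin m → Prop) : WordFace ty w :=
  .strip ⟨(r, (Finset.univ.filter fun q : Fin m => HasRung ty (w q) r ∧ P q).max), fun _ hp =>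
    (Finset.mem_filter.mp (Finset.mem_of_max hp)).2.1⟩

/-- The face to the left of a rung. -/
noncomputable def RungIdx.leftFace (x : RungIdx ty w) : WordFace ty w :=
  lastFace x.1.2 fun q => q < x.1.1

/-- The face to the right of a rung. -/
def RungIdx.rightFace (x : RungIdx ty w) : WordFace ty w :=
  .strip ⟨(x.1.2, (x.1.1 : WithBot (Fin m))), fun p hp => by
    have : x.1.1 = p := WithBot.coe_injective hp
    subst this; exact x.2⟩

variable (ty w) in
/-- The plabic graph of a double word.  Horizontal edges are directed from left to right, rungs
upwards. -/
noncomputable def wordGraph : PlabicGraph (ty.dim k) where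
  V := WordVertex ty w
  E := WordEdge ty w
  F := WordFace ty w
  fintypeE := WordEdge.instFintype ty w
  IsWhite := WordVertex.IsWhite
  tail
    | .wire x => x.tail
    | .rung x => .inner (.lo x)
    | .leftTop p => .inner (.sqLeft p)
    | .leftBottom p => .inner (.sqLeft p)
    | .topRight p => .inner (.lo p.upper)
    | .bottomRight p => .inner (.hi p.lower)
  head
    | .wire x => x.head
    | .rung x => .inner (.hi x)
    | .leftTop p => .inner (.lo p.upper)
    | .leftBottom p => .inner (.hi p.lower)
    | .topRight p => .inner (.sqRight p)
    | .bottomRight p => .inner (.sqRight p)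
  left
    | .wire x => lastFace x.1.1.succ fun q => (q : WithBot (Fin m)) ≤ x.1.2
    | .rung x => x.leftFace
    | .leftTop p => p.upper.leftFace
    | .leftBottom p => .square p
    | .topRight p => p.upper.rightFace
    | .bottomRight p => .square p
  right
    | .wire x => lastFace x.1.1.castSucc fun q => (q : WithBot (Fin m)) ≤ x.1.2
    | .rung x => x.rightFace
    | .leftTop p => .square p
    | .leftBottom p => p.lower.leftFace
    | .topRight p => .square p
    | .bottomRight p => p.lower.rightFace
  top := lastFace (Fin.last _) fun _ => False
  bot := lastFace 0 fun _ => False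

theorem HasRung.rev {x : DoubleLetter k} {r : Fin (ty.dim k + 1)} (h : HasRung ty x r) :
    HasRung ty x r.rev := by
  have := r.2
  rcases h with h | h
  · right; rw [Fin.val_rev]; omega
  · left; rw [Fin.val_rev]; omega

/-- The reflection in the midline, on faces. -/
def WordFace.reflect : WordFace ty w → WordFace ty w
  | .strip x => .strip ⟨(x.1.1.rev, x.1.2), fun p hp => (x.2 p hp).rev⟩
  | .square p => .square p

variable (ty w) in
/-- The square faces with two opposite vertices on the midline. -/
def midSquares : Set (WordFace ty w) := Set.range WordFace.square

/-- Projective move-symmetric weightings. -/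
def IsMS (Y : (wordGraph ty w).ProjWeighting) : Prop :=
  (wordGraph ty w).IsMoveSymmetric (midSquares ty w) WordFace.reflect Y

/-! ### Face weight coordinates -/

/-- The faces inside strips that lie on or above the midline.  (In type `B` the midline is a wire, so
that these faces are above it.) -/
def WordFace.IsUpper : WordFace ty w → Prop
  | .strip x => ty.dim k ≤ 2 * (x.1.1 : ℕ)
  | .square _ => False

/-- The face in strip `n - i` which begins at the left side of the rectangle. -/
def firstFace (i : Fin k) : WordFace ty w :=
  .strip ⟨(⟨ty.dim k - (i + 1), by omega⟩, ⊥), fun _ hp => by simp at hp⟩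

/-- The face in strip `n - i` immediately to the right of the graph of the letter `w p = ±i`. -/
def nextFace (p : Fin m) : WordFace ty w :=
  .strip ⟨(⟨ty.dim k - (w p).abs, by omega⟩, (p : WithBot (Fin m))), fun q hq => by
    have : p = q := WithBot.coe_injective hq
    subst this
    have h := (w p).idx.2
    right
    cases ty <;> simp only [TypeBC.dim, DoubleLetter.abs] <;> omega⟩

variable (ty w) in
/-- The faces whose weights give coordinates, in the order of the corresponding Fock–Goncharov
variables. -/
def coordFace : Fin k ⊕ Fin m → WordFace ty w
  | .inl i => firstFace i
  | .inr p => nextFace p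

/-- The geometric mean `√(y y') := √c y` of weights with `y' = c y`, where `c` is a positive real
number and `√c` is its positive root. -/
noncomputable def geomMean (y y' : ℂ) : ℂ := y * (y' / y) ^ (1 / 2 : ℂ)

/-- The face weight coordinate attached to a face. -/
noncomputable def faceCoord (Y : (wordGraph ty w).ProjWeighting) (f : WordFace ty w) : ℂ :=
  match ty with
  | .C => PlabicGraph.extend Y f
  | .B => geomMean (PlabicGraph.extend Y f) (PlabicGraph.extend Y f.reflect)

end WordGraph

/-! ### The groups, double Bruhat cells -/

section Groups

/-- The form `Ω_n = ∑ (-1)^(i+1) E_{i, n+1-i}` (labels `i` from `1` to `n`). -/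
def formOmega (n : ℕ) : Matrix (Fin n) (Fin n) ℂ :=
  fun i j => if j = i.rev then (-1) ^ (i : ℕ) else 0

/-- The elements of determinant `1` in `G(Ω_n)`: the group `Sp_n` for even `n`, and `SO_n` for odd
`n`.  The adjoint group is its image in `PGL_n`: this is `PSp_n` for even `n`; for odd `n` the only
scalar matrix in `SO_n` is the identity, so that it is `SO_n` itself. -/
def isometryGroup (n : ℕ) : Subgroup (GL (Fin n) ℂ) where
  carrier := {A | (A : Matrix (Fin n) (Fin n) ℂ) * formOmega n * (A : Matrix (Fin n) (Fin n) ℂ).transpose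
    = formOmega n ∧ (A : Matrix (Fin n) (Fin n) ℂ).det = 1}
  one_mem' := by simp
  mul_mem' := by
    rintro A B ⟨hA, hA'⟩ ⟨hB, hB'⟩
    refine ⟨?_, by simp [hA', hB']⟩
    rw [Units.val_mul, Matrix.transpose_mul]
    calc (A : Matrix (Fin n) (Fin n) ℂ) * B * formOmega n *
          ((B : Matrix (Fin n) (Fin n) ℂ).transpose * (A : Matrix (Fin n) (Fin n) ℂ).transpose)
        = A * (B * formOmega n * (B : Matrix (Fin n) (Fin n) ℂ).transpose) *
          (A : Matrix (Fin n) (Fin n) ℂ).transpose := by simp only [mul_assoc]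
      _ = _ := by rw [hB, hA]
  inv_mem' := by
    rintro A ⟨hA, hA'⟩
    have h1 : ((A⁻¹ : GL (Fin n) ℂ) : Matrix (Fin n) (Fin n) ℂ) * A = 1 := Units.inv_mul A
    refine ⟨?_, ?_⟩
    · have h2 : (A : Matrix (Fin n) (Fin n) ℂ).transpose *
          ((A⁻¹ : GL (Fin n) ℂ) : Matrix (Fin n) (Fin n) ℂ).transpose = 1 := by
        rw [← Matrix.transpose_mul, h1, Matrix.transpose_one]
      conv_lhs => rw [← hA]
      calc ((A⁻¹ : GL (Fin n) ℂ) : Matrix (Fin n) (Fin n) ℂ) *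
            (A * formOmega n * (A : Matrix (Fin n) (Fin n) ℂ).transpose) *
            ((A⁻¹ : GL (Fin n) ℂ) : Matrix (Fin n) (Fin n) ℂ).transpose
          = (((A⁻¹ : GL (Fin n) ℂ) : Matrix (Fin n) (Fin n) ℂ) * A) * formOmega n *
            ((A : Matrix (Fin n) (Fin n) ℂ).transpose *
            ((A⁻¹ : GL (Fin n) ℂ) : Matrix (Fin n) (Fin n) ℂ).transpose) := by
              simp only [mul_assoc]
        _ = _ := by rw [h1, h2, one_mul, mul_one]
    · have := congrArg Matrix.det h1
      rwa [Matrix.det_mul, hA', mul_one, Matrix.det_one] at this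

/-- The upper Borel subgroup of the adjoint group. -/
def upperBorel (n : ℕ) : Set PGL(n, ℂ) :=
  Matrix.ProjGenLinGroup.mk ''
    {A | A ∈ isometryGroup n ∧ ∀ i j : Fin n, j < i → (A : Matrix (Fin n) (Fin n) ℂ) i j = 0}

/-- The lower Borel subgroup of the adjoint group. -/
def lowerBorel (n : ℕ) : Set PGL(n, ℂ) :=
  Matrix.ProjGenLinGroup.mk ''
    {A | A ∈ isometryGroup n ∧ ∀ i j : Fin n, i < j → (A : Matrix (Fin n) (Fin n) ℂ) i j = 0}

/-- Representatives of a Weyl group element.  The normalizer of the torus of diagonal elements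
consists of the monomial matrices in the group, and the Weyl group is identified with the group of
the permutations by which these matrices permute the coordinate lines. -/
def IsWeylRep {n : ℕ} (w : Equiv.Perm (Fin n)) (A : GL (Fin n) ℂ) : Prop :=
  A ∈ isometryGroup n ∧ ∀ i j : Fin n, (A : Matrix (Fin n) (Fin n) ℂ) i j ≠ 0 → i = w j

/-- The double coset `B w B` in the adjoint group. -/
def bruhatCell {n : ℕ} (B : Set PGL(n, ℂ)) (w : Equiv.Perm (Fin n)) : Set PGL(n, ℂ) :=
  {g | ∃ b ∈ B, ∃ A, IsWeylRep w A ∧ ∃ b' ∈ B, g = b * Matrix.ProjGenLinGroup.mk A * b'}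

/-- The double Bruhat cell `G^{u,v} = B₊ u B₊ ∩ B₋ v B₋` of the adjoint group. -/
def doubleBruhatCell {n : ℕ} (u v : Equiv.Perm (Fin n)) : Set PGL(n, ℂ) :=
  bruhatCell (upperBorel n) u ∩ bruhatCell (lowerBorel n) v

/-- Zariski density of `S` in `T`, for sets in the adjoint group: every polynomial in the matrix
entries that vanishes on all representatives of elements of `S` vanishes on all representatives of
elements of `T`. -/
def IsZariskiDenseIn {n : ℕ} (S T : Set PGL(n, ℂ)) : Prop :=
  S ⊆ T ∧ ∀ f : MvPolynomial (Fin n × Fin n) ℂ,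
    (∀ A ∈ isometryGroup n, Matrix.ProjGenLinGroup.mk A ∈ S →
      MvPolynomial.eval (fun ij => (A : Matrix (Fin n) (Fin n) ℂ) ij.1 ij.2) f = 0) →
    ∀ A ∈ isometryGroup n, Matrix.ProjGenLinGroup.mk A ∈ T →
      MvPolynomial.eval (fun ij => (A : Matrix (Fin n) (Fin n) ℂ) ij.1 ij.2) f = 0

variable {k : ℕ} (ty : TypeBC)

/-- The coordinate with label `i + 1`. -/
def coordinate (i : Fin k) : Fin (ty.dim k) :=
  ⟨i, by have := i.2; cases ty <;> simp only [TypeBC.dim] <;> omega⟩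

/-- Simple reflections in the Weyl group, as permutations of `{1, …, n}`: the transposition
`(k, n + 1 - k)` for the last root, and `(i, i + 1) (n + 1 - i, n - i)` for `i < k`. -/
def simpleReflection (i : Fin k) : Equiv.Perm (Fin (ty.dim k)) :=
  if h : (i : ℕ) + 1 < k then
    Equiv.swap (coordinate ty i) (coordinate ty ⟨i + 1, h⟩) *
      Equiv.swap (coordinate ty i).rev (coordinate ty ⟨i + 1, h⟩).rev
  else Equiv.swap (coordinate ty i) (coordinate ty i).rev

/-- The product of the simple reflections of those letters of the word that have the given sign. -/
def weylElement (sign : Bool) {m : ℕ} (w : Fin m → DoubleLetter k) :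
    Equiv.Perm (Fin (ty.dim k)) :=
  (List.ofFn fun p => if (w p).pos = sign then simpleReflection ty (w p).idx else 1).prod

/-- The double word `w` represents `(u, v)`; negative letters belong to the first factor. -/
def Represents {m : ℕ} (w : Fin m → DoubleLetter k) (u v : Equiv.Perm (Fin (ty.dim k))) : Prop :=
  weylElement ty false w = u ∧ weylElement ty true w = v

/-- `w` is a reduced double word representing `(u, v)`: no shorter double word does. -/
def IsReducedWordOf {m : ℕ} (w : Fin m → DoubleLetter k) (u v : Equiv.Perm (Fin (ty.dim k))) :
    Prop :=
  Represents ty w u v ∧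
    ∀ (m' : ℕ) (w' : Fin m' → DoubleLetter k), Represents ty w' u v → m ≤ m'

/-! ### Fock–Goncharov coordinates -/

/-- The matrix unit `E_{a,b}`, with labels `a`, `b` from `1` to `n`. -/
def matrixUnit (n a b : ℕ) : Matrix (Fin n) (Fin n) ℂ :=
  fun i j => if (i : ℕ) + 1 = a ∧ (j : ℕ) + 1 = b then 1 else 0

/-- The Chevalley generators `E_i`, `i = 1, …, k`. -/
noncomputable def chevalleyE (k : ℕ) (i : ℕ) : Matrix (Fin (ty.dim k)) (Fin (ty.dim k)) ℂ :=
  if i < k then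
    matrixUnit (ty.dim k) i (i + 1) + matrixUnit (ty.dim k) (ty.dim k - i) (ty.dim k - i + 1)
  else match ty with
    | .C => matrixUnit _ k (k + 1)
    | .B => ((Real.sqrt 2 : ℝ) : ℂ) • (matrixUnit _ k (k + 1) + matrixUnit _ (k + 1) (k + 2))

/-- The Chevalley generators `F_i`, `i = 1, …, k`. -/
noncomputable def chevalleyF (k : ℕ) (i : ℕ) : Matrix (Fin (ty.dim k)) (Fin (ty.dim k)) ℂ :=
  (chevalleyE ty k i).transpose

/-- `∑_{j ≤ i} (E_{j,j} - E_{n+1-j,n+1-j})`. -/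
noncomputable def coweightSum (n i : ℕ) : Matrix (Fin n) (Fin n) ℂ :=
  ∑ j ∈ Finset.Icc 1 i, (matrixUnit n j j - matrixUnit n (n + 1 - j) (n + 1 - j))

/-- The fundamental coweights `H^i`, `i = 1, …, k`: the basis dual to the simple roots. -/
noncomputable def coweight (k : ℕ) (i : ℕ) : Matrix (Fin (ty.dim k)) (Fin (ty.dim k)) ℂ :=
  match ty with
  | .C => if i < k then coweightSum _ i else (1 / 2 : ℂ) • coweightSum _ i
  | .B => coweightSum _ i

/-- The matrix exponential with values in `PGL_n`. -/
noncomputable def expPGL {n : ℕ} (A : Matrix (Fin n) (Fin n) ℂ) : PGL(n, ℂ) :=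
  Matrix.ProjGenLinGroup.mk (Matrix.isUnit_exp A).unit

/-- `X_i = exp E_i` and `X_{-i} = exp F_i`. -/
noncomputable def letterX (x : DoubleLetter k) : PGL(ty.dim k, ℂ) :=
  expPGL (if x.pos then chevalleyE ty k x.abs else chevalleyF ty k x.abs)

/-- The cocharacters `Y_i(t) = exp(H^i log t)`. -/
noncomputable def cocharacterY (k i : ℕ) (t : ℂˣ) : PGL(ty.dim k, ℂ) :=
  expPGL (Complex.log t • coweight ty k i)

/-- The Fock–Goncharov parametrization attached to a double word: the product of the `X_{w p}` with
`Y`'s inserted, so that any two consecutive `Y_i` are separated by exactly one `X_{±i}`.  The first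
`Y_i`, with the variable `t (inl i)`, is placed at the beginning; each other `Y_i`, with the variable
`t (inr p)`, is placed right after the corresponding `X_{w p} = X_{±i}`. -/
noncomputable def fockGoncharov {m : ℕ} (w : Fin m → DoubleLetter k) (t : Fin k ⊕ Fin m → ℂˣ) :
    PGL(ty.dim k, ℂ) :=
  (List.ofFn fun i : Fin k => cocharacterY ty k (i + 1) (t (.inl i))).prod *
    (List.ofFn fun p : Fin m => letterX ty (w p) * cocharacterY ty k (w p).abs (t (.inr p))).prod

end Groups

/-! ### Reduced double words and the exchange property in the hyperoctahedral group -/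

section Permutations

variable {k : ℕ} (ty : TypeBC)

/-! The proof has a half about the group, a half about the graph, and an identity of path sums that
joins them.

Group half. A diagonal matrix can be moved past `exp E_i` or `exp F_i` at the cost of rescaling the
parameter. The Fock–Goncharov product is therefore a product of non-trivial root subgroup elements
`x_{±i}(c)`, in the order of the word, times a torus element (`fockGoncharov_succ`, `wordSet`). A
reduced double word, read from right to left, lengthens the Weyl group element of the sign concerned
at every letter; this is the exchange property (`isAscending_of_minimal`). Hence the rule `BsB · BσB
= BsσB` for lengthening `s` puts the products into `G^{u,v}` (`wordSet_subset`). Disjointness of the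
cells makes the parameter of the first letter unique, and peeling off letters gives injectivity
(`fockGoncharov_injective`). Density holds already for the classical topology: a point `A` of the
cell is deformed to `A L = x_i(s) A U` with `U` upper triangular and `L` lower triangular near `1`.
For small `s ≠ 0` this has the form `x_{-i}(c) A'` with `A'` in the smaller cell
(`eq_zero_of_forall_rootElement_neg_mul`). Statements about lower triangular matrices follow from
the upper triangular ones through conjugation by the reversal of the coordinates.

Graph half. The orientation with all horizontal edges pointing right is perfect and carries a height
function. This makes it acyclic and the only perfect orientation (`IsPerfect.eq_of_height`). Its
boundary measurements are determined by the recursion for path sums, so it is enough to exhibit a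
solution of that recursion (`IsPathPotential`). The solution is built from the rows of the partial
Fock–Goncharov products, rescaled wire by wire by a gauge. The gauge compares the edge weights along
a wire with the diagonal entries of the `Y`'s. That it does what is needed at every rung is read off
from the product of all face weights of a strip in front of that rung: almost all edges cancel in it
(`prod_stripFaces_wordFaceWeight`), and on the other side the Fock–Goncharov variables of these
faces multiply to a simple root of the accumulated torus element (`prod_stripFaces_eq_canonDiag`).

Squares. Under move-symmetry a square has weight `y` with `y⁻¹ = y` and `1 + y ≠ 0`, so `y = 1`. The
square moves then multiply the neighbouring weights by `2` or `1/2`, and a weight is its coordinate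
times a product of factors `√2^{±1}` which is inverted by the reflection (`faceScale`, `isMS_iff`).
In type `B` these factors are what is needed to match the Chevalley generator with its `√2`. With `y
= 1` the two ways around the square have equal weight, and each contributes `1/√2` after the gauge.
Their sum is the entry `√2` of the 3×3 block of the exponential (`square_transfer`). In type `C`
there are no squares and all scaling factors are `1`. -/

theorem TypeBC.two_mul_le_dim (k : ℕ) : 2 * k ≤ ty.dim k := by
  cases ty <;> simp only [TypeBC.dim] <;> omega

/-- The second coordinate moved by a simple reflection; the first one is `coordinate ty i`. -/
def upperCoordinate (i : Fin k) : Fin (ty.dim k) :=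
  if h : (i : ℕ) + 1 < k then coordinate ty ⟨i + 1, h⟩ else (coordinate ty i).rev

/-- Permutations commuting with the reversal of `Fin n`. -/
def CommutesRev {n : ℕ} (σ : Equiv.Perm (Fin n)) : Prop := ∀ x, σ x.rev = (σ x).rev

theorem CommutesRev.one {n : ℕ} : CommutesRev (1 : Equiv.Perm (Fin n)) := fun _ => rfl

theorem CommutesRev.mul {n : ℕ} {σ τ : Equiv.Perm (Fin n)} (hσ : CommutesRev σ)
    (hτ : CommutesRev τ) : CommutesRev (σ * τ) := fun x => by
  rw [Equiv.Perm.mul_apply, Equiv.Perm.mul_apply, hτ, hσ]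

theorem CommutesRev.inv {n : ℕ} {σ : Equiv.Perm (Fin n)} (hσ : CommutesRev σ) :
    CommutesRev σ⁻¹ := fun x => by
  apply σ.injective
  rw [hσ]; simp

theorem simpleReflection_apply_val (i : Fin k) (x : Fin (ty.dim k)) :
    ((simpleReflection ty i x : Fin (ty.dim k)) : ℕ) =
      if (i : ℕ) + 1 < k then
        if (x : ℕ) = i then (i : ℕ) + 1 else if (x : ℕ) = i + 1 then (i : ℕ)
        else if (x : ℕ) + 1 + i = ty.dim k then ty.dim k - (i + 2)
        else if (x : ℕ) + 2 + i = ty.dim k then ty.dim k - (i + 1) else x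
      else if (x : ℕ) = i then ty.dim k - (i + 1)
        else if (x : ℕ) + 1 + i = ty.dim k then (i : ℕ) else x := by
  have hd := ty.two_mul_le_dim k
  have hi := i.2
  have hx := x.2
  unfold simpleReflection
  split_ifs with h <;>
  simp only [Equiv.Perm.mul_apply, Equiv.swap_apply_def, coordinate, Fin.ext_iff, Fin.val_rev] <;>
  split_ifs <;> simp_all [Fin.ext_iff, Fin.val_rev] <;> omega

theorem simpleReflection_commutesRev (i : Fin k) : CommutesRev (simpleReflection ty i) := by
  intro x
  have hd := ty.two_mul_le_dim k
  have hi := i.2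
  have hx := x.2
  rw [Fin.ext_iff, Fin.val_rev, simpleReflection_apply_val, simpleReflection_apply_val,
    Fin.val_rev]
  split_ifs <;> omega

theorem simpleReflection_mul_self (i : Fin k) :
    simpleReflection ty i * simpleReflection ty i = 1 := by
  ext x
  have hd := ty.two_mul_le_dim k
  have hi := i.2
  have hx := x.2
  rw [Equiv.Perm.mul_apply, simpleReflection_apply_val, simpleReflection_apply_val]
  simp only [Equiv.Perm.one_apply]
  split_ifs <;> omega

theorem simpleReflection_inv (i : Fin k) : (simpleReflection ty i)⁻¹ = simpleReflection ty i :=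
  inv_eq_of_mul_eq_one_left (simpleReflection_mul_self ty i)

theorem simpleReflection_ne_one (i : Fin k) : simpleReflection ty i ≠ 1 := by
  intro h
  have hd := ty.two_mul_le_dim k
  have hi := i.2
  have := simpleReflection_apply_val ty i (coordinate ty i)
  rw [h] at this
  simp only [Equiv.Perm.one_apply, coordinate] at this
  split_ifs at this <;> omega

theorem upperCoordinate_val (i : Fin k) :
    (upperCoordinate ty i : ℕ) = if (i : ℕ) + 1 < k then (i : ℕ) + 1 else ty.dim k - (i + 1) := by
  unfold upperCoordinate
  split_ifs <;> simp [coordinate, Fin.val_rev]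

theorem coordinate_val (i : Fin k) : (coordinate ty i : ℕ) = i := rfl

theorem coordinate_lt_upperCoordinate (i : Fin k) : coordinate ty i < upperCoordinate ty i := by
  have hd := ty.two_mul_le_dim k
  have hi := i.2
  rw [Fin.lt_def, upperCoordinate_val, coordinate_val]
  split_ifs <;> omega

/-- The pairs of coordinates, away from the middle one, whose order is reversed by a simple
reflection. -/
theorem eq_of_simpleReflection_lt (j : Fin k) {x y : Fin (ty.dim k)} (hxy : x < y)
    (hx : x ≠ x.rev) (hy : y ≠ y.rev)
    (h : simpleReflection ty j y < simpleReflection ty j x) :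
    (x = coordinate ty j ∧ y = upperCoordinate ty j) ∨
      (x = (upperCoordinate ty j).rev ∧ y = (coordinate ty j).rev) := by
  have hd := ty.two_mul_le_dim k
  have hj := j.2
  have hx' := x.2
  have hy' := y.2
  simp only [Fin.lt_def, Fin.ext_iff, Fin.val_rev, simpleReflection_apply_val,
    upperCoordinate_val, coordinate_val, ne_eq] at *
  have : ty.dim k ≤ 2 * k + 1 := by cases ty <;> simp [TypeBC.dim]
  split_ifs at * <;> omega

theorem simpleReflection_eq (i : Fin k) :
    simpleReflection ty i = if upperCoordinate ty i = (coordinate ty i).rev then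
      Equiv.swap (coordinate ty i) (upperCoordinate ty i) else
      Equiv.swap (coordinate ty i) (upperCoordinate ty i) *
        Equiv.swap (coordinate ty i).rev (upperCoordinate ty i).rev := by
  have hd := ty.two_mul_le_dim k
  have hi := i.2
  unfold simpleReflection upperCoordinate
  split_ifs with h h'
  · exfalso
    rw [Fin.ext_iff, Fin.val_rev, coordinate_val, coordinate_val] at h'
    simp only at h'
    omega
  · rfl
  · rfl
  · exact absurd rfl ‹_›

theorem conj_swap {α : Type*} [DecidableEq α] (σ : Equiv.Perm α) (x y : α) :
    σ * Equiv.swap x y * σ⁻¹ = Equiv.swap (σ x) (σ y) := by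
  rw [Equiv.mul_swap_eq_swap_mul, mul_inv_cancel_right]

/-- Conjugation transports transpositions. The hypothesis says that `σ` carries the pair of the
`i`-th simple root to that of the `j`-th, possibly written as its mirror image, which defines the
same reflection. -/
theorem conj_simpleReflection {σ : Equiv.Perm (Fin (ty.dim k))} (hσ : CommutesRev σ) (i j : Fin k)
    (h : (σ (coordinate ty i) = coordinate ty j ∧ σ (upperCoordinate ty i) = upperCoordinate ty j) ∨
      (σ (coordinate ty i) = (upperCoordinate ty j).rev ∧
        σ (upperCoordinate ty i) = (coordinate ty j).rev)) :
    σ * simpleReflection ty i * σ⁻¹ = simpleReflection ty j := by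
  -- A pair that is its own mirror image gives a single transposition, any other pair gives two;
  -- since `σ` commutes with the reversal it preserves this alternative.
  have key : upperCoordinate ty i = (coordinate ty i).rev ↔
      upperCoordinate ty j = (coordinate ty j).rev := by
    rw [← σ.injective.eq_iff, hσ]
    rcases h with ⟨h1, h2⟩ | ⟨h1, h2⟩
    · rw [h1, h2]
    · rw [h1, h2, Fin.rev_rev]; exact eq_comm
  have hm : ∀ s t : Equiv.Perm (Fin (ty.dim k)), σ * (s * t) * σ⁻¹ = (σ * s * σ⁻¹) * (σ * t * σ⁻¹) :=
    fun s t => by group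
  rw [simpleReflection_eq, simpleReflection_eq]
  simp only [key]
  split_ifs with hc
  · rw [conj_swap]
    rcases h with ⟨h1, h2⟩ | ⟨h1, h2⟩
    · rw [h1, h2]
    · rw [h1, h2, hc, Fin.rev_rev]
  · rw [hm, conj_swap, conj_swap, hσ, hσ]
    rcases h with ⟨h1, h2⟩ | ⟨h1, h2⟩
    · rw [h1, h2]
    · rw [h1, h2, Fin.rev_rev, Fin.rev_rev, Equiv.swap_comm (upperCoordinate ty j).rev,
        Equiv.swap_comm (upperCoordinate ty j)]
      have := simpleReflection_inv ty j
      rw [simpleReflection_eq, if_neg hc, mul_inv_rev, Equiv.swap_inv, Equiv.swap_inv] at this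
      exact this

theorem ne_rev_of_commutesRev {n : ℕ} {σ : Equiv.Perm (Fin n)} (hσ : CommutesRev σ) {x : Fin n}
    (hx : x ≠ x.rev) : σ x ≠ (σ x).rev := by
  rw [← hσ]; exact fun h => hx (σ.injective h)

theorem coordinate_ne_rev (i : Fin k) : coordinate ty i ≠ (coordinate ty i).rev := by
  have hd := ty.two_mul_le_dim k
  have hi := i.2
  rw [Ne, Fin.ext_iff, Fin.val_rev, coordinate_val]; omega

theorem upperCoordinate_ne_rev (i : Fin k) : upperCoordinate ty i ≠ (upperCoordinate ty i).rev := by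
  have hd := ty.two_mul_le_dim k
  have hi := i.2
  rw [Ne, Fin.ext_iff, Fin.val_rev, upperCoordinate_val]
  split_ifs <;> omega

theorem prod_simpleReflection_commutesRev (L : List (Fin k)) :
    CommutesRev (L.map (simpleReflection ty)).prod := by
  induction L with
  | nil => exact CommutesRev.one
  | cons j L ih => exact (simpleReflection_commutesRev ty j).mul ih

/-- The exchange property, for a reflection conjugate to a simple one. -/
theorem exists_conj_simpleReflection_mul_prod (i : Fin k) (L : List (Fin k)) :
    ∀ σ : Equiv.Perm (Fin (ty.dim k)), CommutesRev σ →
      σ (coordinate ty i) < σ (upperCoordinate ty i) →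
      (L.map (simpleReflection ty)).prod⁻¹ (σ (upperCoordinate ty i)) <
        (L.map (simpleReflection ty)).prod⁻¹ (σ (coordinate ty i)) →
      ∃ L' : List (Fin k), L'.length + 1 = L.length ∧
        σ * simpleReflection ty i * σ⁻¹ * (L.map (simpleReflection ty)).prod =
          (L'.map (simpleReflection ty)).prod := by
  induction L with
  | nil =>
    intro σ _ h1 h2
    simp only [List.map_nil, List.prod_nil, inv_one, Equiv.Perm.one_apply] at h2
    exact absurd h1 h2.asymm
  | cons j L ih =>
    intro σ hσ h1 h2
    rw [List.map_cons, List.prod_cons] at h2 ⊢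
    rw [mul_inv_rev, simpleReflection_inv, Equiv.Perm.mul_apply, Equiv.Perm.mul_apply] at h2
    by_cases h3 : simpleReflection ty j (σ (coordinate ty i)) <
        simpleReflection ty j (σ (upperCoordinate ty i))
    · obtain ⟨L', hL', h⟩ := ih (simpleReflection ty j * σ)
        ((simpleReflection_commutesRev ty j).mul hσ) h3 h2
      refine ⟨j :: L', by simp [hL'], ?_⟩
      rw [List.map_cons, List.prod_cons, ← h, mul_inv_rev, simpleReflection_inv]
      have := simpleReflection_mul_self ty j
      calc _ = 1 * σ * simpleReflection ty i * σ⁻¹ *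
            (simpleReflection ty j * (L.map (simpleReflection ty)).prod) := by rw [one_mul]
        _ = _ := by rw [← this]; group
    -- The root turns negative exactly at the letter `j`. The only positive root that a simple
    -- reflection makes negative is its own simple root, so the conjugated reflection is the `j`-th
    -- one and deletes this letter.
    · have h4 := lt_of_le_of_ne (not_lt.mp h3) (fun h => h1.ne
        ((simpleReflection ty j).injective h).symm)
      have h5 := conj_simpleReflection ty hσ i j (eq_of_simpleReflection_lt ty j h1
        (ne_rev_of_commutesRev hσ (coordinate_ne_rev ty i))
        (ne_rev_of_commutesRev hσ (upperCoordinate_ne_rev ty i)) h4)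
      refine ⟨L, by simp, ?_⟩
      rw [h5, ← mul_assoc, simpleReflection_mul_self, one_mul]

/-- The Weyl group elements of double words given as lists. -/
def weylList (sign : Bool) (l : List (DoubleLetter k)) : Equiv.Perm (Fin (ty.dim k)) :=
  (l.map fun x => if x.pos = sign then simpleReflection ty x.idx else 1).prod

theorem weylElement_eq_weylList (sign : Bool) {m : ℕ} (w : Fin m → DoubleLetter k) :
    weylElement ty sign w = weylList ty sign (List.ofFn w) := by
  rw [weylElement, weylList, List.map_ofFn]; rfl

theorem weylList_eq_prod_filter (sign : Bool) (l : List (DoubleLetter k)) :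
    weylList ty sign l =
      (((l.filter fun x => x.pos = sign).map DoubleLetter.idx).map (simpleReflection ty)).prod := by
  induction l with
  | nil => rfl
  | cons x l ih =>
    unfold weylList at ih ⊢
    rw [List.map_cons, List.prod_cons, ih]
    by_cases h : x.pos = sign <;> simp [h]

theorem weylList_commutesRev (sign : Bool) (l : List (DoubleLetter k)) :
    CommutesRev (weylList ty sign l) := by
  rw [weylList_eq_prod_filter]; exact prod_simpleReflection_commutesRev ty _

/-- Left multiplication of `σ` by the simple reflection `i` makes `σ` longer. -/
def IsAscent (σ : Equiv.Perm (Fin (ty.dim k))) (i : Fin k) : Prop :=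
  σ⁻¹ (coordinate ty i) < σ⁻¹ (upperCoordinate ty i)

/-- Double words whose letters successively, from right to left, increase the lengths of the two
Weyl group elements. -/
def IsAscending : List (DoubleLetter k) → Prop
  | [] => True
  | x :: l => IsAscent ty (weylList ty x.pos l) x.idx ∧ IsAscending l

theorem length_filter_add_length_filter (s : Bool) (l : List (DoubleLetter k)) :
    (l.filter fun x => x.pos = s).length + (l.filter fun x => x.pos = !s).length = l.length := by
  induction l with
  | nil => rfl
  | cons x l ih =>
    cases s <;> cases hx : x.pos <;> simp [hx] at ih ⊢ <;> omega

theorem weylList_cons (s : Bool) (x : DoubleLetter k) (l : List (DoubleLetter k)) :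
    weylList ty s (x :: l) = (if x.pos = s then simpleReflection ty x.idx else 1) * weylList ty s l := by
  simp [weylList]

theorem weylList_append (s : Bool) (l l' : List (DoubleLetter k)) :
    weylList ty s (l ++ l') = weylList ty s l * weylList ty s l' := by
  simp [weylList]

theorem weylList_map_mk (s : Bool) (L : List (Fin k)) :
    weylList ty s (L.map fun i => ⟨i, s⟩) = (L.map (simpleReflection ty)).prod := by
  simp [weylList, Function.comp_def]

theorem weylList_map_mk_not (s : Bool) (L : List (Fin k)) :
    weylList ty s (L.map fun i => ⟨i, !s⟩) = 1 := by
  induction L with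
  | nil => rfl
  | cons j L ih => rw [List.map_cons, weylList_cons, ih]; simp

/-- If the first letter does not lengthen the element of its sign, exchange absorbs it by deleting a
letter of the same sign further right. Only the two products of equal signs matter, so the remaining
letters may be regrouped by sign into a double word that is too short. -/
theorem isAscending_of_minimal (l : List (DoubleLetter k))
    (h : ∀ l' : List (DoubleLetter k), (∀ s, weylList ty s l' = weylList ty s l) →
      l.length ≤ l'.length) : IsAscending ty l := by
  induction l with
  | nil => trivial
  | cons x l ih =>
    refine ⟨?_, ih fun l' hl' => ?_⟩
    · by_contra hasc
      have h2 : (weylList ty x.pos l)⁻¹ (upperCoordinate ty x.idx) <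
          (weylList ty x.pos l)⁻¹ (coordinate ty x.idx) :=
        lt_of_le_of_ne (not_lt.mp hasc) fun he =>
          (coordinate_lt_upperCoordinate ty x.idx).ne (Equiv.injective _ he).symm
      rw [weylList_eq_prod_filter] at h2
      obtain ⟨L', hL', h3⟩ := exists_conj_simpleReflection_mul_prod ty x.idx _ 1 CommutesRev.one
        (coordinate_lt_upperCoordinate ty x.idx) h2
      simp only [one_mul, inv_one, mul_one] at h3
      set M := (l.filter fun y => y.pos = !x.pos).map DoubleLetter.idx with hM
      -- The competing word: the shortened word in the sign of `x`, followed by all letters of the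
      -- other sign.
      have := h (L'.map (fun i => ⟨i, x.pos⟩) ++ M.map fun i => ⟨i, !x.pos⟩) ?_
      · have h5 := length_filter_add_length_filter x.pos l
        simp only [List.length_append, List.length_map, hM, List.length_cons] at this hL' h5
        omega
      · intro s
        by_cases hs : s = x.pos
        · subst hs
          rw [weylList_append, weylList_map_mk, weylList_map_mk_not, mul_one, ← h3, weylList_cons,
            if_pos rfl, ← weylList_eq_prod_filter]
        · have hs' : s = !x.pos := by cases s <;> cases hx : x.pos <;> simp_all
          have hx : x.pos = !s := by rw [hs', Bool.not_not]
          rw [weylList_append, weylList_cons, if_neg (Ne.symm hs), ← hs', hx,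
            weylList_map_mk_not, weylList_map_mk, one_mul, one_mul, hM, ← hs',
            ← weylList_eq_prod_filter]
    · have := h (x :: l') fun s => by rw [weylList_cons, weylList_cons, hl']
      simpa using this

theorem IsReducedWordOf.isAscending {m : ℕ} {w : Fin m → DoubleLetter k}
    {u v : Equiv.Perm (Fin (ty.dim k))} (h : IsReducedWordOf ty w u v) :
    IsAscending ty (List.ofFn w) := by
  apply isAscending_of_minimal
  intro l' hl'
  have := h.2 l'.length l'.get ⟨?_, ?_⟩
  · simpa using this
  · rw [weylElement_eq_weylList, List.ofFn_get, hl', ← weylElement_eq_weylList]; exact h.1.1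
  · rw [weylElement_eq_weylList, List.ofFn_get, hl', ← weylElement_eq_weylList]; exact h.1.2

end Permutations

/-! ### Exponentials of matrices with vanishing cube -/

section Unipotent

variable {ι : Type*} [Fintype ι] [DecidableEq ι]

/-- The exponential of `c N`, for matrices with `N ^ 3 = 0`. -/
noncomputable def quadExp (N : Matrix ι ι ℂ) (c : ℂ) : Matrix ι ι ℂ :=
  1 + c • N + (c ^ 2 / 2) • N ^ 2

theorem quadExp_zero (N : Matrix ι ι ℂ) : quadExp N 0 = 1 := by simp [quadExp]

theorem quadExp_mul {N : Matrix ι ι ℂ} (hN : N ^ 3 = 0) (c d : ℂ) :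
    quadExp N c * quadExp N d = quadExp N (c + d) := by
  have h4 : N ^ 4 = 0 := by rw [pow_succ, hN, zero_mul]
  simp only [quadExp, add_mul, mul_add, one_mul, mul_one, Matrix.smul_mul, Matrix.mul_smul,
    smul_smul, ← pow_succ, ← pow_succ', ← sq, hN, smul_zero, add_zero]
  rw [← pow_mul, h4]
  module

theorem quadExp_transpose (N : Matrix ι ι ℂ) (c : ℂ) :
    (quadExp N c).transpose = quadExp N.transpose c := by
  simp [quadExp, Matrix.transpose_pow]

theorem exp_eq_quadExp {N : Matrix ι ι ℂ} (hN : N ^ 3 = 0) :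
    NormedSpace.exp N = quadExp N 1 := by
  rw [NormedSpace.exp_eq_tsum ℂ]
  show ∑' n : ℕ, _ = _
  rw [tsum_eq_sum (s := Finset.range 3)]
  · simp [Finset.sum_range_succ, quadExp]
  · intro b hb
    rw [Finset.mem_range, not_lt] at hb
    rw [pow_eq_zero_of_le hb hN, smul_zero]

/-- The exponential of `c N` as an invertible matrix. -/
noncomputable def quadExpGL (N : Matrix ι ι ℂ) (hN : N ^ 3 = 0) (c : ℂ) : GL ι ℂ where
  val := quadExp N c
  inv := quadExp N (-c)
  val_inv := by rw [quadExp_mul hN, add_neg_cancel, quadExp_zero]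
  inv_val := by rw [quadExp_mul hN, neg_add_cancel, quadExp_zero]

end Unipotent

/-! ### The isometry group of the form, the reversal, and Bruhat cells -/

section Isometries

variable {n : ℕ}

theorem mul_formOmega_apply (A : Matrix (Fin n) (Fin n) ℂ) (a b : Fin n) :
    (A * formOmega n) a b = A a b.rev * (-1) ^ (b.rev : ℕ) := by
  rw [Matrix.mul_apply, Finset.sum_eq_single b.rev]
  · simp [formOmega]
  · intro c _ hc
    rw [formOmega, if_neg, mul_zero]
    rintro rfl; simp at hc
  · simp

theorem formOmega_mul_apply (A : Matrix (Fin n) (Fin n) ℂ) (a b : Fin n) :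
    (formOmega n * A) a b = (-1) ^ (a : ℕ) * A a.rev b := by
  rw [Matrix.mul_apply, Finset.sum_eq_single a.rev]
  · simp [formOmega]
  · intro c _ hc
    rw [formOmega, if_neg hc, zero_mul]
  · simp

theorem mul_formOmega_mul_transpose_apply (A : Matrix (Fin n) (Fin n) ℂ) (a b : Fin n) :
    (A * formOmega n * A.transpose) a b = ∑ c, A a c * (-1) ^ (c : ℕ) * A b c.rev := by
  rw [Matrix.mul_apply, ← Equiv.sum_comp Fin.revPerm]
  simp [mul_formOmega_apply]

theorem formOmega_mul_self : formOmega n * formOmega n = ((-1) ^ (n - 1) : ℂ) • 1 := by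
  ext a b
  rw [formOmega_mul_apply, Matrix.smul_apply, Matrix.one_apply, formOmega, Fin.rev_rev, Fin.val_rev]
  by_cases h : a = b
  · subst h
    simp only [if_true, smul_eq_mul, mul_one]
    rw [← pow_add]; congr 1; omega
  · simp [h, Ne.symm h]

theorem det_formOmega_ne_zero : (formOmega n).det ≠ 0 := by
  intro h
  have := congrArg Matrix.det (formOmega_mul_self (n := n))
  rw [Matrix.det_mul, h, zero_mul, Matrix.det_smul, Matrix.det_one, mul_one] at this
  exact (pow_ne_zero _ (pow_ne_zero _ (by norm_num))) this.symm

theorem formOmega_mul_cancel {A B : Matrix (Fin n) (Fin n) ℂ}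
    (h : formOmega n * A = formOmega n * B) : A = B := by
  have hu : IsUnit (formOmega n) :=
    (Matrix.isUnit_iff_isUnit_det _).mpr (isUnit_iff_ne_zero.mpr det_formOmega_ne_zero)
  exact hu.mul_left_cancel h

/-- The Lie algebra of the isometry group. -/
def IsSkew (N : Matrix (Fin n) (Fin n) ℂ) : Prop := N * formOmega n = -(formOmega n * N.transpose)

/-- Skewness moves the exponential past `Ω`, where it becomes the exponential of `-c Nᵗ` and cancels
against the transpose. The quadratic term keeps its sign because two signs arise. -/
theorem IsSkew.quadExp_mul {N : Matrix (Fin n) (Fin n) ℂ} (hN : IsSkew N) (h3 : N ^ 3 = 0) (c : ℂ) :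
    quadExp N c * formOmega n * (quadExp N c).transpose = formOmega n := by
  have h2 : N ^ 2 * formOmega n = formOmega n * N.transpose ^ 2 := by
    rw [sq, sq, mul_assoc, hN, mul_neg, ← mul_assoc, hN, neg_mul, neg_neg, mul_assoc]
  have h3' : N.transpose ^ 3 = 0 := by rw [← Matrix.transpose_pow, h3, Matrix.transpose_zero]
  have : quadExp N c * formOmega n = formOmega n * quadExp N.transpose (-c) := by
    simp only [quadExp, add_mul, mul_add, one_mul, mul_one, Matrix.smul_mul, Matrix.mul_smul, h2,
      neg_smul, neg_sq, IsSkew] at hN ⊢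
    rw [hN, mul_neg, Matrix.mul_smul, smul_neg]
  rw [this, quadExp_transpose, mul_assoc, _root_.quadExp_mul h3', neg_add_cancel, quadExp_zero,
    mul_one]

/-- Preservation of the form gives only `det ² = 1`. But `exp (cN)` is the square of `exp (cN/2)`,
so its determinant is such a square. -/
theorem quadExpGL_mem_isometryGroup {N : Matrix (Fin n) (Fin n) ℂ} (hN : IsSkew N) (h3 : N ^ 3 = 0)
    (c : ℂ) : quadExpGL N h3 c ∈ isometryGroup n := by
  refine ⟨hN.quadExp_mul h3 c, ?_⟩
  have h := congrArg Matrix.det (hN.quadExp_mul h3 (c / 2))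
  rw [Matrix.det_mul, Matrix.det_mul, Matrix.det_transpose, mul_right_comm] at h
  have h2 : (quadExp N (c / 2)).det * (quadExp N (c / 2)).det = 1 :=
    mul_right_cancel₀ det_formOmega_ne_zero (h.trans (one_mul _).symm)
  show (quadExp N c).det = 1
  rw [← h2, ← Matrix.det_mul, _root_.quadExp_mul h3, add_halves]

/-- Conjugation by the reversal of the coordinates. -/
noncomputable def flipGL : GL (Fin n) ℂ ≃* GL (Fin n) ℂ :=
  Units.mapEquiv (Matrix.reindexAlgEquiv ℂ ℂ Fin.revPerm).toMulEquiv

theorem flipGL_apply (A : GL (Fin n) ℂ) (i j : Fin n) :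
    (flipGL A : Matrix (Fin n) (Fin n) ℂ) i j = (A : Matrix (Fin n) (Fin n) ℂ) i.rev j.rev := rfl

theorem flipGL_flipGL (A : GL (Fin n) ℂ) : flipGL (flipGL A) = A := by
  ext i j; rw [flipGL_apply, flipGL_apply, Fin.rev_rev, Fin.rev_rev]

theorem neg_one_pow_rev (c : Fin n) : ((-1 : ℂ)) ^ (c.rev : ℕ) = (-1) ^ (n - 1) * (-1) ^ (c : ℕ) := by
  have : (c.rev : ℕ) + 2 * c = n - 1 + c := by rw [Fin.val_rev]; omega
  rw [← pow_add, ← this, pow_add, pow_mul]; simp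

theorem reindex_formOmega : Matrix.reindexAlgEquiv ℂ ℂ Fin.revPerm (formOmega n) =
    ((-1 : ℂ) ^ (n - 1)) • formOmega n := by
  ext a b
  simp only [Matrix.coe_reindexAlgEquiv, Matrix.reindex_apply, Matrix.submatrix_apply,
    Matrix.smul_apply, smul_eq_mul, formOmega, Fin.revPerm_symm, Fin.revPerm_apply, Fin.rev_rev]
  by_cases h : b = a.rev
  · subst h; rw [if_pos (Fin.rev_rev a), if_pos rfl, neg_one_pow_rev]
  · rw [if_neg h, if_neg, mul_zero]
    rintro rfl; exact h (Fin.rev_rev b).symm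

/-- The reversal multiplies the form by the scalar `(-1)^(n-1)`, which does not affect its
isometries. As it interchanges upper and lower triangular matrices, the lower Borel subgroup never
needs a separate treatment. -/
theorem flipGL_mem_isometryGroup {A : GL (Fin n) ℂ} (hA : A ∈ isometryGroup n) :
    flipGL A ∈ isometryGroup n := by
  refine ⟨?_, ?_⟩
  · have h := congrArg (Matrix.reindexAlgEquiv ℂ ℂ Fin.revPerm) hA.1
    rw [map_mul, map_mul, reindex_formOmega, Matrix.mul_smul, Matrix.smul_mul] at h
    exact smul_right_injective _ (pow_ne_zero (n - 1) (by norm_num : (-1 : ℂ) ≠ 0)) h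
  · show (Matrix.reindexAlgEquiv ℂ ℂ Fin.revPerm (A : Matrix (Fin n) (Fin n) ℂ)).det = 1
    rw [Matrix.det_reindexAlgEquiv]; exact hA.2

/-- The upper triangular isometries. -/
def upperIsometries (n : ℕ) : Subgroup (GL (Fin n) ℂ) where
  carrier := {A | A ∈ isometryGroup n ∧ (A : Matrix (Fin n) (Fin n) ℂ).BlockTriangular id}
  one_mem' := ⟨one_mem _, Matrix.blockTriangular_one⟩
  mul_mem' hA hB := ⟨mul_mem hA.1 hB.1, hA.2.mul hB.2⟩
  inv_mem' {A} hA := ⟨inv_mem hA.1, by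
    rw [Matrix.coe_units_inv]
    have : Invertible (A : Matrix (Fin n) (Fin n) ℂ) := A.invertible
    exact Matrix.blockTriangular_inv_of_blockTriangular hA.2⟩

theorem diag_ne_zero_of_blockTriangular {A : GL (Fin n) ℂ}
    (h : (A : Matrix (Fin n) (Fin n) ℂ).BlockTriangular id) (i : Fin n) :
    (A : Matrix (Fin n) (Fin n) ℂ) i i ≠ 0 := by
  have hd : (A : Matrix (Fin n) (Fin n) ℂ).det ≠ 0 :=
    ((Matrix.isUnit_iff_isUnit_det _).mp A.isUnit).ne_zero
  rw [Matrix.det_of_isUpperTriangular h, Finset.prod_ne_zero_iff] at hd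
  exact hd i (Finset.mem_univ i)

theorem perm_apply_inv_apply {α : Type*} (σ : Equiv.Perm α) (x : α) : σ (σ⁻¹ x) = x :=
  σ.apply_symm_apply x

theorem perm_inv_apply_apply {α : Type*} (σ : Equiv.Perm α) (x : α) : σ⁻¹ (σ x) = x :=
  σ.symm_apply_apply x

theorem IsWeylRep.mul {σ τ : Equiv.Perm (Fin n)} {A B : GL (Fin n) ℂ} (hA : IsWeylRep σ A)
    (hB : IsWeylRep τ B) : IsWeylRep (σ * τ) (A * B) := by
  refine ⟨mul_mem hA.1 hB.1, fun i j h => ?_⟩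
  rw [Units.val_mul, Matrix.mul_apply] at h
  obtain ⟨c, _, hc⟩ := Finset.exists_ne_zero_of_sum_ne_zero h
  rw [hA.2 i c (left_ne_zero_of_mul hc), hB.2 c j (right_ne_zero_of_mul hc)]; rfl

theorem IsWeylRep.mul_apply {σ : Equiv.Perm (Fin n)} {A : GL (Fin n) ℂ} (hA : IsWeylRep σ A)
    (B : Matrix (Fin n) (Fin n) ℂ) (i j : Fin n) :
    (B * (A : Matrix (Fin n) (Fin n) ℂ)) i j = B i (σ j) * (A : Matrix (Fin n) (Fin n) ℂ) (σ j) j := by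
  rw [Matrix.mul_apply, Finset.sum_eq_single (σ j)]
  · intro c _ hc
    rw [not_not.mp fun h => hc (hA.2 c j h), mul_zero]
  · simp

theorem IsWeylRep.apply_ne_zero {σ : Equiv.Perm (Fin n)} {A : GL (Fin n) ℂ} (hA : IsWeylRep σ A)
    (j : Fin n) : (A : Matrix (Fin n) (Fin n) ℂ) (σ j) j ≠ 0 := by
  intro h
  have h1 : ((A⁻¹ : GL (Fin n) ℂ) : Matrix (Fin n) (Fin n) ℂ) * A = 1 := Units.inv_mul A
  have h2 := congrFun (congrFun h1 j) j
  rw [hA.mul_apply, h] at h2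
  simp at h2

theorem IsWeylRep.inv {σ : Equiv.Perm (Fin n)} {A : GL (Fin n) ℂ} (hA : IsWeylRep σ A) :
    IsWeylRep σ⁻¹ A⁻¹ := by
  refine ⟨inv_mem hA.1, fun i j h => ?_⟩
  have h1 : ((A⁻¹ : GL (Fin n) ℂ) : Matrix (Fin n) (Fin n) ℂ) * A = 1 := Units.inv_mul A
  have h2 := congrFun (congrFun h1 i) (σ⁻¹ j)
  rw [hA.mul_apply, Matrix.one_apply, perm_apply_inv_apply] at h2
  by_contra hij
  have h3 := hA.apply_ne_zero (σ⁻¹ j)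
  rw [perm_apply_inv_apply] at h3
  rw [if_neg hij] at h2
  exact mul_ne_zero h h3 h2

theorem IsWeylRep.flipGL {σ : Equiv.Perm (Fin n)} (hσ : CommutesRev σ) {A : GL (Fin n) ℂ}
    (hA : IsWeylRep σ A) : IsWeylRep σ (flipGL A) :=
  ⟨flipGL_mem_isometryGroup hA.1, fun i j h => by
    have := hA.2 i.rev j.rev h
    rw [hσ] at this
    exact Fin.rev_injective this⟩

/-- The double coset of a Weyl group element in the isometry group. -/
def upperCell (σ : Equiv.Perm (Fin n)) : Set (GL (Fin n) ℂ) :=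
  {A | ∃ b ∈ upperIsometries n, ∃ N, IsWeylRep σ N ∧ ∃ b' ∈ upperIsometries n, A = b * N * b'}

theorem upperCell_mul_left {σ : Equiv.Perm (Fin n)} {A b : GL (Fin n) ℂ} (hA : A ∈ upperCell σ)
    (hb : b ∈ upperIsometries n) : b * A ∈ upperCell σ := by
  obtain ⟨b₁, h₁, N, hN, b₂, h₂, rfl⟩ := hA
  exact ⟨b * b₁, mul_mem hb h₁, N, hN, b₂, h₂, by simp only [mul_assoc]⟩

theorem upperCell_mul_right {σ : Equiv.Perm (Fin n)} {A b : GL (Fin n) ℂ} (hA : A ∈ upperCell σ)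
    (hb : b ∈ upperIsometries n) : A * b ∈ upperCell σ := by
  obtain ⟨b₁, h₁, N, hN, b₂, h₂, rfl⟩ := hA
  exact ⟨b₁, h₁, N, hN, b₂ * b, mul_mem h₂ hb, by simp only [mul_assoc]⟩

theorem mem_isometryGroup_of_mem_upperCell {σ : Equiv.Perm (Fin n)} {A : GL (Fin n) ℂ}
    (hA : A ∈ upperCell σ) : A ∈ isometryGroup n := by
  obtain ⟨b₁, h₁, N, hN, b₂, h₂, rfl⟩ := hA
  exact mul_mem (mul_mem h₁.1 hN.1) h₂.1

theorem perm_eq_one_of_le (σ : Equiv.Perm (Fin n)) (h : ∀ j, σ j ≤ j) : σ = 1 := by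
  have key : ∀ m : ℕ, ∀ j : Fin n, (j : ℕ) = m → σ j = j := by
    intro m
    induction m using Nat.strong_induction_on with
    | _ m ih =>
      intro j hj
      by_contra hne
      have hlt := lt_of_le_of_ne (h j) hne
      exact hne (σ.injective (ih (σ j) (by rw [← hj]; exact hlt) (σ j) rfl))
  exact Equiv.ext fun j => key j j rfl

/-- Distinct double cosets are disjoint. -/
theorem eq_of_mem_upperCell {σ τ : Equiv.Perm (Fin n)} {A : GL (Fin n) ℂ} (hσ : A ∈ upperCell σ)
    (hτ : A ∈ upperCell τ) : σ = τ := by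
  obtain ⟨b₁, h₁, N, hN, b₂, h₂, rfl⟩ := hσ
  obtain ⟨c₁, g₁, M, hM, c₂, g₂, h⟩ := hτ
  have h' : (c₁⁻¹ * b₁) * N = M * (c₂ * b₂⁻¹) := by
    rw [mul_assoc c₁⁻¹, inv_mul_eq_iff_eq_mul, ← mul_assoc M, ← mul_assoc c₁,
      eq_mul_inv_iff_mul_eq, ← mul_assoc c₁, h]
  have hb := mul_mem (inv_mem g₁) h₁
  have hc := mul_mem g₂ (inv_mem h₂)
  generalize c₁⁻¹ * b₁ = b at h' hb
  generalize c₂ * b₂⁻¹ = c at h' hc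
  have key : τ⁻¹ * σ = 1 := by
    -- The entry `(σ j, j)` of `b N` is a diagonal entry of `b` times a non-zero number. In `M c` it
    -- can only come from the entry `(τ⁻¹ σ j, j)` of `c`, which is upper triangular; hence `τ⁻¹ σ j
    -- ≤ j`.
    apply perm_eq_one_of_le
    intro j
    have h3 := congrArg (fun X : GL (Fin n) ℂ => (X : Matrix (Fin n) (Fin n) ℂ) (σ j) j) h'
    rw [Units.val_mul, Units.val_mul, hN.mul_apply, Matrix.mul_apply] at h3
    have h4 := mul_ne_zero (diag_ne_zero_of_blockTriangular hb.2 (σ j)) (hN.apply_ne_zero j)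
    rw [h3] at h4
    obtain ⟨l, _, hl⟩ := Finset.exists_ne_zero_of_sum_ne_zero h4
    have h5 := hM.2 _ _ (left_ne_zero_of_mul hl)
    rw [Equiv.Perm.mul_apply, h5, perm_inv_apply_apply]
    by_contra hlt
    exact right_ne_zero_of_mul hl (hc.2 (not_le.mp hlt))
  exact (inv_mul_eq_one.mp key).symm

end Isometries

/-! ### Reduction to small diagonal blocks -/

section BlockEmbedding

variable {d n : ℕ}

/-- The matrix of the inclusion of coordinates `φ`. -/
def inclMatrix (φ : Fin d → Fin n) : Matrix (Fin n) (Fin d) ℂ := fun p a => if p = φ a then 1 else 0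

theorem inclMatrix_transpose_mul {φ : Fin d → Fin n} (hφ : Function.Injective φ) :
    (inclMatrix φ).transpose * inclMatrix φ = 1 := by
  ext a b
  simp [Matrix.mul_apply, inclMatrix, Matrix.one_apply, hφ.eq_iff, eq_comm]

theorem inclMatrix_mul_apply {φ : Fin d → Fin n} (hφ : Function.Injective φ)
    (A : Matrix (Fin d) (Fin d) ℂ) (a b : Fin d) :
    (inclMatrix φ * A * (inclMatrix φ).transpose) (φ a) (φ b) = A a b := by
  simp [Matrix.mul_apply, inclMatrix, hφ.eq_iff]

theorem inclMatrix_mul_apply_of_notMem {φ : Fin d → Fin n}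
    (A : Matrix (Fin d) (Fin d) ℂ) {p q : Fin n} (h : p ∉ Set.range φ ∨ q ∉ Set.range φ) :
    (inclMatrix φ * A * (inclMatrix φ).transpose) p q = 0 := by
  rcases h with h | h
  · have : ∀ a, p ≠ φ a := fun a ha => h ⟨a, ha.symm⟩
    simp [Matrix.mul_apply, inclMatrix, this]
  · have : ∀ a, q ≠ φ a := fun a ha => h ⟨a, ha.symm⟩
    simp [Matrix.mul_apply, inclMatrix, this]

/-- The matrix which is `A` on the coordinates `φ` and the identity on the other ones. -/
def blockEmbed (φ : Fin d → Fin n) (A : Matrix (Fin d) (Fin d) ℂ) : Matrix (Fin n) (Fin n) ℂ :=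
  1 + inclMatrix φ * (A - 1) * (inclMatrix φ).transpose

theorem inclMatrix_mul_mul {φ : Fin d → Fin n} (hφ : Function.Injective φ)
    (A B : Matrix (Fin d) (Fin d) ℂ) :
    (inclMatrix φ * A * (inclMatrix φ).transpose) * (inclMatrix φ * B * (inclMatrix φ).transpose) =
      inclMatrix φ * (A * B) * (inclMatrix φ).transpose := by
  calc _ = inclMatrix φ * A * ((inclMatrix φ).transpose * inclMatrix φ) * B *
        (inclMatrix φ).transpose := by simp only [Matrix.mul_assoc]
    _ = _ := by rw [inclMatrix_transpose_mul hφ, Matrix.mul_one, Matrix.mul_assoc (inclMatrix φ)]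

theorem blockEmbed_mul {φ : Fin d → Fin n} (hφ : Function.Injective φ)
    (A B : Matrix (Fin d) (Fin d) ℂ) :
    blockEmbed φ A * blockEmbed φ B = blockEmbed φ (A * B) := by
  simp only [blockEmbed]
  rw [add_mul, mul_add, mul_add, inclMatrix_mul_mul hφ, one_mul, one_mul, mul_one]
  have : A * B - 1 = (B - 1) + ((A - 1) + (A - 1) * (B - 1)) := by noncomm_ring
  rw [this, Matrix.mul_add, Matrix.mul_add, Matrix.add_mul, Matrix.add_mul]
  abel

theorem quadExp_inclMatrix {φ : Fin d → Fin n} (hφ : Function.Injective φ)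
    (N : Matrix (Fin d) (Fin d) ℂ) (c : ℂ) :
    quadExp (inclMatrix φ * N * (inclMatrix φ).transpose) c = blockEmbed φ (quadExp N c) := by
  rw [quadExp, quadExp, blockEmbed, sq (_ * _), inclMatrix_mul_mul hφ, add_assoc 1 (c • N),
    add_sub_cancel_left, Matrix.mul_add, Matrix.add_mul, add_assoc, sq N]
  simp only [Matrix.mul_smul, Matrix.smul_mul]

theorem blockEmbed_apply_ne_zero {φ : Fin d → Fin n} (hφ : Function.Injective φ)
    {A : Matrix (Fin d) (Fin d) ℂ} {p q : Fin n} (h : blockEmbed φ A p q ≠ 0) :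
    (∃ a b, p = φ a ∧ q = φ b ∧ A a b ≠ 0) ∨ (p = q ∧ q ∉ Set.range φ) := by
  by_cases hp : p ∈ Set.range φ ∧ q ∈ Set.range φ
  · obtain ⟨⟨a, rfl⟩, ⟨b, rfl⟩⟩ := hp
    refine Or.inl ⟨a, b, rfl, rfl, ?_⟩
    rw [blockEmbed, Matrix.add_apply, inclMatrix_mul_apply hφ, Matrix.sub_apply, Matrix.one_apply,
      Matrix.one_apply] at h
    simpa only [hφ.eq_iff, add_sub_cancel] using h
  · rw [not_and_or] at hp
    rw [blockEmbed, Matrix.add_apply, inclMatrix_mul_apply_of_notMem _ hp, add_zero,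
      Matrix.one_apply, ne_eq, ite_eq_right_iff, Classical.not_imp] at h
    refine Or.inr ⟨h.1, ?_⟩
    rcases hp with hp | hp
    · rwa [← h.1]
    · exact hp

/-- The standard representative of a simple reflection, in terms of a small block. -/
theorem blockEmbed_ne_zero_of_block {φ : Fin d → Fin n} (hφ : Function.Injective φ)
    {N : Matrix (Fin d) (Fin d) ℂ} {c e : ℂ} {σ : Equiv.Perm (Fin n)}
    (h1 : ∀ a b, (quadExp N c * quadExp N.transpose e * quadExp N c) a b ≠ 0 → φ a = σ (φ b))
    (h2 : ∀ q, q ∉ Set.range φ → σ q = q) {E : Matrix (Fin n) (Fin n) ℂ}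
    (hE : E = inclMatrix φ * N * (inclMatrix φ).transpose) (p q : Fin n)
    (h : (quadExp E c * quadExp E.transpose e * quadExp E c) p q ≠ 0) : p = σ q := by
  have hE' : E.transpose = inclMatrix φ * N.transpose * (inclMatrix φ).transpose := by
    rw [hE, Matrix.transpose_mul, Matrix.transpose_mul, Matrix.transpose_transpose, Matrix.mul_assoc]
  rw [hE', hE, quadExp_inclMatrix hφ, quadExp_inclMatrix hφ, blockEmbed_mul hφ, blockEmbed_mul hφ] at h
  rcases blockEmbed_apply_ne_zero hφ h with ⟨a, b, rfl, rfl, hab⟩ | ⟨rfl, hq⟩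
  · exact h1 a b hab
  · exact (h2 p hq).symm

end BlockEmbedding

/-! ### Chevalley generators and root subgroups -/

section Chevalley

variable {k : ℕ} (ty : TypeBC)

/-- The scale of the entries of a Chevalley generator. -/
noncomputable def rootScale (i : Fin k) : ℂ :=
  match ty with
  | .C => 1
  | .B => if (i : ℕ) + 1 < k then 1 else ((Real.sqrt 2 : ℝ) : ℂ)

theorem sqrt_two_mul_self : ((Real.sqrt 2 : ℝ) : ℂ) * ((Real.sqrt 2 : ℝ) : ℂ) = 2 := by
  rw [← Complex.ofReal_mul, Real.mul_self_sqrt (by norm_num)]; norm_num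

theorem sqrt_two_ne_zero : ((Real.sqrt 2 : ℝ) : ℂ) ≠ 0 := by
  intro h
  have := sqrt_two_mul_self
  rw [h] at this; norm_num at this

theorem rootScale_ne_zero (i : Fin k) : rootScale ty i ≠ 0 := by
  cases ty
  · simp only [rootScale]; split_ifs
    · exact one_ne_zero
    · exact sqrt_two_ne_zero
  · exact one_ne_zero

/-- The condition on the column `b` is literally `HasRung` for the strip `b`: the strip between the
wires `b - 1` and `b` contains a rung of the letter. This uniform description is the point of
contact with the graph. -/
theorem chevalleyE_apply (i : Fin k) (a b : Fin (ty.dim k)) :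
    chevalleyE ty k (i + 1) a b =
      if (b : ℕ) = a + 1 ∧ ((b : ℕ) = i + 1 ∨ (b : ℕ) + (i + 1) = ty.dim k) then rootScale ty i
      else 0 := by
  have hi := i.2
  have ha := a.2
  have hb := b.2
  have hu : ∀ p q : ℕ, matrixUnit (ty.dim k) p q a b =
      if (a : ℕ) + 1 = p ∧ (b : ℕ) + 1 = q then 1 else 0 := fun _ _ => rfl
  unfold chevalleyE rootScale
  cases ty
  · have hB : TypeBC.B.dim k = 2 * k + 1 := rfl
    by_cases hk : (i : ℕ) + 1 < k
    · simp only [hk, if_true]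
      rw [Matrix.add_apply, hu, hu]
      split_ifs <;> first | omega | norm_num
    · simp only [hk, if_false]
      rw [Matrix.smul_apply, Matrix.add_apply, hu, hu]
      split_ifs <;> first | omega | simp
  · have hC : TypeBC.C.dim k = 2 * k := rfl
    by_cases hk : (i : ℕ) + 1 < k
    · simp only [hk, if_true]
      rw [Matrix.add_apply, hu, hu]
      split_ifs <;> first | omega | norm_num
    · simp only [hk, if_false]
      rw [hu]
      split_ifs <;> first | omega | simp

/-- The pairs of coordinates reversed by the simple reflection `i + 1`. -/
def IsRootPair (i : Fin k) (x y : Fin (ty.dim k)) : Prop :=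
  ((y : ℕ) = x + 1 ∧ ((y : ℕ) = i + 1 ∨ (y : ℕ) + (i + 1) = ty.dim k)) ∨
    ((y : ℕ) = x + 2 ∧ (x : ℕ) = i ∧ (y : ℕ) + (i + 1) = ty.dim k)

theorem TypeBC.dim_le (k : ℕ) : ty.dim k ≤ 2 * k + 1 := by cases ty <;> simp [TypeBC.dim]

theorem isRootPair_of_lt (i : Fin k) {x y : Fin (ty.dim k)} (hxy : x < y)
    (h : simpleReflection ty i y < simpleReflection ty i x) : IsRootPair ty i x y := by
  have hd := ty.two_mul_le_dim k
  have hd' := ty.dim_le k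
  have hj := i.2
  have hx' := x.2
  have hy' := y.2
  simp only [Fin.lt_def, simpleReflection_apply_val, IsRootPair] at *
  split_ifs at * <;> omega

theorem IsRootPair.lt {i : Fin k} {x y : Fin (ty.dim k)} (h : IsRootPair ty i x y) : x < y := by
  rw [Fin.lt_def]; rcases h with h | h <;> omega

/-- An ascent compares one pair of coordinates, and the reversal gives its mirror image. Other root
pairs occur only for the last root in type `B` and involve the middle coordinate. There `σ⁻¹` fixes
the middle and sends `coordinate ty i` below its own mirror image, hence into the lower half. -/
theorem IsAscent.lt {σ : Equiv.Perm (Fin (ty.dim k))} (hσ : CommutesRev σ) {i : Fin k}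
    (hi : IsAscent ty σ i) {x y : Fin (ty.dim k)} (h : IsRootPair ty i x y) : σ⁻¹ x < σ⁻¹ y := by
  have hd := ty.two_mul_le_dim k
  have hd' := ty.dim_le k
  have hj := i.2
  have hx' := x.2
  have hy' := y.2
  have hs := hσ.inv
  have hlt : σ⁻¹ (coordinate ty i) < σ⁻¹ (upperCoordinate ty i) := hi
  generalize σ⁻¹ = τ at *
  have hlt' : τ (upperCoordinate ty i).rev < τ (coordinate ty i).rev := by
    rw [hs, hs]; exact Fin.rev_lt_rev.mpr hlt
  by_cases h1 : x = coordinate ty i ∧ y = upperCoordinate ty i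
  · rw [h1.1, h1.2]; exact hlt
  by_cases h2 : x = (upperCoordinate ty i).rev ∧ y = (coordinate ty i).rev
  · rw [h2.1, h2.2]; exact hlt'
  have hup := upperCoordinate_val ty i
  have hlo := coordinate_val ty i
  simp only [Fin.ext_iff, Fin.val_rev, hup, hlo] at h1 h2
  have hodd : ty.dim k = 2 * k + 1 ∧ (i : ℕ) + 1 = k := by
    rcases h with h | h <;> split_ifs at h1 h2 <;> omega
  have hupr : upperCoordinate ty i = (coordinate ty i).rev := by
    rw [Fin.ext_iff, Fin.val_rev, hup, hlo, if_neg (by omega)]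
  rw [hupr, hs] at hlt
  have h3 : ((τ (coordinate ty i) : Fin _) : ℕ) < k := by
    rw [Fin.lt_def, Fin.val_rev] at hlt; omega
  have hmid : ∀ z : Fin (ty.dim k), (z : ℕ) = k → ((τ z : Fin _) : ℕ) = k := by
    intro z hz
    have : z.rev = z := by rw [Fin.ext_iff, Fin.val_rev]; omega
    have h4 := hs z
    rw [this, Fin.ext_iff, Fin.val_rev] at h4
    have := (τ z).2
    omega
  rw [if_neg (by omega)] at hup
  rcases h with ⟨h5, h6⟩ | h
  · rcases h6 with h6 | h6
    · have hx : x = coordinate ty i := by rw [Fin.ext_iff, hlo]; omega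
      rw [hx, Fin.lt_def, hmid y (by omega)]; exact h3
    · have hy : y = (coordinate ty i).rev := by rw [Fin.ext_iff, Fin.val_rev, hlo]; omega
      rw [hy, hs, Fin.lt_def, Fin.val_rev, hmid x (by omega)]; omega
  · rw [if_neg (by omega)] at h1; omega

/-- The square is non-zero only for the last root in type `B`, where `√2 · √2 = 2` cancels the `1/2`
of the exponential series; the corner entry of `exp (c E_k)` is then `c ^ 2`. -/
theorem chevalleyE_sq_apply (i : Fin k) (a b : Fin (ty.dim k)) :
    (chevalleyE ty k (i + 1) ^ 2) a b =
      if (b : ℕ) = a + 2 ∧ (a : ℕ) = i ∧ (b : ℕ) + (i + 1) = ty.dim k then 2 else 0 := by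
  have hd := ty.two_mul_le_dim k
  have hi := i.2
  have ha := a.2
  have hb := b.2
  rw [sq, Matrix.mul_apply]
  by_cases h : (a : ℕ) + 1 < ty.dim k
  · rw [Finset.sum_eq_single ⟨a + 1, h⟩]
    · rw [chevalleyE_apply, chevalleyE_apply]
      simp only [true_and]
      split_ifs with h1 h2 h3 h4 h5 h6
      · have : rootScale ty i = ((Real.sqrt 2 : ℝ) : ℂ) := by
          cases ty
          · simp only [TypeBC.dim] at *
            rw [rootScale, if_neg (by omega)]
          · simp only [TypeBC.dim] at *; omega
        rw [this, sqrt_two_mul_self]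
      all_goals first | omega | simp
    · intro c _ hc
      rw [chevalleyE_apply, if_neg, zero_mul]
      rintro ⟨h1, _⟩; exact hc (Fin.ext h1)
    · simp
  · rw [if_neg (by omega), Finset.sum_eq_zero]
    intro c _
    rw [chevalleyE_apply, if_neg, zero_mul]
    have := c.2
    omega

theorem chevalleyE_cube (i : Fin k) : chevalleyE ty k (i + 1) ^ 3 = 0 := by
  have hd := ty.two_mul_le_dim k
  have hd' := ty.dim_le k
  have hi := i.2
  ext a b
  rw [pow_succ, Matrix.mul_apply, Matrix.zero_apply, Finset.sum_eq_zero]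
  intro c _
  rw [chevalleyE_sq_apply, chevalleyE_apply]
  split_ifs <;> first | omega | simp

theorem chevalleyE_isSkew (i : Fin k) : IsSkew (chevalleyE ty k (i + 1)) := by
  ext a b
  have ha := a.2
  have hb := b.2
  rw [Matrix.neg_apply, mul_formOmega_apply, formOmega_mul_apply, Matrix.transpose_apply,
    chevalleyE_apply, chevalleyE_apply]
  simp only [Fin.val_rev]
  split_ifs with h1 h2 h2
  · have : ty.dim k - (b + 1) = a + 1 := by omega
    rw [this, pow_succ]; ring
  · omega
  · omega
  · simp

theorem IsSkew.transpose {n : ℕ} {N : Matrix (Fin n) (Fin n) ℂ} (h : IsSkew N) :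
    IsSkew N.transpose := by
  unfold IsSkew at h ⊢
  apply formOmega_mul_cancel
  rw [← mul_assoc, ← neg_eq_iff_eq_neg.mpr h, Matrix.transpose_transpose, neg_mul, mul_neg,
    ← mul_assoc, mul_assoc N, formOmega_mul_self]
  simp

/-- The Chevalley generator of a letter: `E_i` or `F_i`. -/
noncomputable def chevalley (x : DoubleLetter k) : Matrix (Fin (ty.dim k)) (Fin (ty.dim k)) ℂ :=
  if x.pos then chevalleyE ty k x.abs else chevalleyF ty k x.abs

theorem chevalley_cube (x : DoubleLetter k) : chevalley ty x ^ 3 = 0 := by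
  unfold chevalley chevalleyF DoubleLetter.abs
  split_ifs
  · exact chevalleyE_cube ty x.idx
  · rw [← Matrix.transpose_pow, chevalleyE_cube, Matrix.transpose_zero]

theorem chevalley_isSkew (x : DoubleLetter k) : IsSkew (chevalley ty x) := by
  unfold chevalley chevalleyF DoubleLetter.abs
  split_ifs
  · exact chevalleyE_isSkew ty x.idx
  · exact (chevalleyE_isSkew ty x.idx).transpose

/-- The one-parameter subgroup `exp (c E_i)` or `exp (c F_i)` of a letter. -/
noncomputable def rootElement (x : DoubleLetter k) (c : ℂ) : GL (Fin (ty.dim k)) ℂ :=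
  quadExpGL (chevalley ty x) (chevalley_cube ty x) c

theorem rootElement_val (x : DoubleLetter k) (c : ℂ) :
    (rootElement ty x c : Matrix (Fin (ty.dim k)) (Fin (ty.dim k)) ℂ) = quadExp (chevalley ty x) c :=
  rfl

theorem rootElement_mem (x : DoubleLetter k) (c : ℂ) :
    rootElement ty x c ∈ isometryGroup (ty.dim k) :=
  quadExpGL_mem_isometryGroup (chevalley_isSkew ty x) _ c

theorem rootElement_mul (x : DoubleLetter k) (c d : ℂ) :
    rootElement ty x c * rootElement ty x d = rootElement ty x (c + d) :=
  Units.ext (quadExp_mul (chevalley_cube ty x) c d)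

theorem rootElement_zero (x : DoubleLetter k) : rootElement ty x 0 = 1 :=
  Units.ext (quadExp_zero _)

theorem rootElement_inv (x : DoubleLetter k) (c : ℂ) :
    (rootElement ty x c)⁻¹ = rootElement ty x (-c) := by
  rw [inv_eq_iff_mul_eq_one, rootElement_mul, add_neg_cancel, rootElement_zero]

theorem rootElement_pos_apply (i : Fin k) (c : ℂ) (a b : Fin (ty.dim k)) :
    (rootElement ty ⟨i, true⟩ c : Matrix (Fin (ty.dim k)) (Fin (ty.dim k)) ℂ) a b =
      if a = b then 1
      else if (b : ℕ) = a + 1 ∧ ((b : ℕ) = i + 1 ∨ (b : ℕ) + (i + 1) = ty.dim k) then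
        c * rootScale ty i
      else if (b : ℕ) = a + 2 ∧ (a : ℕ) = i ∧ (b : ℕ) + (i + 1) = ty.dim k then c ^ 2 else 0 := by
  rw [rootElement_val, quadExp, Matrix.add_apply, Matrix.add_apply, Matrix.smul_apply,
    Matrix.smul_apply]
  simp only [chevalley, if_true, DoubleLetter.abs]
  rw [chevalleyE_apply, chevalleyE_sq_apply, Matrix.one_apply]
  by_cases hab : a = b
  · subst hab
    rw [if_pos rfl, if_pos rfl, if_neg (by omega), if_neg (by omega)]; simp
  · rw [if_neg hab, if_neg hab]
    split_ifs <;> first | omega | simp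

theorem rootElement_neg_apply (i : Fin k) (c : ℂ) (a b : Fin (ty.dim k)) :
    (rootElement ty ⟨i, false⟩ c : Matrix (Fin (ty.dim k)) (Fin (ty.dim k)) ℂ) a b =
      (rootElement ty ⟨i, true⟩ c : Matrix (Fin (ty.dim k)) (Fin (ty.dim k)) ℂ) b a := by
  rw [rootElement_val, rootElement_val]
  have : chevalley ty (⟨i, false⟩ : DoubleLetter k) = (chevalley ty ⟨i, true⟩).transpose := rfl
  rw [this, ← quadExp_transpose, Matrix.transpose_apply]

theorem rootElement_pos_ne_zero {i : Fin k} {c : ℂ} {a b : Fin (ty.dim k)}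
    (h : (rootElement ty ⟨i, true⟩ c : Matrix (Fin (ty.dim k)) (Fin (ty.dim k)) ℂ) a b ≠ 0) :
    a = b ∨ IsRootPair ty i a b := by
  rw [rootElement_pos_apply] at h
  split_ifs at h with h1 h2 h3
  · exact Or.inl h1
  · exact Or.inr (Or.inl h2)
  · exact Or.inr (Or.inr h3)
  · exact absurd rfl h

theorem rootElement_pos_mem (i : Fin k) (c : ℂ) :
    rootElement ty ⟨i, true⟩ c ∈ upperIsometries (ty.dim k) :=
  ⟨rootElement_mem ty _ c, fun a b hab => by
    by_contra h
    rcases rootElement_pos_ne_zero ty h with h | h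
    · exact absurd h (ne_of_gt hab)
    · exact absurd hab h.lt.asymm⟩

/-- Reversing both indices moves the entries above the diagonal in strip `r` to those below the
diagonal in strip `n - r`, and the strips of a letter are symmetric under `r ↦ n - r`. -/
theorem flipGL_rootElement (i : Fin k) (s : Bool) (c : ℂ) :
    flipGL (rootElement ty ⟨i, s⟩ c) = rootElement ty ⟨i, !s⟩ c := by
  have key : flipGL (rootElement ty ⟨i, true⟩ c) = rootElement ty ⟨i, false⟩ c := by
    ext a b
    have ha := a.2
    have hb := b.2
    have hd := ty.two_mul_le_dim k
    have hi := i.2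
    rw [flipGL_apply, rootElement_neg_apply, rootElement_pos_apply, rootElement_pos_apply]
    simp only [Fin.val_rev, Fin.ext_iff]
    split_ifs <;> first | omega | rfl
  cases s
  · rw [← key, flipGL_flipGL]; rfl
  · exact key

end Chevalley

/-! ### Representatives of simple reflections -/

section SimpleReflectionRep

variable {k : ℕ} (ty : TypeBC)

/-- A representative of a simple reflection. -/
noncomputable def reflectionRep (i : Fin k) (c : ℂ) : GL (Fin (ty.dim k)) ℂ :=
  rootElement ty ⟨i, true⟩ c * rootElement ty ⟨i, false⟩ (-c⁻¹) * rootElement ty ⟨i, true⟩ c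

/-- This is the familiar product of three unipotent matrices in `SL_2`. It is computed in a block:
two copies of `SL_2` in four coordinates when `i + 1 < k`, the three-dimensional representation for
the last root in type `B`, and one copy of `SL_2` for the last root in type `C`. -/
theorem reflectionRep_isWeylRep (i : Fin k) {c : ℂ} (hc : c ≠ 0) :
    IsWeylRep (simpleReflection ty i) (reflectionRep ty i c) := by
  refine ⟨mul_mem (mul_mem (rootElement_mem ..) (rootElement_mem ..)) (rootElement_mem ..), ?_⟩
  intro p q h
  have hd := ty.two_mul_le_dim k
  have hi := i.2
  have h' : (quadExp (chevalleyE ty k (i + 1)) c * quadExp (chevalleyE ty k (i + 1)).transpose (-c⁻¹) *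
    quadExp (chevalleyE ty k (i + 1)) c) p q ≠ 0 := h
  by_cases hk : (i : ℕ) + 1 < k
  · obtain ⟨φ, h0, h1, h2, h3⟩ : ∃ φ : Fin 4 → Fin (ty.dim k), (φ 0 : ℕ) = i ∧ (φ 1 : ℕ) = i + 1 ∧
        (φ 2 : ℕ) = ty.dim k - (i + 2) ∧ (φ 3 : ℕ) = ty.dim k - (i + 1) :=
      ⟨![⟨i, by omega⟩, ⟨i + 1, by omega⟩, ⟨ty.dim k - (i + 2), by omega⟩,
        ⟨ty.dim k - (i + 1), by omega⟩], rfl, rfl, rfl, rfl⟩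
    let N : Matrix (Fin 4) (Fin 4) ℂ := !![0, 1, 0, 0; 0, 0, 0, 0; 0, 0, 0, 1; 0, 0, 0, 0]
    have hN2 : N ^ 2 = 0 := by
      ext a b; fin_cases a <;> fin_cases b <;>
        simp [N, sq, Matrix.mul_apply, Fin.sum_univ_succ]
    refine blockEmbed_ne_zero_of_block (φ := φ) (N := N) ?_ ?_ ?_ ?_ p q h'
    · intro a b hab
      rw [Fin.ext_iff] at hab
      fin_cases a <;> fin_cases b <;> simp [h0, h1, h2, h3] at hab ⊢ <;> omega
    · intro a b hab
      have hN2' : N.transpose ^ 2 = 0 := by rw [← Matrix.transpose_pow, hN2, Matrix.transpose_zero]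
      rw [quadExp, quadExp, hN2, hN2', smul_zero, smul_zero, add_zero, add_zero] at hab
      rw [Fin.ext_iff, simpleReflection_apply_val, if_pos hk]
      fin_cases a <;> fin_cases b <;>
        simp [N, Matrix.mul_apply, Fin.sum_univ_succ, Matrix.one_apply, hc] at hab <;>
        simp only [Fin.zero_eta, Fin.mk_one, Fin.reduceFinMk, h0, h1, h2, h3] <;>
        (split_ifs <;> omega)
    · intro q hq
      rw [Fin.ext_iff, simpleReflection_apply_val, if_pos hk]
      have g0 := Fin.val_ne_of_ne fun e => hq ⟨0, e⟩
      have g1 := Fin.val_ne_of_ne fun e => hq ⟨1, e⟩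
      have g2 := Fin.val_ne_of_ne fun e => hq ⟨2, e⟩
      have g3 := Fin.val_ne_of_ne fun e => hq ⟨3, e⟩
      simp only [h0, h1, h2, h3] at g0 g1 g2 g3
      have := q.2
      split_ifs <;> omega
    · have hs : rootScale ty i = 1 := by cases ty <;> simp [rootScale, hk]
      ext p q
      have hp := p.2
      have hq := q.2
      rw [chevalleyE_apply, hs]
      simp [Matrix.mul_apply, inclMatrix, Fin.sum_univ_succ, N, Fin.ext_iff, h0, h1, h2, h3]
      split_ifs <;> first | omega | simp
  · cases ty
    · have hB : TypeBC.B.dim k = 2 * k + 1 := rfl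
      obtain ⟨φ, h0, h1, h2⟩ : ∃ φ : Fin 3 → Fin (TypeBC.B.dim k), (φ 0 : ℕ) = i ∧
          (φ 1 : ℕ) = i + 1 ∧ (φ 2 : ℕ) = i + 2 :=
        ⟨![⟨i, by omega⟩, ⟨i + 1, by omega⟩, ⟨i + 2, by omega⟩], rfl, rfl, rfl⟩
      obtain ⟨r, hr, hr'⟩ : ∃ r : ℂ, r * r = 2 ∧ r = ((Real.sqrt 2 : ℝ) : ℂ) :=
        ⟨_, sqrt_two_mul_self, rfl⟩
      let N : Matrix (Fin 3) (Fin 3) ℂ := !![0, r, 0; 0, 0, r; 0, 0, 0]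
      have hN2 : N ^ 2 = !![0, 0, 2; 0, 0, 0; 0, 0, 0] := by
        ext a b; fin_cases a <;> fin_cases b <;>
          simp [N, sq, Matrix.mul_apply, Fin.sum_univ_succ, hr]
      refine blockEmbed_ne_zero_of_block (φ := φ) (N := N) ?_ ?_ ?_ ?_ p q h'
      · intro a b hab
        rw [Fin.ext_iff] at hab
        fin_cases a <;> fin_cases b <;> simp [h0, h1, h2] at hab ⊢
      · intro a b hab
        have hx : quadExp N c = !![1, c * r, c ^ 2; 0, 1, c * r; 0, 0, 1] := by
          rw [quadExp, hN2]
          ext a b; fin_cases a <;> fin_cases b <;> simp [N]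
        have hy : quadExp N.transpose (-c⁻¹) =
            !![1, 0, 0; -c⁻¹ * r, 1, 0; (c⁻¹) ^ 2, -c⁻¹ * r, 1] := by
          rw [quadExp, ← Matrix.transpose_pow, hN2]
          ext a b; fin_cases a <;> fin_cases b <;> simp [N]
        -- The Weyl element of `SL_2` in the three-dimensional representation: it exchanges the
        -- outer coordinates and acts by `-1` on the middle one; only `r * r = 2` is used.
        have hz : quadExp N c * quadExp N.transpose (-c⁻¹) * quadExp N c =
            !![0, 0, c ^ 2; 0, -1, 0; (c⁻¹) ^ 2, 0, 0] := by
          rw [hx, hy]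
          ext a b; fin_cases a <;> fin_cases b <;>
            simp [Matrix.mul_apply, Fin.sum_univ_succ] <;> field_simp <;>
            ring_nf <;> first | done | linear_combination hr | linear_combination -hr |
              linear_combination r * hr | linear_combination -r * hr | linear_combination (-c) * r * hr
        rw [hz] at hab
        rw [Fin.ext_iff, simpleReflection_apply_val, if_neg hk]
        fin_cases a <;> fin_cases b <;> simp at hab <;>
          simp only [Fin.zero_eta, Fin.mk_one, Fin.reduceFinMk, h0, h1, h2] <;>
          (split_ifs <;> omega)
      · intro q hq
        rw [Fin.ext_iff, simpleReflection_apply_val, if_neg hk]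
        have g0 := Fin.val_ne_of_ne fun e => hq ⟨0, e⟩
        have g1 := Fin.val_ne_of_ne fun e => hq ⟨1, e⟩
        have g2 := Fin.val_ne_of_ne fun e => hq ⟨2, e⟩
        simp only [h0, h1, h2] at g0 g1 g2
        have := q.2
        split_ifs <;> omega
      · have hs : rootScale TypeBC.B i = r := by simp [rootScale, hk, hr']
        ext p q
        have hp := p.2
        have hq := q.2
        rw [chevalleyE_apply, hs]
        simp [Matrix.mul_apply, inclMatrix, Fin.sum_univ_succ, N, Fin.ext_iff, h0, h1, h2]
        split_ifs <;> first | omega | simp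
    · have hC : TypeBC.C.dim k = 2 * k := rfl
      obtain ⟨φ, h0, h1⟩ : ∃ φ : Fin 2 → Fin (TypeBC.C.dim k), (φ 0 : ℕ) = i ∧
          (φ 1 : ℕ) = i + 1 :=
        ⟨![⟨i, by omega⟩, ⟨i + 1, by omega⟩], rfl, rfl⟩
      let N : Matrix (Fin 2) (Fin 2) ℂ := !![0, 1; 0, 0]
      have hN2 : N ^ 2 = 0 := by
        ext a b; fin_cases a <;> fin_cases b <;>
          simp [N, sq, Matrix.mul_apply, Fin.sum_univ_succ]
      refine blockEmbed_ne_zero_of_block (φ := φ) (N := N) ?_ ?_ ?_ ?_ p q h'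
      · intro a b hab
        rw [Fin.ext_iff] at hab
        fin_cases a <;> fin_cases b <;> simp [h0, h1] at hab ⊢
      · intro a b hab
        have hN2' : N.transpose ^ 2 = 0 := by rw [← Matrix.transpose_pow, hN2, Matrix.transpose_zero]
        rw [quadExp, quadExp, hN2, hN2', smul_zero, smul_zero, add_zero, add_zero] at hab
        rw [Fin.ext_iff, simpleReflection_apply_val, if_neg hk]
        fin_cases a <;> fin_cases b <;>
          simp [N, Matrix.mul_apply, Fin.sum_univ_succ, Matrix.one_apply, hc] at hab <;>
          simp only [Fin.zero_eta, Fin.mk_one, h0, h1] <;>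
          (split_ifs <;> omega)
      · intro q hq
        rw [Fin.ext_iff, simpleReflection_apply_val, if_neg hk]
        have g0 := Fin.val_ne_of_ne fun e => hq ⟨0, e⟩
        have g1 := Fin.val_ne_of_ne fun e => hq ⟨1, e⟩
        simp only [h0, h1] at g0 g1
        have := q.2
        split_ifs <;> omega
      · ext p q
        have hp := p.2
        have hq := q.2
        rw [chevalleyE_apply]
        simp [Matrix.mul_apply, inclMatrix, Fin.sum_univ_succ, N, Fin.ext_iff, rootScale, h0, h1]
        split_ifs <;> first | omega | simp

end SimpleReflectionRep

/-! ### Multiplying Bruhat cells by root subgroups -/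

section Cells

variable {k : ℕ} (ty : TypeBC)

/-- The entries of a triangular isometry at the positions of one simple root are tied together by
the form, so the vanishing of the first one forces that of its mirror image and of the corner entry
in type `B`. -/
theorem upperIsometries_eq_zero_of_isRootPair (i : Fin k) {b : GL (Fin (ty.dim k)) ℂ}
    (hb : b ∈ upperIsometries (ty.dim k)) {x y : Fin (ty.dim k)} (hx : (x : ℕ) = i)
    (hy : (y : ℕ) = i + 1) (h : (b : Matrix (Fin (ty.dim k)) (Fin (ty.dim k)) ℂ) x y = 0)
    {p q : Fin (ty.dim k)} (hpq : IsRootPair ty i p q) :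
    (b : Matrix (Fin (ty.dim k)) (Fin (ty.dim k)) ℂ) p q = 0 := by
  set A := (b : Matrix (Fin (ty.dim k)) (Fin (ty.dim k)) ℂ) with hA
  have hup : ∀ i j, j < i → A i j = 0 := fun i j hij => hb.2 hij
  have hdiag : A x x ≠ 0 := diag_ne_zero_of_blockTriangular hb.2 x
  have hform := mul_formOmega_mul_transpose_apply A
  rw [hb.1.1] at hform
  have hs : ∀ c : ℕ, ((-1 : ℂ)) ^ c ≠ 0 := fun c => pow_ne_zero _ (by norm_num)
  have hqlt := q.2
  have hd := ty.two_mul_le_dim k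
  rcases hpq with ⟨h1, h2 | h2⟩ | ⟨h1, h2, h3⟩
  · have : p = x := Fin.ext (by omega)
    have : q = y := Fin.ext (by omega)
    subst_vars; exact h
  · by_cases hpx : p = x
    · have : q = y := Fin.ext (by subst hpx; omega)
      subst_vars; exact h
    -- Pair the rows `x` and `p`: triangularity and the vanishing of the entry `(x, y)` leave only
    -- the product of `A x x` and `A p q`, up to sign.
    have h4 := hform x p
    rw [Finset.sum_eq_single x] at h4
    · have hq : x.rev = q := by rw [Fin.ext_iff, Fin.val_rev]; omega
      have hne : p ≠ x.rev := by rw [Ne, Fin.ext_iff, Fin.val_rev]; omega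
      rw [hq, formOmega, if_neg hne] at h4
      exact (mul_eq_zero.mp h4.symm).resolve_left (mul_ne_zero hdiag (hs _))
    · intro c _ hc
      by_cases hcx : c < x
      · rw [hup x c hcx]; ring
      · by_cases hcy : c = y
        · rw [hcy, h]; ring
        · rw [hup p c.rev, mul_zero]
          rw [Fin.lt_def, Fin.val_rev]
          rw [Fin.lt_def] at hcx
          simp only [Fin.ext_iff, ne_eq] at hc hcy
          omega
    · simp
  · have hpx : p = x := Fin.ext (by omega)
    subst hpx
    -- Pair the row `p` with itself. The two terms that survive are equal, as `q` and `p` have the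
    -- same parity, so `2 · A p p · A p q = 0`.
    have h4 := hform p p
    have hpq : p ≠ q := by rw [Ne, Fin.ext_iff]; omega
    have hpr : p.rev = q := by rw [Fin.ext_iff, Fin.val_rev]; omega
    have hqr : q.rev = p := by rw [← hpr, Fin.rev_rev]
    rw [Finset.sum_eq_add p q hpq, hpr, hqr, formOmega, if_neg (by rw [hpr]; exact hpq), h1,
      pow_add] at h4
    · have h5 : (2 * (A p p * (-1) ^ (p : ℕ))) * A p q = 0 := by
        rw [h4]; ring
      exact (mul_eq_zero.mp h5).resolve_left (mul_ne_zero two_ne_zero (mul_ne_zero hdiag (hs _)))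
    · rintro c _ ⟨hcp, hcq⟩
      by_cases hcx : c < p
      · rw [hup p c hcx]; ring
      · by_cases hcy : c = y
        · rw [hcy, h]; ring
        · rw [hup p c.rev, mul_zero]
          rw [Fin.lt_def, Fin.val_rev]
          rw [Fin.lt_def] at hcx
          simp only [Fin.ext_iff, ne_eq] at hcp hcq hcy
          omega
    · simp
    · simp

/-- Splitting off a simple root subgroup from an upper triangular isometry. -/
theorem exists_eq_rootElement_mul (i : Fin k) {b : GL (Fin (ty.dim k)) ℂ}
    (hb : b ∈ upperIsometries (ty.dim k)) :
    ∃ d : ℂ, ∃ y ∈ upperIsometries (ty.dim k), b = rootElement ty ⟨i, true⟩ d * y ∧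
      ∀ N, IsWeylRep (simpleReflection ty i) N → N⁻¹ * y * N ∈ upperIsometries (ty.dim k) := by
  have hd := ty.two_mul_le_dim k
  have hi := i.2
  obtain ⟨p, hp⟩ : ∃ p : Fin (ty.dim k), (p : ℕ) = i := ⟨⟨i, by omega⟩, rfl⟩
  obtain ⟨q, hq⟩ : ∃ q : Fin (ty.dim k), (q : ℕ) = i + 1 := ⟨⟨i + 1, by omega⟩, rfl⟩
  set A := (b : Matrix (Fin (ty.dim k)) (Fin (ty.dim k)) ℂ) with hA
  have hqq : A q q ≠ 0 := diag_ne_zero_of_blockTriangular hb.2 q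
  -- The value for which the factor with parameter `-d` clears the entry `(p, q)`; this entry of `b`
  -- is measured against the diagonal entry `A q q` and the scale of the generator.
  set d := A p q / (A q q * rootScale ty i) with hdd
  set y := rootElement ty ⟨i, true⟩ (-d) * b with hy
  have hyU : y ∈ upperIsometries (ty.dim k) := mul_mem (rootElement_pos_mem ty i _) hb
  have hpq : p ≠ q := by rw [Ne, Fin.ext_iff]; omega
  have hy0 : (y : Matrix (Fin (ty.dim k)) (Fin (ty.dim k)) ℂ) p q = 0 := by
    rw [hy, Units.val_mul, Matrix.mul_apply, Finset.sum_eq_add p q hpq]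
    · rw [rootElement_pos_apply, rootElement_pos_apply, if_pos rfl, if_neg hpq,
        if_pos ⟨by omega, Or.inl hq⟩, ← hA, hdd]
      have := rootScale_ne_zero ty i
      field_simp
      ring
    · rintro c _ ⟨hcp, hcq⟩
      by_cases hc : q < c
      · rw [show (b : Matrix (Fin (ty.dim k)) (Fin (ty.dim k)) ℂ) c q = 0 from hb.2 hc, mul_zero]
      · rw [show (rootElement ty ⟨i, true⟩ (-d) : Matrix (Fin (ty.dim k)) (Fin (ty.dim k)) ℂ) p c = 0
          from (rootElement_pos_mem ty i (-d)).2 ?_, zero_mul]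
        simp only [id, Fin.lt_def, Fin.ext_iff, ne_eq] at *
        omega
    · simp
    · simp
  refine ⟨d, y, hyU, ?_, ?_⟩
  · rw [hy, ← mul_assoc, rootElement_mul, add_neg_cancel, rootElement_zero, one_mul]
  · intro N hN
    refine ⟨mul_mem (mul_mem (inv_mem hN.1) hyU.1) hN.1, fun a c hac => ?_⟩
    rw [Units.val_mul, hN.mul_apply, Units.val_mul, Matrix.mul_apply]
    rw [Finset.sum_eq_zero, zero_mul]
    intro e _
    by_contra hne
    have h1 := hN.inv.2 _ _ (left_ne_zero_of_mul hne)
    have h2 := right_ne_zero_of_mul hne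
    have he : e = simpleReflection ty i a := by rw [h1, perm_apply_inv_apply]
    rw [he] at h2
    have hac' : c < a := hac
    have hinv : ∀ z, simpleReflection ty i (simpleReflection ty i z) = z := fun z => by
      rw [← Equiv.Perm.mul_apply, simpleReflection_mul_self]; rfl
    -- Conjugation moves the entry of `y` at the reflected indices to `(a, c)`, below the diagonal.
    -- Either that entry of `y` is itself below the diagonal, or the reflection reverses the pair;
    -- then it is a root pair, where `y` was arranged to vanish.
    rcases lt_trichotomy (simpleReflection ty i a) (simpleReflection ty i c) with h3 | h3 | h3
    · exact h2 (upperIsometries_eq_zero_of_isRootPair ty i hyU hp hq hy0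
        (isRootPair_of_lt ty i h3 (by rw [hinv, hinv]; exact hac')))
    · exact hac'.ne (Equiv.injective _ h3).symm
    · exact h2 (hyU.2 h3)

/-- Conjugation by a representative of `σ⁻¹` moves positions by `σ⁻¹`, and for an ascent it keeps
every root pair in increasing order. -/
theorem IsWeylRep.inv_mul_rootElement_mul {σ : Equiv.Perm (Fin (ty.dim k))} (hσ : CommutesRev σ)
    {i : Fin k} (hi : IsAscent ty σ i) {N : GL (Fin (ty.dim k)) ℂ} (hN : IsWeylRep σ N) (c : ℂ) :
    N⁻¹ * rootElement ty ⟨i, true⟩ c * N ∈ upperIsometries (ty.dim k) := by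
  refine ⟨mul_mem (mul_mem (inv_mem hN.1) (rootElement_mem ..)) hN.1, fun a b hab => ?_⟩
  rw [Units.val_mul, hN.mul_apply, Units.val_mul, Matrix.mul_apply]
  rw [Finset.sum_eq_zero, zero_mul]
  intro e _
  by_contra hne
  have h1 := hN.inv.2 _ _ (left_ne_zero_of_mul hne)
  have he : e = σ a := by rw [h1, perm_apply_inv_apply]
  have hab' : b < a := hab
  rcases rootElement_pos_ne_zero ty (right_ne_zero_of_mul hne) with h2 | h2
  · rw [he] at h2; exact hab'.ne (σ.injective h2).symm
  · have := hi.lt ty hσ h2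
    rw [he, perm_inv_apply_apply, perm_inv_apply_apply] at this
    exact this.asymm hab'

/-- The rule `BsB · BσB = BsσB` for a lengthening `s`. Write `x_{-i}(c) = x_i(c⁻¹) n x_i(c⁻¹)` with
`n` representing `s`. Of the triangular factor to the right of `n`, the part without the `i`-th root
is moved left through `n`, and the root subgroup part is moved right through `N` by the ascent. -/
theorem rootElement_neg_mul_mem_upperCell {σ : Equiv.Perm (Fin (ty.dim k))} (hσ : CommutesRev σ)
    {i : Fin k} (hi : IsAscent ty σ i) {A : GL (Fin (ty.dim k)) ℂ} (hA : A ∈ upperCell σ) {c : ℂ}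
    (hc : c ≠ 0) :
    rootElement ty ⟨i, false⟩ c * A ∈ upperCell (simpleReflection ty i * σ) := by
  obtain ⟨b₁, h₁, N, hN, b₂, h₂, rfl⟩ := hA
  obtain ⟨d, y, hy, hdy, hconj⟩ := exists_eq_rootElement_mul ty i
    (inv_mem (mul_mem (rootElement_pos_mem ty i c⁻¹) h₁))
  have hn := reflectionRep_isWeylRep ty i (c := -c⁻¹) (neg_ne_zero.mpr (inv_ne_zero hc))
  set n := reflectionRep ty i (-c⁻¹) with hnn
  have hx : rootElement ty ⟨i, false⟩ c =
      rootElement ty ⟨i, true⟩ c⁻¹ * n * rootElement ty ⟨i, true⟩ c⁻¹ := by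
    have hcc : -(-c⁻¹)⁻¹ = c := by rw [inv_neg, inv_inv, neg_neg]
    rw [hnn, reflectionRep, hcc]
    have : ∀ X Y : GL (Fin (ty.dim k)) ℂ, X * (X⁻¹ * Y * X⁻¹) * X = Y := fun X Y => by group
    rw [← rootElement_inv, this]
  have h3 : rootElement ty ⟨i, true⟩ c⁻¹ * b₁ = y⁻¹ * rootElement ty ⟨i, true⟩ (-d) := by
    rw [← rootElement_inv, ← mul_inv_rev, ← hdy, inv_inv]
  have hconj' := inv_mem (hconj n⁻¹ (by
    have := hn.inv; rwa [simpleReflection_inv] at this))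
  refine ⟨rootElement ty ⟨i, true⟩ c⁻¹ * (n⁻¹⁻¹ * y * n⁻¹)⁻¹, mul_mem (rootElement_pos_mem ..) hconj',
    n * N, hn.mul hN, N⁻¹ * rootElement ty ⟨i, true⟩ (-d) * N * b₂,
    mul_mem (hN.inv_mul_rootElement_mul ty hσ hi _) h₂, ?_⟩
  calc rootElement ty ⟨i, false⟩ c * (b₁ * N * b₂)
      = rootElement ty ⟨i, true⟩ c⁻¹ * n * (rootElement ty ⟨i, true⟩ c⁻¹ * b₁) * N * b₂ := by
        rw [hx]; simp only [mul_assoc]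
    _ = _ := by rw [h3]; group

/-- Up to a translation by the simple root subgroup, elements of the bigger cell come from the
smaller one. -/
theorem exists_eq_rootElement_neg_mul {σ : Equiv.Perm (Fin (ty.dim k))}
    {i : Fin k} {A : GL (Fin (ty.dim k)) ℂ} (hA : A ∈ upperCell (simpleReflection ty i * σ)) :
    ∃ d : ℂ, ∀ s : ℂ, s ≠ d → ∃ c : ℂ, c ≠ 0 ∧ ∃ A' ∈ upperCell σ,
      rootElement ty ⟨i, true⟩ s * A = rootElement ty ⟨i, false⟩ c * A' := by
  obtain ⟨b₁, h₁, N, hN, b₂, h₂, rfl⟩ := hA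
  obtain ⟨d, y, hy, rfl, hconj⟩ := exists_eq_rootElement_mul ty i h₁
  -- The excluded value is the one for which the root component `s + d` of the left triangular
  -- factor vanishes. Otherwise `x_i(s + d)` times a suitable representative of the reflection
  -- equals `x_{-i}((s + d)⁻¹)` times an upper triangular element.
  refine ⟨-d, fun s hs => ?_⟩
  have he : s + d ≠ 0 := fun h => hs (eq_neg_of_add_eq_zero_left h)
  have hn := reflectionRep_isWeylRep ty i (c := -(s + d)) (neg_ne_zero.mpr he)
  have hx : rootElement ty ⟨i, true⟩ (s + d) * reflectionRep ty i (-(s + d)) =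
      rootElement ty ⟨i, false⟩ (s + d)⁻¹ * rootElement ty ⟨i, true⟩ (-(s + d)) := by
    rw [reflectionRep, ← mul_assoc, ← mul_assoc, rootElement_mul, add_neg_cancel, rootElement_zero,
      one_mul, inv_neg, neg_neg]
  set n := reflectionRep ty i (-(s + d))
  refine ⟨(s + d)⁻¹, inv_ne_zero he, rootElement ty ⟨i, true⟩ (-(s + d)) *
    ((n⁻¹ * y * n) * (n⁻¹ * N) * b₂), ?_, ?_⟩
  · refine upperCell_mul_left ⟨_, hconj n hn, n⁻¹ * N, ?_, b₂, h₂, rfl⟩ (rootElement_pos_mem ..)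
    have := hn.inv.mul hN
    rwa [simpleReflection_inv, ← mul_assoc, simpleReflection_mul_self, one_mul] at this
  · rw [← mul_assoc (rootElement ty ⟨i, false⟩ _), ← hx, ← rootElement_mul]
    group

/-- If the parameters differed, `A'` would be a non-trivial `x_{-i}` times `A` and would lie in the
cell of `s_i σ` as well as in that of `σ`. -/
theorem rootElement_neg_mul_injective {σ : Equiv.Perm (Fin (ty.dim k))} (hσ : CommutesRev σ)
    {i : Fin k} (hi : IsAscent ty σ i) {A A' : GL (Fin (ty.dim k)) ℂ} (hA : A ∈ upperCell σ)
    (hA' : A' ∈ upperCell σ) {c c' : ℂ}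
    (h : rootElement ty ⟨i, false⟩ c * A = rootElement ty ⟨i, false⟩ c' * A') : c = c' := by
  by_contra hc
  have h1 : rootElement ty ⟨i, false⟩ (c - c') * A = A' := by
    rw [sub_eq_neg_add, ← rootElement_mul, mul_assoc, h, ← mul_assoc, rootElement_mul,
      neg_add_cancel, rootElement_zero, one_mul]
  have h2 := rootElement_neg_mul_mem_upperCell ty hσ hi hA (sub_ne_zero.mpr hc)
  rw [h1] at h2
  have h3 := eq_of_mem_upperCell h2 hA'
  exact simpleReflection_ne_one ty i (mul_eq_right.mp h3)

end Cells

/-! ### Triangular factorization of isometries near the identity -/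

section LU

variable {n : ℕ}

/-- Since `Ω` squares to a sign, the hypothesis exhibits a right inverse of `A` in terms of `Ω` and
`Aᵗ`; it is also a left inverse, which is the conclusion. -/
theorem transpose_mul_formOmega_mul {A : Matrix (Fin n) (Fin n) ℂ}
    (h : A * formOmega n * A.transpose = formOmega n) :
    A.transpose * formOmega n * A = formOmega n := by
  have hs : ((-1 : ℂ) ^ (n - 1)) * (-1) ^ (n - 1) = 1 := by rw [← mul_pow]; simp
  have hinv : A * (((-1 : ℂ) ^ (n - 1)) • (formOmega n * A.transpose * formOmega n)) = 1 := by
    rw [Matrix.mul_smul, ← mul_assoc, ← mul_assoc, h, formOmega_mul_self, smul_smul, hs, one_smul]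
  have h2 := mul_eq_one_comm.mp hinv
  apply formOmega_mul_cancel
  rw [← mul_assoc, ← mul_assoc, formOmega_mul_self]
  rw [Matrix.smul_mul] at h2
  have h3 := congrArg (fun X => ((-1 : ℂ) ^ (n - 1)) • X) h2
  simp only [smul_smul, hs, one_smul] at h3
  exact h3

/-- The leading block of size `j`, completed by the identity. -/
def leadingBlock (N : Matrix (Fin n) (Fin n) ℂ) (j : Fin n) : Matrix (Fin n) (Fin n) ℂ :=
  fun a b => if a < j ∧ b < j then N a b else if a = b then 1 else 0

/-- The right hand side of the linear system for the `j`-th column of the upper triangular factor. -/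
def eliminationVector (N : Matrix (Fin n) (Fin n) ℂ) (j : Fin n) : Fin n → ℂ :=
  fun a => if a < j then - N a j else if a = j then 1 else 0

/-- The unipotent upper triangular matrix `V` for which `N V` is lower triangular. -/
noncomputable def upperFactor (N : Matrix (Fin n) (Fin n) ℂ) : Matrix (Fin n) (Fin n) ℂ :=
  fun a j => (leadingBlock N j).det⁻¹ *
    ((leadingBlock N j).adjugate.mulVec (eliminationVector N j)) a

/-- Cramer's rule. Completing the leading block by the identity keeps the size `n`, and the adjugate
makes the factor an explicit function of `N`, continuous wherever the minors do not vanish. -/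
theorem leadingBlock_mulVec_upperFactor {N : Matrix (Fin n) (Fin n) ℂ} {j : Fin n}
    (h : (leadingBlock N j).det ≠ 0) :
    (leadingBlock N j).mulVec (fun a => upperFactor N a j) = eliminationVector N j := by
  have : (fun a => upperFactor N a j) =
      (leadingBlock N j).det⁻¹ • (leadingBlock N j).adjugate.mulVec (eliminationVector N j) := rfl
  rw [this, Matrix.mulVec_smul, Matrix.mulVec_mulVec, Matrix.mul_adjugate, Matrix.smul_mulVec,
    Matrix.one_mulVec, smul_smul, inv_mul_cancel₀ h, one_smul]

theorem upperFactor_of_le {N : Matrix (Fin n) (Fin n) ℂ} {a j : Fin n}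
    (h : (leadingBlock N j).det ≠ 0) (haj : j ≤ a) :
    upperFactor N a j = if a = j then 1 else 0 := by
  have h1 := congrFun (leadingBlock_mulVec_upperFactor h) a
  rw [eliminationVector, if_neg (not_lt.mpr haj), Matrix.mulVec, dotProduct,
    Finset.sum_eq_single a] at h1
  · rwa [leadingBlock, if_neg (fun h => not_lt.mpr haj h.1), if_pos rfl, one_mul] at h1
  · intro b _ hb
    rw [leadingBlock, if_neg (fun h => not_lt.mpr haj h.1), if_neg hb.symm, zero_mul]
  · simp

/-- The rows of the linear system with index below `j` say exactly that the entries of `N V` above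
the diagonal in column `j` vanish. -/
theorem mul_upperFactor_of_lt {N : Matrix (Fin n) (Fin n) ℂ} {a j : Fin n}
    (h : (leadingBlock N j).det ≠ 0) (haj : a < j) : (N * upperFactor N) a j = 0 := by
  have h1 := congrFun (leadingBlock_mulVec_upperFactor h) a
  rw [eliminationVector, if_pos haj, Matrix.mulVec, dotProduct] at h1
  rw [Matrix.mul_apply, ← add_neg_eq_zero.mpr (rfl : N a j = N a j), ← h1,
    ← Finset.add_sum_erase _ _ (Finset.mem_univ j), ← Finset.add_sum_erase (a := j) _
      (fun b => leadingBlock N j a b * _) (Finset.mem_univ j), upperFactor_of_le h le_rfl, if_pos rfl,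
    mul_one]
  congr 1
  rw [leadingBlock, if_neg (fun h => lt_irrefl _ h.2), if_neg haj.ne, zero_mul, zero_add]
  refine Finset.sum_congr rfl fun b hb => ?_
  by_cases hbj : b < j
  · rw [leadingBlock, if_pos ⟨haj, hbj⟩]
  · rw [upperFactor_of_le h (not_lt.mp hbj), if_neg (Finset.ne_of_mem_erase hb), mul_zero, mul_zero]

theorem continuous_leadingBlock (j : Fin n) :
    Continuous fun N : Matrix (Fin n) (Fin n) ℂ => leadingBlock N j := by
  refine continuous_pi fun a => continuous_pi fun b => ?_
  unfold leadingBlock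
  split_ifs <;> fun_prop

theorem leadingBlock_one (j : Fin n) : leadingBlock (1 : Matrix (Fin n) (Fin n) ℂ) j = 1 := by
  ext a b
  rw [leadingBlock, Matrix.one_apply]
  split_ifs <;> rfl

theorem upperFactor_one : upperFactor (1 : Matrix (Fin n) (Fin n) ℂ) = 1 := by
  ext a j
  rw [upperFactor, leadingBlock_one, Matrix.det_one, Matrix.adjugate_one, Matrix.one_mulVec, inv_one,
    one_mul, eliminationVector, Matrix.one_apply]
  split_ifs with h1 h2 h3 <;> simp_all

theorem continuousAt_upperFactor_one :
    ContinuousAt (upperFactor : Matrix (Fin n) (Fin n) ℂ → _) 1 := by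
  refine continuousAt_pi.mpr fun a => continuousAt_pi.mpr fun j => ?_
  unfold upperFactor
  have hc := continuous_leadingBlock j
  refine ContinuousAt.mul (ContinuousAt.inv₀ hc.matrix_det.continuousAt ?_) ?_
  · rw [leadingBlock_one, Matrix.det_one]; exact one_ne_zero
  · have : Continuous fun N : Matrix (Fin n) (Fin n) ℂ => eliminationVector N j := by
      refine continuous_pi fun a => ?_
      unfold eliminationVector
      split_ifs <;> fun_prop
    exact ((continuous_apply a).comp (hc.matrix_adjugate.matrix_mulVec this)).continuousAt

theorem eventually_det_leadingBlock_ne_zero :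
    ∀ᶠ N in nhds (1 : Matrix (Fin n) (Fin n) ℂ), ∀ j, (leadingBlock N j).det ≠ 0 := by
  rw [Filter.eventually_all]
  intro j
  refine (continuous_leadingBlock j).matrix_det.continuousAt.eventually_ne ?_
  rw [leadingBlock_one, Matrix.det_one]; exact one_ne_zero

/-- The triangular factors of an isometry are isometries. -/
theorem exists_upper_lower {N : GL (Fin n) ℂ} (hN : N ∈ isometryGroup n)
    (h : ∀ j, (leadingBlock (N : Matrix (Fin n) (Fin n) ℂ) j).det ≠ 0) :
    ∃ U ∈ upperIsometries n, ∃ L, flipGL L ∈ upperIsometries n ∧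
      (L : Matrix (Fin n) (Fin n) ℂ) = N * upperFactor (N : Matrix (Fin n) (Fin n) ℂ) ∧ N * U = L := by
  set V := upperFactor (N : Matrix (Fin n) (Fin n) ℂ) with hV
  have hVup : V.BlockTriangular id := fun a b hab => by
    have hab' : b < a := hab
    rw [hV, upperFactor_of_le (h b) hab'.le, if_neg hab'.ne']
  have hVdiag : ∀ a, V a a = 1 := fun a => by rw [hV, upperFactor_of_le (h a) le_rfl, if_pos rfl]
  have hVdet : V.det = 1 := by
    rw [Matrix.det_of_isUpperTriangular hVup]; simp [hVdiag]
  set M := (N : Matrix (Fin n) (Fin n) ℂ) * V with hM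
  have hMlow : ∀ a b, a < b → M a b = 0 := fun a b hab => mul_upperFactor_of_lt (h b) hab
  have e1 : M.transpose * formOmega n * M = V.transpose * formOmega n * V := by
    rw [hM, Matrix.transpose_mul]
    calc _ = V.transpose * ((N : Matrix (Fin n) (Fin n) ℂ).transpose * formOmega n * N) * V := by
          simp only [mul_assoc]
      _ = _ := by rw [transpose_mul_formOmega_mul hN.1]
  -- Compute `Vᵗ Ω V` by position. Above the antidiagonal it vanishes because `V` is upper
  -- triangular; on the antidiagonal the unit diagonal of `V` gives `Ω`; below it one uses `e1` and
  -- the lower triangular `M`.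
  have e2 : V.transpose * formOmega n * V.transpose.transpose = formOmega n := by
    ext a b
    rcases lt_trichotomy a b.rev with hab | hab | hab
    · rw [mul_formOmega_mul_transpose_apply, Finset.sum_eq_zero, formOmega, if_neg]
      · rintro rfl; rw [Fin.rev_rev] at hab; exact lt_irrefl _ hab
      · intro c _
        simp only [Matrix.transpose_apply]
        by_cases hc : a < c
        · rw [show V c a = 0 from hVup hc]; ring
        · rw [show V c.rev b = 0 from hVup (by
            show b < c.rev
            rw [← Fin.rev_rev b]
            exact Fin.rev_lt_rev.mpr (lt_of_le_of_lt (not_lt.mp hc) hab))]; ring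
    · rw [mul_formOmega_mul_transpose_apply, Finset.sum_eq_single a]
      · simp only [Matrix.transpose_apply, hVdiag, one_mul]
        rw [hab, Fin.rev_rev, hVdiag, formOmega, if_pos (Fin.rev_rev b).symm, mul_one]
      · intro c _ hc
        simp only [Matrix.transpose_apply]
        by_cases hc' : a < c
        · rw [show V c a = 0 from hVup hc']; ring
        · rw [show V c.rev b = 0 from hVup (by
            show b < c.rev
            rw [← Fin.rev_rev b, ← hab]
            exact Fin.rev_lt_rev.mpr (lt_of_le_of_ne (not_lt.mp hc') hc))]; ring
      · simp
    · rw [Matrix.transpose_transpose, ← e1, ← Matrix.transpose_transpose M, Matrix.transpose_transpose M.transpose,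
        mul_formOmega_mul_transpose_apply, Finset.sum_eq_zero, formOmega, if_neg]
      · rintro rfl; rw [Fin.rev_rev] at hab; exact lt_irrefl _ hab
      · intro c _
        simp only [Matrix.transpose_apply]
        by_cases hc : c < a
        · rw [hMlow c a hc]; ring
        · rw [hMlow c.rev b (by
            rw [← Fin.rev_rev b]
            exact Fin.rev_lt_rev.mpr (lt_of_lt_of_le hab (not_lt.mp hc)))]; ring
  have e3 := transpose_mul_formOmega_mul e2
  rw [Matrix.transpose_transpose] at e3
  let U : GL (Fin n) ℂ := Matrix.GeneralLinearGroup.mkOfDetNeZero V (by rw [hVdet]; exact one_ne_zero)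
  have hU : U ∈ upperIsometries n := ⟨⟨e3, hVdet⟩, hVup⟩
  refine ⟨U, hU, N * U, ⟨flipGL_mem_isometryGroup (mul_mem hN hU.1), fun a b hab => ?_⟩, rfl, rfl⟩
  rw [flipGL_apply]
  exact hMlow _ _ (Fin.rev_lt_rev.mpr hab)

end LU

/-! ### Density of products of root subgroup elements in double Bruhat cells -/

section Density

theorem flipGL_val {n : ℕ} (A : GL (Fin n) ℂ) : (flipGL A : Matrix (Fin n) (Fin n) ℂ) =
    Matrix.reindexAlgEquiv ℂ ℂ Fin.revPerm (A : Matrix (Fin n) (Fin n) ℂ) := rfl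

variable {k : ℕ} (ty : TypeBC)

theorem continuous_rootElement (x : DoubleLetter k) :
    Continuous fun c : ℂ => (rootElement ty x c : Matrix (Fin (ty.dim k)) (Fin (ty.dim k)) ℂ) := by
  simp only [rootElement_val, quadExp]
  fun_prop

/-- A small deformation inside a double Bruhat cell. -/
theorem exists_deformation (i : Fin k) {A : GL (Fin (ty.dim k)) ℂ}
    (hA : A ∈ isometryGroup (ty.dim k)) :
    ∃ M : ℂ → Matrix (Fin (ty.dim k)) (Fin (ty.dim k)) ℂ, Filter.Tendsto M (nhds 0) (nhds 1) ∧
      ∀ᶠ s in nhds (0 : ℂ), ∃ U ∈ upperIsometries (ty.dim k), ∃ L,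
        flipGL L ∈ upperIsometries (ty.dim k) ∧
        (L : Matrix (Fin (ty.dim k)) (Fin (ty.dim k)) ℂ) = M s ∧
        rootElement ty ⟨i, true⟩ s * A * U = A * L := by
  -- This tends to `1` with `s`, so `N s = L U⁻¹` with triangular isometries for small `s`. Then
  -- `x_i(s) A U = A L`: the left side shows how the upper cell is met, the right side that the
  -- lower cell is not left.
  let N : ℂ → GL (Fin (ty.dim k)) ℂ := fun s => A⁻¹ * rootElement ty ⟨i, true⟩ s * A
  have hNc : Continuous fun s => (N s : Matrix (Fin (ty.dim k)) (Fin (ty.dim k)) ℂ) := by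
    simp only [N, Units.val_mul]
    exact (continuous_const.mul (continuous_rootElement ty _)).mul continuous_const
  have hN0 : (N 0 : Matrix (Fin (ty.dim k)) (Fin (ty.dim k)) ℂ) = 1 := by
    simp only [N, rootElement_zero, mul_one, inv_mul_cancel, Units.val_one]
  have hNt : Filter.Tendsto (fun s => (N s : Matrix (Fin (ty.dim k)) (Fin (ty.dim k)) ℂ)) (nhds 0)
      (nhds 1) := hN0 ▸ hNc.tendsto 0
  refine ⟨fun s => N s * upperFactor (N s : Matrix (Fin (ty.dim k)) (Fin (ty.dim k)) ℂ), ?_, ?_⟩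
  · have h1 := continuousAt_upperFactor_one (n := ty.dim k)
    rw [ContinuousAt, upperFactor_one] at h1
    have := hNt.mul (h1.comp hNt)
    rwa [one_mul] at this
  · filter_upwards [hNt.eventually eventually_det_leadingBlock_ne_zero] with s hs
    obtain ⟨U, hU, L, hL, h1, h2⟩ := exists_upper_lower (N := N s)
      (mul_mem (mul_mem (inv_mem hA) (rootElement_mem ..)) hA) hs
    refine ⟨U, hU, L, hL, h1, ?_⟩
    rw [← h2]; simp only [N]; group

/-- Every element `A` of the bigger cell is a limit, as `s → 0`, of elements `A L = x_i(s) A U`. For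
all but one value of `s` these are of the form `x_{-i}(c) (A' U)` with `A' U` in the smaller double
cell, where `F` vanishes by hypothesis. -/
theorem eq_zero_of_forall_rootElement_neg_mul (i : Fin k) {σ τ : Equiv.Perm (Fin (ty.dim k))}
    {F : Matrix (Fin (ty.dim k)) (Fin (ty.dim k)) ℂ → ℂ} (hF : Continuous F)
    (h : ∀ c : ℂ, c ≠ 0 → ∀ A ∈ upperCell σ, flipGL A ∈ upperCell τ →
      F ((rootElement ty ⟨i, false⟩ c * A : GL (Fin (ty.dim k)) ℂ) : Matrix _ _ ℂ) = 0)
    {A : GL (Fin (ty.dim k)) ℂ} (hA : A ∈ upperCell (simpleReflection ty i * σ))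
    (hA' : flipGL A ∈ upperCell τ) : F (A : Matrix _ _ ℂ) = 0 := by
  obtain ⟨M, hM, hev⟩ := exists_deformation ty i (mem_isometryGroup_of_mem_upperCell hA)
  obtain ⟨d, hd⟩ := exists_eq_rootElement_neg_mul ty hA
  -- Working in a punctured neighbourhood covers the case that the excluded value is `0` itself.
  have h1 : ∀ᶠ s in nhdsWithin (0 : ℂ) {0}ᶜ, s ≠ d := by
    by_cases h0 : d = 0
    · subst h0; exact self_mem_nhdsWithin
    · exact (continuousAt_id.eventually_ne (fun h => h0 h.symm)).filter_mono nhdsWithin_le_nhds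
  have h2 : Filter.Tendsto (fun s => F ((A : Matrix _ _ ℂ) * M s)) (nhdsWithin (0 : ℂ) {0}ᶜ)
      (nhds (F (A : Matrix _ _ ℂ))) := by
    have : Filter.Tendsto (fun s => (A : Matrix _ _ ℂ) * M s) (nhds 0) (nhds (A : Matrix _ _ ℂ)) := by
      have := (tendsto_const_nhds (x := (A : Matrix (Fin (ty.dim k)) (Fin (ty.dim k)) ℂ))).mul hM
      rwa [mul_one] at this
    exact ((hF.tendsto _).comp this).mono_left nhdsWithin_le_nhds
  refine tendsto_nhds_unique (h2.congr' ?_) tendsto_const_nhds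
  filter_upwards [h1, hev.filter_mono nhdsWithin_le_nhds] with s hs ⟨U, hU, L, hL, hLM, hUL⟩
  obtain ⟨c, hc, A', hA'σ, hcA'⟩ := hd s hs
  rw [hcA', mul_assoc] at hUL
  -- Read this way, `A' U` is `A` multiplied by lower triangular elements on both sides, so it has
  -- the same lower cell as `A`.
  have h3 : A' * U = rootElement ty ⟨i, false⟩ (-c) * (A * L) := by
    rw [← hUL, ← mul_assoc, rootElement_mul, neg_add_cancel, rootElement_zero, one_mul]
  have h4 := h c hc (A' * U) (upperCell_mul_right hA'σ hU) (by
    rw [h3, map_mul, map_mul, flipGL_rootElement]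
    exact upperCell_mul_left (upperCell_mul_right hA' hL) (rootElement_pos_mem ..))
  rw [hUL, Units.val_mul, hLM] at h4
  exact h4

/-- The products of non-trivial elements of root subgroups, in the order prescribed by a word, and of
a diagonal matrix. -/
def wordSet : List (DoubleLetter k) → Set (GL (Fin (ty.dim k)) ℂ)
  | [] => {A | A ∈ isometryGroup (ty.dim k) ∧
      ∀ i j, i ≠ j → (A : Matrix (Fin (ty.dim k)) (Fin (ty.dim k)) ℂ) i j = 0}
  | x :: l => {A | ∃ c : ℂ, c ≠ 0 ∧ ∃ A' ∈ wordSet l, A = rootElement ty x c * A'}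

theorem mem_upperIsometries_of_mem_upperCell_one {n : ℕ} {A : GL (Fin n) ℂ}
    (hA : A ∈ upperCell (1 : Equiv.Perm (Fin n))) : A ∈ upperIsometries n := by
  obtain ⟨b₁, h₁, N, hN, b₂, h₂, rfl⟩ := hA
  refine mul_mem (mul_mem h₁ ⟨hN.1, fun a b hab => ?_⟩) h₂
  by_contra h
  exact (ne_of_gt hab) (hN.2 _ _ h)

theorem mem_upperCell_one_of_mem_upperIsometries {n : ℕ} {A : GL (Fin n) ℂ}
    (hA : A ∈ upperIsometries n) : A ∈ upperCell (1 : Equiv.Perm (Fin n)) :=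
  ⟨A, hA, 1, ⟨one_mem _, fun i j h => by
    by_contra hij
    exact h (Matrix.one_apply_ne hij)⟩, 1, one_mem _, by simp⟩

/-- A negative letter enlarges the upper cell because it is an ascent, and it belongs to the lower
Borel subgroup, so that the lower cell does not change. For positive letters the roles are
exchanged. -/
theorem wordSet_subset {l : List (DoubleLetter k)} (hl : IsAscending ty l)
    {A : GL (Fin (ty.dim k)) ℂ} (hA : A ∈ wordSet ty l) :
    A ∈ upperCell (weylList ty false l) ∧ flipGL A ∈ upperCell (weylList ty true l) := by
  induction l generalizing A with
  | nil =>
    refine ⟨mem_upperCell_one_of_mem_upperIsometries ⟨hA.1, fun a b hab => hA.2 a b (ne_of_gt hab)⟩,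
      mem_upperCell_one_of_mem_upperIsometries ⟨flipGL_mem_isometryGroup hA.1, fun a b hab => ?_⟩⟩
    exact hA.2 _ _ fun h => (ne_of_gt hab) (Fin.rev_injective h)
  | cons x l ih =>
    obtain ⟨c, hc, A', hA', rfl⟩ := hA
    obtain ⟨h1, h2⟩ := ih hl.2 hA'
    have hasc := hl.1
    obtain ⟨i, s⟩ := x
    rw [weylList_cons, weylList_cons, map_mul, flipGL_rootElement]
    cases s
    · exact ⟨rootElement_neg_mul_mem_upperCell ty (weylList_commutesRev ty _ _) hasc h1 hc,
        by simpa using upperCell_mul_left h2 (rootElement_pos_mem ..)⟩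
    · exact ⟨by simpa using upperCell_mul_left h1 (rootElement_pos_mem ..),
        rootElement_neg_mul_mem_upperCell ty (weylList_commutesRev ty _ _) hasc h2 hc⟩

/-- Continuous functions vanishing on `wordSet` vanish on the whole double Bruhat cell. -/
theorem eq_zero_of_forall_wordSet (l : List (DoubleLetter k)) :
    ∀ F : Matrix (Fin (ty.dim k)) (Fin (ty.dim k)) ℂ → ℂ, Continuous F →
      (∀ A ∈ wordSet ty l, F (A : Matrix _ _ ℂ) = 0) →
      ∀ A : GL (Fin (ty.dim k)) ℂ, A ∈ upperCell (weylList ty false l) →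
        flipGL A ∈ upperCell (weylList ty true l) → F (A : Matrix _ _ ℂ) = 0 := by
  induction l with
  | nil =>
    intro F _ h A hA hA'
    have h1 := mem_upperIsometries_of_mem_upperCell_one hA
    have h2 := mem_upperIsometries_of_mem_upperCell_one hA'
    refine h A ⟨h1.1, fun i j hij => ?_⟩
    -- For the empty word both cells are Borel subgroups, and a matrix that is upper and lower
    -- triangular is diagonal.
    rcases lt_or_gt_of_ne hij with h3 | h3
    · have := h2.2 (i := i.rev) (j := j.rev) (Fin.rev_lt_rev.mpr h3)
      rwa [flipGL_apply, Fin.rev_rev, Fin.rev_rev] at this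
    · exact h1.2 h3
  | cons x l ih =>
    intro F hF h A hA hA'
    -- For a fixed parameter of the first letter, translation of `F` gives another continuous
    -- function, to which the induction applies.
    have key : ∀ c : ℂ, c ≠ 0 → ∀ A ∈ upperCell (weylList ty false l),
        flipGL A ∈ upperCell (weylList ty true l) →
        F ((rootElement ty x c * A : GL (Fin (ty.dim k)) ℂ) : Matrix _ _ ℂ) = 0 := by
      intro c hc
      exact ih (fun B => F ((rootElement ty x c : Matrix _ _ ℂ) * B))
        (hF.comp (continuous_const.mul continuous_id)) fun B hB => h _ ⟨c, hc, B, hB, rfl⟩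
    obtain ⟨i, s⟩ := x
    rw [weylList_cons] at hA hA'
    cases s
    · exact eq_zero_of_forall_rootElement_neg_mul ty i hF key hA (by simpa using hA')
    -- For a positive letter the reversal interchanges the two cells and turns `x_i` into `x_{-i}`.
    · have := eq_zero_of_forall_rootElement_neg_mul ty i
        (F := fun B => F (Matrix.reindexAlgEquiv ℂ ℂ Fin.revPerm B))
        (hF.comp (Continuous.matrix_submatrix continuous_id _ _)) (σ := weylList ty true l) (τ := weylList ty false l)
        (fun c hc B hB hB' => ?_) (A := flipGL A) hA' (by rw [flipGL_flipGL]; simpa using hA)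
      · rwa [← flipGL_val, flipGL_flipGL] at this
      · rw [← flipGL_val, map_mul, flipGL_rootElement]
        exact key c hc (flipGL B) hB' (by rwa [flipGL_flipGL])

end Density

/-! ### Diagonal matrices modulo scalars -/

section Torus

variable {n : ℕ}

/-- Invertible diagonal matrices. -/
noncomputable def diagGL : (Fin n → ℂˣ) →* GL (Fin n) ℂ :=
  (Units.map (Matrix.diagonalRingHom (Fin n) ℂ).toMonoidHom).comp
    (MulEquiv.piUnits.symm : (Fin n → ℂˣ) ≃* (Fin n → ℂ)ˣ).toMonoidHom

theorem diagGL_val (v : Fin n → ℂˣ) :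
    (diagGL v : Matrix (Fin n) (Fin n) ℂ) = Matrix.diagonal fun a => (v a : ℂ) := rfl

/-- Equal ratios of neighbouring entries propagate along the diagonal, so the two matrices differ by
the ratio of their first entries. -/
theorem mk_diagGL_eq {v v' : Fin n → ℂˣ}
    (h : ∀ a b : Fin n, (b : ℕ) = a + 1 → v a / v b = v' a / v' b) :
    Matrix.ProjGenLinGroup.mk (diagGL v) = Matrix.ProjGenLinGroup.mk (diagGL v') := by
  rw [Matrix.ProjGenLinGroup.mk_eq_mk_iff]
  rcases Nat.eq_zero_or_pos n with hn | hn
  · subst hn; exact ⟨1, Units.ext (Subsingleton.elim _ _)⟩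
  refine ⟨v' ⟨0, hn⟩ / v ⟨0, hn⟩, ?_⟩
  have key : ∀ m : ℕ, ∀ hm : m < n, v' ⟨m, hm⟩ / v ⟨m, hm⟩ = v' ⟨0, hn⟩ / v ⟨0, hn⟩ := by
    intro m
    induction m with
    | zero => intro _; rfl
    | succ m ih =>
      intro hm
      rw [← ih (by omega)]
      have := h ⟨m, by omega⟩ ⟨m + 1, hm⟩ rfl
      rw [div_eq_div_iff_mul_eq_mul] at this ⊢
      rw [mul_comm, ← this, mul_comm]
  apply Units.ext
  ext a b
  rw [Units.val_mul, diagGL_val, diagGL_val, Matrix.GeneralLinearGroup.coe_scalar]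
  rw [Matrix.scalar_apply, Matrix.diagonal_mul_diagonal, ← key a a.2]
  by_cases hab : a = b
  · subst hab
    rw [Matrix.diagonal_apply_eq, Matrix.diagonal_apply_eq, ← Units.val_mul, mul_div_cancel]
  · rw [Matrix.diagonal_apply_ne _ hab, Matrix.diagonal_apply_ne _ hab]

theorem div_eq_div_of_mk_diagGL_eq {v v' : Fin n → ℂˣ}
    (h : Matrix.ProjGenLinGroup.mk (diagGL v) = Matrix.ProjGenLinGroup.mk (diagGL v'))
    (a b : Fin n) : v a / v b = v' a / v' b := by
  rw [Matrix.ProjGenLinGroup.mk_eq_mk_iff] at h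
  obtain ⟨u, hu⟩ := h
  have key : ∀ c, v c * u = v' c := fun c => by
    have := congrArg (fun X : GL (Fin n) ℂ => (X : Matrix (Fin n) (Fin n) ℂ) c c) hu
    simp only [Units.val_mul, diagGL_val, Matrix.GeneralLinearGroup.coe_scalar] at this
    rw [Matrix.scalar_apply, Matrix.diagonal_mul_diagonal, Matrix.diagonal_apply_eq,
      Matrix.diagonal_apply_eq] at this
    exact Units.ext this
  rw [← key, ← key, mul_div_mul_right_eq_div]

theorem diagonal_mul_formOmega_mul {v : Fin n → ℂ} (h : ∀ a, v a * v a.rev = 1) :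
    Matrix.diagonal v * formOmega n * (Matrix.diagonal v).transpose = formOmega n := by
  ext a b
  rw [Matrix.diagonal_transpose, Matrix.mul_diagonal, Matrix.diagonal_mul, formOmega]
  split_ifs with hab
  · rw [hab, mul_right_comm, h, one_mul]
  · rw [mul_zero, zero_mul]

/-- The diagonal matrix `exp (s h)`. -/
noncomputable def expDiag (h : Fin n → ℂ) (s : ℂ) : Fin n → ℂˣ :=
  fun a => Units.mk0 (Complex.exp (s * h a)) (Complex.exp_ne_zero _)

/-- As for the root subgroups, the determinant is `1` because the matrix is the square of the one
with parameter `s / 2`. -/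
theorem expDiag_mem_isometryGroup {h : Fin n → ℂ} (hh : ∀ a, h a.rev = - h a) (s : ℂ) :
    diagGL (expDiag h s) ∈ isometryGroup n := by
  have hform : ∀ s, Matrix.diagonal (fun a => (expDiag h s a : ℂ)) * formOmega n *
      (Matrix.diagonal (fun a => (expDiag h s a : ℂ))).transpose = formOmega n := fun s =>
    diagonal_mul_formOmega_mul fun a => by
      simp only [expDiag, Units.val_mk0, hh]
      rw [← Complex.exp_add, mul_neg, add_neg_cancel, Complex.exp_zero]
  refine ⟨hform s, ?_⟩
  have h2 := congrArg Matrix.det (hform (s / 2))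
  rw [Matrix.det_mul, Matrix.det_mul, Matrix.det_transpose, mul_right_comm] at h2
  have h3 := mul_right_cancel₀ det_formOmega_ne_zero (h2.trans (one_mul _).symm)
  rw [diagGL_val, ← h3, ← Matrix.det_mul, Matrix.diagonal_mul_diagonal]
  congr 2
  ext a
  simp only [expDiag, Units.val_mk0]
  rw [← Complex.exp_add]
  congr 1; ring

theorem exp_diagonal_smul (h : Fin n → ℂ) (s : ℂ) :
    expPGL (s • Matrix.diagonal h) = Matrix.ProjGenLinGroup.mk (diagGL (expDiag h s)) := by
  rw [expPGL]
  congr 1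
  apply Units.ext
  rw [IsUnit.unit_spec, diagGL_val, ← Matrix.diagonal_smul, Matrix.exp_diagonal]
  congr 1
  ext a
  rw [Pi.coe_exp]
  simp [expDiag, Complex.exp_eq_exp_ℂ]

end Torus

/-! ### Fundamental coweights and the elements `Y_i(t)` -/

section Cocharacters

variable {k : ℕ} (ty : TypeBC)

theorem coweightSum_apply {n : ℕ} (i : ℕ) (hi : i ≤ n) (a b : Fin n) :
    coweightSum n i a b = if a = b then
      (if (a : ℕ) < i then 1 else 0) - (if n ≤ (a : ℕ) + i then 1 else 0) else 0 := by
  induction i with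
  | zero =>
    have := a.2
    simp [coweightSum, this]
  | succ i ih =>
    have ha := a.2
    have hb := b.2
    have : coweightSum n (i + 1) = coweightSum n i +
        (matrixUnit n (i + 1) (i + 1) - matrixUnit n (n + 1 - (i + 1)) (n + 1 - (i + 1))) := by
      rw [coweightSum, Finset.sum_Icc_succ_top (by omega), coweightSum]
    rw [this, Matrix.add_apply, Matrix.sub_apply, ih (by omega)]
    simp only [matrixUnit, Fin.ext_iff]
    split_ifs <;> first | omega | norm_num

/-- The denominators of the fundamental coweights. -/
noncomputable def coweightScale (i : Fin k) : ℂ :=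
  match ty with
  | .C => if (i : ℕ) + 1 < k then 1 else 1 / 2
  | .B => 1

/-- The diagonal entries of the fundamental coweights. -/
noncomputable def coweightDiag (i : Fin k) (a : Fin (ty.dim k)) : ℂ :=
  coweightScale ty i *
  ((if (a : ℕ) < i + 1 then 1 else 0) - (if ty.dim k ≤ (a : ℕ) + (i + 1) then 1 else 0))

theorem coweight_eq (i : Fin k) :
    coweight ty k (i + 1) = Matrix.diagonal (coweightDiag ty i) := by
  have hd := ty.two_mul_le_dim k
  have hi := i.2
  have hle : (i : ℕ) + 1 ≤ ty.dim k := by omega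
  ext a b
  rw [Matrix.diagonal_apply]
  have key := coweightSum_apply (i + 1) hle a b
  unfold coweight coweightDiag coweightScale
  cases ty
  · simp only [one_mul]; exact key
  · by_cases hk : (i : ℕ) + 1 < k
    · simp only [hk, if_true, one_mul]; exact key
    · simp only [hk, if_false]
      rw [Matrix.smul_apply, key, smul_eq_mul]
      split_ifs <;> simp

theorem coweightDiag_rev (i : Fin k) (a : Fin (ty.dim k)) :
    coweightDiag ty i a.rev = - coweightDiag ty i a := by
  have ha := a.2
  unfold coweightDiag
  rw [← mul_neg]
  congr 1
  rw [Fin.val_rev]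
  split_ifs <;> first | omega | norm_num

/-- Duality with the simple roots: the diagonal drops at the strips `i + 1` and `n - (i + 1)` and
nowhere else. For the last root in type `C` these strips coincide and the drop is doubled, which the
denominator `2` of the coweight corrects. -/
theorem coweightDiag_sub (i : Fin k) (a b : Fin (ty.dim k)) (hab : (b : ℕ) = a + 1) :
    coweightDiag ty i a - coweightDiag ty i b =
      if (b : ℕ) = i + 1 ∨ (b : ℕ) + (i + 1) = ty.dim k then 1 else 0 := by
  have hd := ty.two_mul_le_dim k
  have hb := b.2
  have hi := i.2
  unfold coweightDiag coweightScale
  rw [← mul_sub]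
  cases ty
  · have hB : TypeBC.B.dim k = 2 * k + 1 := rfl
    simp only
    split_ifs <;> first | omega | norm_num
  · have hC : TypeBC.C.dim k = 2 * k := rfl
    simp only
    split_ifs <;> first | omega | norm_num

/-- The diagonal entries of `Y_i(t)`. -/
noncomputable def cocharDiag (i : Fin k) (t : ℂˣ) : Fin (ty.dim k) → ℂˣ :=
  expDiag (coweightDiag ty i) (Complex.log t)

theorem cocharacterY_eq (i : Fin k) (t : ℂˣ) :
    cocharacterY ty k (i + 1) t = Matrix.ProjGenLinGroup.mk (diagGL (cocharDiag ty i t)) := by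
  rw [cocharacterY, coweight_eq, exp_diagonal_smul]; rfl

/-- The diagonal entries may depend on the branch of the logarithm, through half-integral coweights,
but these ratios do not; they are all that matters in `PGL`. -/
theorem cocharDiag_div (i : Fin k) (t : ℂˣ) (a b : Fin (ty.dim k)) (hab : (b : ℕ) = a + 1) :
    cocharDiag ty i t a / cocharDiag ty i t b =
      if (b : ℕ) = i + 1 ∨ (b : ℕ) + (i + 1) = ty.dim k then t else 1 := by
  apply Units.ext
  rw [Units.val_div_eq_div_val]
  simp only [cocharDiag, expDiag, Units.val_mk0]
  rw [← Complex.exp_sub, ← mul_sub, coweightDiag_sub ty i a b hab]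
  split_ifs
  · rw [mul_one, Complex.exp_log t.ne_zero]
  · rw [mul_zero, Complex.exp_zero, Units.val_one]

/-- The diagonal entries of `Y_1(t_1) ⋯ Y_k(t_k)`. -/
noncomputable def torusDiag (t : Fin k → ℂˣ) : Fin (ty.dim k) → ℂˣ := ∏ i, cocharDiag ty i (t i)

theorem prod_cocharacterY (t : Fin k → ℂˣ) :
    (List.ofFn fun i : Fin k => cocharacterY ty k (i + 1) (t i)).prod =
      Matrix.ProjGenLinGroup.mk (diagGL (torusDiag ty t)) := by
  simp only [cocharacterY_eq]
  rw [torusDiag, ← List.prod_ofFn, map_list_prod, map_list_prod, List.map_ofFn, List.map_ofFn]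
  rfl

theorem diagGL_torusDiag_mem (t : Fin k → ℂˣ) :
    diagGL (torusDiag ty t) ∈ isometryGroup (ty.dim k) := by
  rw [torusDiag, ← List.prod_ofFn, map_list_prod, List.map_ofFn]
  refine Subgroup.list_prod_mem _ fun x hx => ?_
  obtain ⟨i, rfl⟩ := List.mem_ofFn.mp hx
  exact expDiag_mem_isometryGroup (coweightDiag_rev ty i) _

theorem torusDiag_div (t : Fin k → ℂˣ) (a b : Fin (ty.dim k)) (hab : (b : ℕ) = a + 1) (i : Fin k)
    (hi : (b : ℕ) = i + 1 ∨ (b : ℕ) + (i + 1) = ty.dim k) :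
    torusDiag ty t a / torusDiag ty t b = t i := by
  have hd := ty.two_mul_le_dim k
  have hb := b.2
  rw [torusDiag, Finset.prod_apply, Finset.prod_apply, ← Finset.prod_div_distrib,
    Finset.prod_eq_single i]
  · rw [cocharDiag_div ty i _ a b hab, if_pos hi]
  · intro j _ hj
    have := j.2
    have := i.2
    rw [cocharDiag_div ty j _ a b hab, if_neg]
    rw [Ne, Fin.ext_iff] at hj
    omega
  · simp

/-- The root whose rungs lie in strip `r`. -/
theorem exists_stripIndex {r : ℕ} (h1 : 1 ≤ r) (h2 : r < ty.dim k) :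
    ∃ i : Fin k, r = i + 1 ∨ r + (i + 1) = ty.dim k := by
  have hd' := ty.dim_le k
  by_cases h : r ≤ k
  · exact ⟨⟨r - 1, by omega⟩, Or.inl (by simp only []; omega)⟩
  · exact ⟨⟨ty.dim k - r - 1, by omega⟩, Or.inr (by simp only []; omega)⟩

theorem mul_rev_eq_of_mem_isometryGroup {n : ℕ} {v : Fin n → ℂˣ} (h : diagGL v ∈ isometryGroup n)
    (a : Fin n) : v a * v a.rev = 1 := by
  have h1 := congrFun (congrFun h.1 a) a.rev
  rw [diagGL_val, Matrix.diagonal_transpose, Matrix.mul_diagonal, Matrix.diagonal_mul, formOmega,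
    if_pos rfl, mul_right_comm] at h1
  apply Units.ext
  rw [Units.val_mul, Units.val_one]
  exact mul_right_cancel₀ (pow_ne_zero _ (by norm_num : (-1 : ℂ) ≠ 0)) (h1.trans (one_mul _).symm)

/-- Diagonal isometries are determined, up to scalars, by their simple roots. -/
theorem mk_diagGL_eq_of_isometry {v v' : Fin (ty.dim k) → ℂˣ}
    (h : diagGL v ∈ isometryGroup (ty.dim k)) (h' : diagGL v' ∈ isometryGroup (ty.dim k))
    (heq : ∀ i : Fin k, ∀ a b : Fin (ty.dim k), (a : ℕ) = i → (b : ℕ) = i + 1 →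
      v a / v b = v' a / v' b) :
    Matrix.ProjGenLinGroup.mk (diagGL v) = Matrix.ProjGenLinGroup.mk (diagGL v') := by
  refine mk_diagGL_eq fun a b hab => ?_
  obtain ⟨i, hi | hi⟩ := exists_stripIndex ty (r := b) (by omega) b.2
  · exact heq i a b (by omega) hi
  · have h1 := heq i b.rev a.rev (by rw [Fin.val_rev]; omega) (by rw [Fin.val_rev]; omega)
    have e1 : ∀ c, v c.rev = (v c)⁻¹ := fun c =>
      eq_inv_of_mul_eq_one_right (mul_rev_eq_of_mem_isometryGroup h c)
    have e2 : ∀ c, v' c.rev = (v' c)⁻¹ := fun c =>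
      eq_inv_of_mul_eq_one_right (mul_rev_eq_of_mem_isometryGroup h' c)
    rw [e1, e1, e2, e2] at h1
    simpa [div_eq_mul_inv, mul_comm] using h1

end Cocharacters

/-! ### Fock–Goncharov products as products of root subgroup elements -/

section FockGoncharov

variable {k : ℕ} (ty : TypeBC)

/-- `c` or its inverse, according to a sign. -/
noncomputable def signPow (s : Bool) (c : ℂˣ) : ℂˣ := if s then c else c⁻¹

/-- The torus scales the `i`-th root subgroup by the value `α` of the simple root, and the opposite
one by `α⁻¹`; the corner entry in type `B` scales by `α ^ 2`, consistently with its being quadratic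
in the parameter. -/
theorem diagGL_mul_rootElement (x : DoubleLetter k) {v : Fin (ty.dim k) → ℂˣ} {α : ℂˣ}
    (hv : ∀ a b : Fin (ty.dim k), (b : ℕ) = a + 1 →
      ((b : ℕ) = x.idx + 1 ∨ (b : ℕ) + (x.idx + 1) = ty.dim k) → v a / v b = α) (c : ℂ) :
    diagGL v * rootElement ty x c = rootElement ty x (signPow x.pos α * c) * diagGL v := by
  obtain ⟨i, s⟩ := x
  have hv1 : ∀ a b : Fin (ty.dim k), (b : ℕ) = a + 1 →
      ((b : ℕ) = i + 1 ∨ (b : ℕ) + (i + 1) = ty.dim k) → (v a : ℂ) = α * v b := by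
    intro a b h1 h2
    rw [← hv a b h1 h2, ← Units.val_mul, div_mul_cancel]
  have hv2 : ∀ a b : Fin (ty.dim k), (b : ℕ) = a + 2 ∧ (a : ℕ) = i ∧ (b : ℕ) + (i + 1) = ty.dim k →
      (v a : ℂ) = α ^ 2 * v b := by
    rintro a b ⟨h1, h2, h3⟩
    have hb := b.2
    rw [hv1 a ⟨a + 1, by omega⟩ rfl (Or.inl (by simp only []; omega)),
      hv1 ⟨a + 1, by omega⟩ b (by simp only []; omega) (Or.inr h3)]
    ring
  have key : ∀ (c : ℂ) (a b : Fin (ty.dim k)),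
      (v a : ℂ) * (rootElement ty ⟨i, true⟩ c : Matrix (Fin (ty.dim k)) (Fin (ty.dim k)) ℂ) a b =
      (rootElement ty ⟨i, true⟩ (α * c) : Matrix (Fin (ty.dim k)) (Fin (ty.dim k)) ℂ) a b * v b := by
    intro c a b
    rw [rootElement_pos_apply, rootElement_pos_apply]
    split_ifs with h1 h2 h3
    · rw [h1]; ring
    · rw [hv1 a b h2.1 h2.2]; ring
    · rw [hv2 a b h3]; ring
    · ring
  apply Units.ext
  ext a b
  rw [Units.val_mul, Units.val_mul, diagGL_val, Matrix.diagonal_mul, Matrix.mul_diagonal]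
  cases s
  · rw [rootElement_neg_apply, rootElement_neg_apply]
    simp only [signPow]
    have := key ((α⁻¹ : ℂˣ) * c) b a
    rw [← mul_assoc, ← Units.val_mul, mul_inv_cancel, Units.val_one, one_mul] at this
    simp only [Bool.false_eq_true, if_false]
    linear_combination -this
  · exact key c a b

theorem letterX_eq (x : DoubleLetter k) :
    letterX ty x = Matrix.ProjGenLinGroup.mk (rootElement ty x 1) := by
  rw [letterX, expPGL]
  congr 1
  apply Units.ext
  rw [IsUnit.unit_spec]
  exact exp_eq_quadExp (chevalley_cube ty x)

/-- The variables that remain after splitting off the first letter. -/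
noncomputable def shiftVars {m : ℕ} (w : Fin (m + 1) → DoubleLetter k)
    (t : Fin k ⊕ Fin (m + 1) → ℂˣ) : Fin k ⊕ Fin m → ℂˣ :=
  Sum.elim (fun j => t (.inl j) * if j = (w 0).idx then t (.inr 0) else 1) fun p => t (.inr p.succ)

/-- The leading torus element passes the first letter, leaving the value of the corresponding simple
root, or its inverse, as parameter. It then meets the `Y_i` that follows and absorbs the variable of
that factor. -/
theorem fockGoncharov_succ {m : ℕ} (w : Fin (m + 1) → DoubleLetter k)
    (t : Fin k ⊕ Fin (m + 1) → ℂˣ) :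
    fockGoncharov ty w t =
      Matrix.ProjGenLinGroup.mk (rootElement ty (w 0) (signPow (w 0).pos (t (.inl (w 0).idx)))) *
        fockGoncharov ty (fun p => w p.succ) (shiftVars w t) := by
  unfold fockGoncharov
  rw [prod_cocharacterY, prod_cocharacterY, List.ofFn_succ, List.prod_cons, letterX_eq]
  have h1 := diagGL_mul_rootElement ty (w 0) (v := torusDiag ty fun i => t (.inl i))
    (α := t (.inl (w 0).idx)) (fun a b h1 h2 => torusDiag_div ty _ a b h1 _ h2) 1
  rw [mul_one] at h1
  rw [show (w 0).abs = (w 0).idx + 1 from rfl, cocharacterY_eq, ← mul_assoc, ← mul_assoc,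
    ← map_mul, h1, map_mul, mul_assoc (Matrix.ProjGenLinGroup.mk _) (Matrix.ProjGenLinGroup.mk _)
      (Matrix.ProjGenLinGroup.mk _), ← map_mul Matrix.ProjGenLinGroup.mk, ← map_mul diagGL, mul_assoc]
  congr 2
  apply mk_diagGL_eq_of_isometry
  · rw [map_mul]
    exact mul_mem (diagGL_torusDiag_mem ty _)
      (expDiag_mem_isometryGroup (coweightDiag_rev ty _) _)
  · exact diagGL_torusDiag_mem ty _
  · intro i a b ha hb
    rw [torusDiag_div ty _ a b (by omega) i (Or.inl hb), Pi.mul_apply, Pi.mul_apply,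
      mul_div_mul_comm, torusDiag_div ty _ a b (by omega) i (Or.inl hb),
      cocharDiag_div ty _ _ a b (by omega)]
    simp only [shiftVars, Sum.elim_inl]
    congr 1
    have hd := ty.two_mul_le_dim k
    have h3 := i.2
    have h4 := (w 0).idx.2
    have : ((b : ℕ) = (w 0).idx + 1 ∨ (b : ℕ) + ((w 0).idx + 1) = ty.dim k) ↔ i = (w 0).idx := by
      rw [Fin.ext_iff]; omega
    simp only [this]

theorem exists_wordSet_eq_fockGoncharov {m : ℕ} (w : Fin m → DoubleLetter k)
    (t : Fin k ⊕ Fin m → ℂˣ) :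
    ∃ A ∈ wordSet ty (List.ofFn w), Matrix.ProjGenLinGroup.mk A = fockGoncharov ty w t := by
  induction m with
  | zero =>
    refine ⟨diagGL (torusDiag ty fun i => t (.inl i)), ?_, ?_⟩
    · rw [List.ofFn_zero]
      refine ⟨diagGL_torusDiag_mem ty _, fun i j hij => ?_⟩
      rw [diagGL_val, Matrix.diagonal_apply_ne _ hij]
    · rw [fockGoncharov, prod_cocharacterY, List.ofFn_zero, List.prod_nil, mul_one]
  | succ m ih =>
    obtain ⟨A, hA, h⟩ := ih (fun p => w p.succ) (shiftVars w t)
    refine ⟨_, ?_, by rw [fockGoncharov_succ, ← h, ← map_mul]⟩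
    rw [List.ofFn_succ]
    exact ⟨_, Units.ne_zero _, A, hA, rfl⟩

/-- Together with the previous lemma, this identifies the image of the parametrization with the
classes of the elements of `wordSet`, the set for which density is known. -/
theorem exists_fockGoncharov_eq {m : ℕ} (w : Fin m → DoubleLetter k) {A : GL (Fin (ty.dim k)) ℂ}
    (hA : A ∈ wordSet ty (List.ofFn w)) :
    ∃ t, fockGoncharov ty w t = Matrix.ProjGenLinGroup.mk A := by
  induction m generalizing A with
  | zero =>
    rw [List.ofFn_zero] at hA
    have hd := ty.two_mul_le_dim k
    have hup : (A : Matrix (Fin (ty.dim k)) (Fin (ty.dim k)) ℂ).BlockTriangular id :=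
      fun a b hab => hA.2 a b (ne_of_gt hab)
    let v : Fin (ty.dim k) → ℂˣ := fun a => Units.mk0 _ (diag_ne_zero_of_blockTriangular hup a)
    have hv : A = diagGL v := by
      apply Units.ext
      ext a b
      rw [diagGL_val]
      by_cases hab : a = b
      · subst hab; rw [Matrix.diagonal_apply_eq]; rfl
      · rw [Matrix.diagonal_apply_ne _ hab, hA.2 a b hab]
    refine ⟨Sum.elim (fun i => v ⟨i, by have := i.2; omega⟩ / v ⟨i + 1, by have := i.2; omega⟩)
      fun p => p.elim0, ?_⟩
    rw [fockGoncharov, prod_cocharacterY, List.ofFn_zero, List.prod_nil, mul_one, hv]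
    apply mk_diagGL_eq_of_isometry
    · exact diagGL_torusDiag_mem ty _
    · rw [← hv]; exact hA.1
    · intro i a b ha hb
      rw [torusDiag_div ty _ a b (by omega) i (Or.inl hb)]
      simp only [Sum.elim_inl]
      congr 2 <;> exact Fin.ext (by simp only []; omega)
  | succ m ih =>
    rw [List.ofFn_succ] at hA
    obtain ⟨c, hc, A', hA', rfl⟩ := hA
    obtain ⟨t', ht'⟩ := ih (fun p => w p.succ) hA'
    let c' : ℂˣ := signPow (w 0).pos (Units.mk0 c hc)
    -- Solve for the variables: the parameter of the first letter gives the leading variable of its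
    -- index, and the variable behind the letter is the quotient that restores the corresponding
    -- variable of the rest.
    refine ⟨Sum.elim (fun j => if j = (w 0).idx then c' else t' (.inl j))
      (Fin.cons (t' (.inl (w 0).idx) / c') fun p => t' (.inr p)), ?_⟩
    rw [fockGoncharov_succ, map_mul, ← ht']
    congr 1
    · simp only [Sum.elim_inl, if_true, c', signPow]
      congr 2
      split_ifs <;> simp
    · congr 1
      ext a
      rcases a with j | p
      · simp only [shiftVars, Sum.elim_inl, Sum.elim_inr, Fin.cons_zero]
        by_cases hj : j = (w 0).idx
        · subst hj; simp
        · simp [hj]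
      · simp [shiftVars]

theorem scalar_mem_upperIsometries {n : ℕ} {u : ℂˣ}
    (h : Matrix.GeneralLinearGroup.scalar (Fin n) u ∈ isometryGroup n) :
    Matrix.GeneralLinearGroup.scalar (Fin n) u ∈ upperIsometries n :=
  ⟨h, by
    rw [Matrix.GeneralLinearGroup.coe_scalar, Matrix.scalar_apply]
    exact Matrix.blockTriangular_diagonal _⟩

theorem flipGL_scalar {n : ℕ} (u : ℂˣ) :
    flipGL (Matrix.GeneralLinearGroup.scalar (Fin n) u) = Matrix.GeneralLinearGroup.scalar (Fin n) u := by
  apply Units.ext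
  ext a b
  rw [flipGL_apply, Matrix.GeneralLinearGroup.coe_scalar, Matrix.scalar_apply]
  simp [Matrix.diagonal_apply]

theorem mem_isometryGroup_of_mem_wordSet {l : List (DoubleLetter k)} {A : GL (Fin (ty.dim k)) ℂ}
    (hA : A ∈ wordSet ty l) : A ∈ isometryGroup (ty.dim k) := by
  induction l generalizing A with
  | nil => exact hA.1
  | cons x l ih =>
    obtain ⟨c, hc, A', hA', rfl⟩ := hA
    exact mul_mem (rootElement_mem ..) (ih hA')

/-- Induction over the letters: disjointness of cells determines the parameter of the first letter,
after which it can be cancelled. For the empty word the variables are the simple roots of the torus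
element. -/
theorem fockGoncharov_injective {m : ℕ} (w : Fin m → DoubleLetter k)
    (hw : IsAscending ty (List.ofFn w)) : Function.Injective (fockGoncharov ty w) := by
  induction m with
  | zero =>
    intro t t' h
    rw [fockGoncharov, fockGoncharov, prod_cocharacterY, prod_cocharacterY, List.ofFn_zero,
      List.ofFn_zero, List.prod_nil, mul_one, mul_one] at h
    have hd := ty.two_mul_le_dim k
    ext a
    rcases a with i | p
    · have hi := i.2
      have := div_eq_div_of_mk_diagGL_eq h ⟨i, by omega⟩ ⟨i + 1, by omega⟩
      rw [torusDiag_div ty _ _ _ rfl i (Or.inl rfl), torusDiag_div ty _ _ _ rfl i (Or.inl rfl)] at this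
      rw [this]
    · exact p.elim0
  | succ m ih =>
    intro t t' h
    rw [List.ofFn_succ] at hw
    obtain ⟨A, hA, hAt⟩ := exists_wordSet_eq_fockGoncharov ty (fun p => w p.succ) (shiftVars w t)
    obtain ⟨A', hA', hAt'⟩ := exists_wordSet_eq_fockGoncharov ty (fun p => w p.succ) (shiftVars w t')
    have hA1 := wordSet_subset ty hw.2 hA
    have hA1' := wordSet_subset ty hw.2 hA'
    have hc : (signPow (w 0).pos (t (.inl (w 0).idx)) : ℂ) =
        signPow (w 0).pos (t' (.inl (w 0).idx)) := by
      rw [fockGoncharov_succ, fockGoncharov_succ, ← hAt, ← hAt', ← map_mul, ← map_mul,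
        Matrix.ProjGenLinGroup.mk_eq_mk_iff] at h
      obtain ⟨u, hu⟩ := h
      -- Equality in `PGL` leaves a scalar. Since both representatives are isometries, so is the
      -- scalar, and it can be absorbed into the Bruhat cell.
      have hz : Matrix.GeneralLinearGroup.scalar (Fin (ty.dim k)) u ∈ isometryGroup (ty.dim k) := by
        rw [← mul_mem_cancel_left (mul_mem (rootElement_mem ty (w 0) _)
          (mem_isometryGroup_of_mem_wordSet ty hA)), hu]
        exact mul_mem (rootElement_mem ty (w 0) _) (mem_isometryGroup_of_mem_wordSet ty hA')
      have hz' := scalar_mem_upperIsometries hz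
      rw [mul_assoc] at hu
      have hasc := hw.1
      rcases hw0 : w 0 with ⟨i, s⟩
      rw [hw0] at hu hasc
      cases s
      · exact rootElement_neg_mul_injective ty (weylList_commutesRev ty _ _) hasc
          (upperCell_mul_right hA1.1 hz') hA1'.1 hu
      · have hu' := congrArg flipGL hu
        rw [map_mul, map_mul, map_mul, flipGL_rootElement, flipGL_rootElement, flipGL_scalar] at hu'
        exact rootElement_neg_mul_injective ty (weylList_commutesRev ty _ _) hasc
          (upperCell_mul_right hA1.2 hz') hA1'.2 hu'
    have hc' : t (.inl (w 0).idx) = t' (.inl (w 0).idx) := by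
      have := Units.ext hc
      simp only [signPow] at this
      split_ifs at this
      · exact this
      · exact inv_injective this
    rw [fockGoncharov_succ, fockGoncharov_succ, hc] at h
    have h2 := ih _ hw.2 (mul_left_cancel h)
    ext a
    rcases a with j | p
    · by_cases hj : j = (w 0).idx
      · rw [hj, hc']
      · have := congrFun h2 (.inl j)
        simp only [shiftVars, Sum.elim_inl, hj, if_false, mul_one] at this
        rw [this]
    · refine Fin.cases ?_ (fun p => ?_) p
      · have := congrFun h2 (.inl (w 0).idx)
        simp only [shiftVars, Sum.elim_inl, if_true, hc'] at this
        rw [mul_left_cancel this]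
      · have := congrFun h2 (.inr p)
        simp only [shiftVars, Sum.elim_inr] at this
        rw [this]

end FockGoncharov

/-! ### Passing from the isometry group to its image in `PGL` -/

section BruhatCells

variable {n : ℕ}

theorem mk_mem_upperBruhatCell {σ : Equiv.Perm (Fin n)} {A : GL (Fin n) ℂ} (hA : A ∈ upperCell σ) :
    Matrix.ProjGenLinGroup.mk A ∈ bruhatCell (upperBorel n) σ := by
  obtain ⟨b₁, h₁, N, hN, b₂, h₂, rfl⟩ := hA
  exact ⟨_, ⟨b₁, ⟨h₁.1, fun i j h => h₁.2 h⟩, rfl⟩, N, hN, _, ⟨b₂, ⟨h₂.1, fun i j h => h₂.2 h⟩, rfl⟩,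
    by rw [map_mul, map_mul]⟩

theorem mem_upperCell_of_mk_mem {σ : Equiv.Perm (Fin n)} {A : GL (Fin n) ℂ}
    (hA : A ∈ isometryGroup n) (h : Matrix.ProjGenLinGroup.mk A ∈ bruhatCell (upperBorel n) σ) :
    A ∈ upperCell σ := by
  obtain ⟨_, ⟨b₁, h₁, rfl⟩, N, hN, _, ⟨b₂, h₂, rfl⟩, h⟩ := h
  rw [← map_mul, ← map_mul, eq_comm, Matrix.ProjGenLinGroup.mk_eq_mk_iff] at h
  obtain ⟨u, rfl⟩ := h
  have hz := scalar_mem_upperIsometries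
    ((mul_mem_cancel_left (mul_mem (mul_mem h₁.1 hN.1) h₂.1)).mp hA)
  exact upperCell_mul_right ⟨b₁, ⟨h₁.1, fun i j h => h₁.2 i j h⟩, N, hN, b₂,
    ⟨h₂.1, fun i j h => h₂.2 i j h⟩, rfl⟩ hz

theorem mk_mem_lowerBruhatCell {σ : Equiv.Perm (Fin n)} (hσ : CommutesRev σ) {A : GL (Fin n) ℂ}
    (hA : flipGL A ∈ upperCell σ) :
    Matrix.ProjGenLinGroup.mk A ∈ bruhatCell (lowerBorel n) σ := by
  obtain ⟨b₁, h₁, N, hN, b₂, h₂, h⟩ := hA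
  have hb : ∀ b ∈ upperIsometries n, flipGL b ∈ isometryGroup n ∧
      ∀ i j : Fin n, i < j → (flipGL b : Matrix (Fin n) (Fin n) ℂ) i j = 0 := fun b hb =>
    ⟨flipGL_mem_isometryGroup hb.1, fun i j hij => hb.2 (Fin.rev_lt_rev.mpr hij)⟩
  refine ⟨_, ⟨flipGL b₁, hb _ h₁, rfl⟩, flipGL N, hN.flipGL hσ, _, ⟨flipGL b₂, hb _ h₂, rfl⟩, ?_⟩
  rw [← map_mul, ← map_mul, ← map_mul, ← map_mul, ← h, flipGL_flipGL]

theorem mem_upperCell_of_mk_mem_lower {σ : Equiv.Perm (Fin n)} (hσ : CommutesRev σ)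
    {A : GL (Fin n) ℂ} (hA : A ∈ isometryGroup n)
    (h : Matrix.ProjGenLinGroup.mk A ∈ bruhatCell (lowerBorel n) σ) : flipGL A ∈ upperCell σ := by
  obtain ⟨_, ⟨b₁, h₁, rfl⟩, N, hN, _, ⟨b₂, h₂, rfl⟩, h⟩ := h
  rw [← map_mul, ← map_mul, eq_comm, Matrix.ProjGenLinGroup.mk_eq_mk_iff] at h
  obtain ⟨u, rfl⟩ := h
  have hz := scalar_mem_upperIsometries
    ((mul_mem_cancel_left (mul_mem (mul_mem h₁.1 hN.1) h₂.1)).mp hA)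
  rw [map_mul, map_mul, map_mul, flipGL_scalar]
  exact upperCell_mul_right ⟨flipGL b₁, ⟨flipGL_mem_isometryGroup h₁.1,
    fun i j h => h₁.2 _ _ (Fin.rev_lt_rev.mpr h)⟩, flipGL N, hN.flipGL hσ, flipGL b₂,
    ⟨flipGL_mem_isometryGroup h₂.1, fun i j h => h₂.2 _ _ (Fin.rev_lt_rev.mpr h)⟩, rfl⟩ hz

end BruhatCells

/-! ### The image of the parametrization in the double Bruhat cell -/

section MainGroupStatements

variable {k : ℕ} {ty : TypeBC} {m : ℕ} {w : Fin m → DoubleLetter k}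
  {u v : Equiv.Perm (Fin (ty.dim k))}

theorem fockGoncharov_mem_doubleBruhatCell (hw : IsReducedWordOf ty w u v)
    (t : Fin k ⊕ Fin m → ℂˣ) : fockGoncharov ty w t ∈ doubleBruhatCell u v := by
  obtain ⟨A, hA, h⟩ := exists_wordSet_eq_fockGoncharov ty w t
  obtain ⟨h1, h2⟩ := wordSet_subset ty hw.isAscending hA
  rw [← h, ← hw.1.1, ← hw.1.2, weylElement_eq_weylList, weylElement_eq_weylList]
  exact ⟨mk_mem_upperBruhatCell h1, mk_mem_lowerBruhatCell (weylList_commutesRev ty _ _) h2⟩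

/-- Polynomials in the matrix entries are continuous, so the argument by limits in the classical
topology suffices. -/
theorem isZariskiDenseIn_range_fockGoncharov (hw : IsReducedWordOf ty w u v) :
    IsZariskiDenseIn (Set.range (fockGoncharov ty w)) (doubleBruhatCell u v) := by
  refine ⟨?_, fun f hf A hA hAuv => ?_⟩
  · rintro _ ⟨t, rfl⟩
    exact fockGoncharov_mem_doubleBruhatCell hw t
  · have hcont : Continuous fun B : Matrix (Fin (ty.dim k)) (Fin (ty.dim k)) ℂ =>
        MvPolynomial.eval (fun ij : Fin (ty.dim k) × Fin (ty.dim k) => B ij.1 ij.2) f :=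
      (MvPolynomial.continuous_eval f).comp
        (continuous_pi fun ij => continuous_id.matrix_elem ij.1 ij.2)
    have hv : CommutesRev v := by
      rw [← hw.1.2, weylElement_eq_weylList]; exact weylList_commutesRev ty _ _
    have hu' : weylList ty false (List.ofFn w) = u := by rw [← weylElement_eq_weylList, hw.1.1]
    have hv' : weylList ty true (List.ofFn w) = v := by rw [← weylElement_eq_weylList, hw.1.2]
    have key := eq_zero_of_forall_wordSet ty (List.ofFn w) _ hcont
    rw [hu', hv'] at key
    exact key (fun B hB =>
      hf B (mem_isometryGroup_of_mem_wordSet ty hB) (exists_fockGoncharov_eq ty w hB)) A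
      (mem_upperCell_of_mk_mem hA hAuv.1) (mem_upperCell_of_mk_mem_lower hv hA hAuv.2)

end MainGroupStatements

/-! ### Acyclic perfect orientations and their path sums -/

namespace PlabicGraph

variable {n : ℕ} {Γ : PlabicGraph n}

theorem headOf_eq_tailOf_of_ne {o o' : Γ.Orientation} {e : Γ.E} (h : o e ≠ o' e) :
    headOf o e = tailOf o' e := by
  unfold headOf tailOf
  revert h
  cases o e <;> cases o' e <;> simp

theorem tailOf_eq_headOf_of_ne {o o' : Γ.Orientation} {e : Γ.E} (h : o e ≠ o' e) :
    tailOf o e = headOf o' e := (headOf_eq_tailOf_of_ne h.symm).symm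

theorem headOf_congr {o o' : Γ.Orientation} {e : Γ.E} (h : o e = o' e) :
    headOf o e = headOf o' e := by unfold headOf; rw [h]

theorem tailOf_congr {o o' : Γ.Orientation} {e : Γ.E} (h : o e = o' e) :
    tailOf o e = tailOf o' e := by unfold tailOf; rw [h]

/-- A graph with a perfect orientation that admits a height function has no other perfect
orientation. -/
theorem IsPerfect.eq_of_height {o₀ : Γ.Orientation} (h₀ : IsPerfect o₀)
    (ht : PlabicPoint Γ.V n → ℕ) (hht : ∀ e, ht (tailOf o₀ e) < ht (headOf o₀ e))
    {o : Γ.Orientation} (ho : IsPerfect o) : o = o₀ := by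
  have key : ∀ N e, ht (tailOf o₀ e) < N → o e = o₀ e := by
    intro N
    induction N with
    | zero => intro e he; omega
    | succ N ih =>
      intro e he
      by_contra hne
      -- All edges starting lower are already known to agree; `e` is reversed, so under `o` it
      -- enters the point where it started under `o₀`.
      have h1 := headOf_eq_tailOf_of_ne hne
      cases hx : tailOf o₀ e with
      | source i => exact ho.source_in i e (h1.trans hx)
      | sink i => exact h₀.sink_out i e hx
      | inner v =>
        by_cases hv : Γ.IsWhite v
        -- The edge entering the white vertex `v` under `o₀` starts lower and is unchanged, so under
        -- `o` two edges enter `v`.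
        · obtain ⟨e', he', -⟩ := h₀.white v hv
          have h2 := hht e'
          rw [he', ← hx] at h2
          have h3 := headOf_congr (ih e' (by omega))
          have h4 := (ho.white v hv).unique (h1.trans hx) (h3.trans he')
          subst h4
          have := hht e
          rw [hx, he'] at this
          omega
        -- If the edge leaving the black vertex `v` under `o` is unchanged, it is `e`, which was
        -- reversed. If it is changed, it entered `v` under `o₀`, so it starts lower there and
        -- cannot have changed.
        · obtain ⟨e', he', -⟩ := ho.black v hv
          by_cases h2 : o e' = o₀ e'
          · have := (h₀.black v hv).unique ((tailOf_congr h2).symm.trans he') hx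
            exact hne (this ▸ h2)
          · have h3 := (tailOf_eq_headOf_of_ne h2).symm.trans he'
            have h4 := hht e'
            rw [h3, ← hx] at h4
            exact h2 (ih e' (by omega))
  funext e
  exact key _ e (Nat.lt_succ_self _)

theorem IsPath.height_le {o : Γ.Orientation} {ht : PlabicPoint Γ.V n → ℕ}
    (hht : ∀ e, ht (tailOf o e) < ht (headOf o e)) {x y : PlabicPoint Γ.V n} {l : List Γ.E}
    (h : IsPath o x y l) : ht x + l.length ≤ ht y := by
  induction l generalizing x with
  | nil => rw [show x = y from h]; simp
  | cons e l ih =>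
    have h1 := ih h.2
    have h2 := hht e
    rw [h.1] at h2
    rw [List.length_cons]
    omega

theorem isAcyclic_of_height {o : Γ.Orientation} {ht : PlabicPoint Γ.V n → ℕ}
    (hht : ∀ e, ht (tailOf o e) < ht (headOf o e)) : IsAcyclic o := fun x l h => by
  have := h.height_le hht
  exact List.eq_nil_of_length_eq_zero (by omega)

/-- The boundary measurements of an acyclic network, computed from the right to the left. -/
theorem boundaryMatrix_eq_of_recursion {o : Γ.Orientation} {ht : PlabicPoint Γ.V n → ℕ}
    (hht : ∀ e, ht (tailOf o e) < ht (headOf o e)) (hsink : ∀ i e, tailOf o e ≠ .sink i)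
    (wt : Γ.E → ℂˣ) (j : Fin n) (q : PlabicPoint Γ.V n → ℂ)
    (hq : ∀ i, q (.sink i) = if i = j then 1 else 0)
    (hrec : ∀ x, (∀ i, x ≠ .sink i) → ∃ S : Finset Γ.E, (∀ e, e ∈ S ↔ tailOf o e = x) ∧
      q x = ∑ e ∈ S, (wt e : ℂ) * q (headOf o e)) (i : Fin n) :
    boundaryMatrix o wt i j = q (.source i) := by
  classical
  set B := Finset.univ.sup fun e => ht (headOf o e) with hB
  have hle : ∀ e, ht (headOf o e) ≤ B := fun e => Finset.le_sup (f := fun e => ht (headOf o e))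
    (Finset.mem_univ e)
  -- Induction on the height that remains below the bound `B`. It also shows that there are only
  -- finitely many paths to the sink, so that the `finsum` in the definition is an actual sum.
  have key : ∀ N x, B - ht x < N → ∃ P : Finset (List Γ.E), (∀ l, l ∈ P ↔ IsPath o x (.sink j) l) ∧
      ∑ l ∈ P, (l.map fun e => (wt e : ℂ)).prod = q x := by
    intro N
    induction N with
    | zero => intro x hx; omega
    | succ N ih =>
      intro x hx
      by_cases hs : ∃ i, x = .sink i
      · obtain ⟨i, rfl⟩ := hs
        refine ⟨if i = j then {[]} else ∅, fun l => ?_, ?_⟩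
        · cases l with
          | nil =>
            by_cases hij : i = j
            · simp [hij, IsPath]
            · simp [hij, IsPath]
          | cons e l =>
            have : ¬ IsPath o (.sink i) (.sink j) (e :: l) := fun h => hsink i e h.1
            by_cases hij : i = j
            · simp only [hij, if_true, Finset.mem_singleton]; rw [hij] at this; simp [this]
            · simp [hij, this]
        · rw [hq]
          split_ifs <;> simp
      · push Not at hs
        obtain ⟨S, hS, hqx⟩ := hrec x hs
        have hch : ∀ e : Γ.E, ∃ P : Finset (List Γ.E), e ∈ S →
            (∀ l, l ∈ P ↔ IsPath o (headOf o e) (.sink j) l) ∧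
            ∑ l ∈ P, (l.map fun e => (wt e : ℂ)).prod = q (headOf o e) := by
          intro e
          by_cases he : e ∈ S
          · have h1 := hht e
            rw [(hS e).mp he] at h1
            have h2 := hle e
            obtain ⟨P, hP⟩ := ih (headOf o e) (by omega)
            exact ⟨P, fun _ => hP⟩
          · exact ⟨∅, fun h => absurd h he⟩
        choose P hP using hch
        refine ⟨S.biUnion fun e => (P e).image (List.cons e), fun l => ?_, ?_⟩
        · rw [Finset.mem_biUnion]
          constructor
          · rintro ⟨e, he, hl⟩
            obtain ⟨l', hl', rfl⟩ := Finset.mem_image.mp hl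
            exact ⟨(hS e).mp he, ((hP e he).1 l').mp hl'⟩
          · intro hl
            cases l with
            | nil => exact absurd hl (hs j)
            | cons e l =>
              have he := (hS e).mpr hl.1
              exact ⟨e, he, Finset.mem_image_of_mem _ (((hP e he).1 l).mpr hl.2)⟩
        · rw [Finset.sum_biUnion, hqx]
          · refine Finset.sum_congr rfl fun e he => ?_
            rw [Finset.sum_image fun a _ b _ h => (List.cons.inj h).2, ← (hP e he).2,
              Finset.mul_sum]
            simp
          · intro e _ e' _ hne
            refine Finset.disjoint_left.mpr fun l hl hl' => hne ?_
            obtain ⟨a, -, rfl⟩ := Finset.mem_image.mp hl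
            obtain ⟨b, -, hb⟩ := Finset.mem_image.mp hl'
            exact (List.cons.inj hb).1.symm
  obtain ⟨P, hP, hsum⟩ := key _ (.source i) (Nat.lt_succ_self _)
  rw [← hsum, boundaryMatrix]
  have : {l : List Γ.E | IsPath o (.source i) (.sink j) l} = (P : Set (List Γ.E)) := by
    ext l; exact (hP l).symm
  rw [← finsum_mem_coe_finset, ← this]
  exact finsum_set_coe_eq_finsum_mem (f := fun l : List Γ.E => (l.map fun e => (wt e : ℂ)).prod)
    {l | IsPath o (.source i) (.sink j) l}

end PlabicGraph

/-! ### Vertices and horizontal edges of the graph of a word -/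

section WordGraphCombinatorics

variable {k : ℕ} {ty : TypeBC} {m : ℕ} {w : Fin m → DoubleLetter k}

theorem HasRung.bounds {x : DoubleLetter k} {r : ℕ} (h : HasRung ty x r) :
    1 ≤ r ∧ r < ty.dim k := by
  have h1 := x.idx.2
  have h2 := ty.two_mul_le_dim k
  rcases h with h | h <;> simp only [DoubleLetter.abs] at h <;> omega

/-- The strips `i` and `n - i` of a letter are adjacent only if `n = 2k + 1` and `i = k`. Thus
outside the squares a letter has at most one vertex on each wire. -/
theorem HasRung.hasSquare {x : DoubleLetter k} {a : ℕ} (h : HasRung ty x a)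
    (h' : HasRung ty x (a + 1)) : HasSquare ty x ∧ a = k := by
  have h1 := x.idx.2
  unfold HasRung HasSquare at *
  simp only [DoubleLetter.abs] at *
  cases ty
  · have hB : TypeBC.B.dim k = 2 * k + 1 := rfl
    simp only [true_and]
    omega
  · have hC : TypeBC.C.dim k = 2 * k := rfl
    exfalso
    omega

theorem HasSquare.dim_eq {x : DoubleLetter k} (h : HasSquare ty x) : ty.dim k = 2 * k + 1 := by
  rw [h.1]; rfl

theorem HasSquare.hasRung_iff {x : DoubleLetter k} (h : HasSquare ty x) (r : ℕ) :
    HasRung ty x r ↔ r = k ∨ r = k + 1 := by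
  have := h.dim_eq
  unfold HasRung
  rw [h.2]
  omega

theorem exists_eq_upper_iff (x : RungIdx ty w) :
    (∃ p : SquareIdx ty w, x = p.upper) ↔ HasSquare ty (w x.1.1) ∧ (x.1.2 : ℕ) = k + 1 := by
  constructor
  · rintro ⟨p, rfl⟩; exact ⟨p.2, rfl⟩
  · rintro ⟨h1, h2⟩
    exact ⟨⟨x.1.1, h1⟩, Subtype.ext (Prod.ext rfl (Fin.ext h2))⟩

theorem exists_eq_lower_iff (x : RungIdx ty w) :
    (∃ p : SquareIdx ty w, x = p.lower) ↔ HasSquare ty (w x.1.1) ∧ (x.1.2 : ℕ) = k := by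
  constructor
  · rintro ⟨p, rfl⟩; exact ⟨p.2, rfl⟩
  · rintro ⟨h1, h2⟩
    exact ⟨⟨x.1.1, h1⟩, Subtype.ext (Prod.ext rfl (Fin.ext h2))⟩

/-- The letter a vertex belongs to. -/
def WordVertex.letter : WordVertex ty w → Fin m
  | .lo x => x.1.1
  | .hi x => x.1.1
  | .sqLeft p => p.1
  | .sqRight p => p.1

/-- The wire closest to a vertex. -/
def WordVertex.wire : WordVertex ty w → ℕ
  | .lo x => x.1.2 - 1
  | .hi x => x.1.2
  | .sqLeft _ => k
  | .sqRight _ => k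

/-- The vertices with a horizontal edge to the right. -/
def WordVertex.IsExit : WordVertex ty w → Prop
  | .lo x => ¬ (HasSquare ty (w x.1.1) ∧ (x.1.2 : ℕ) = k + 1)
  | .hi x => ¬ (HasSquare ty (w x.1.1) ∧ (x.1.2 : ℕ) = k)
  | .sqLeft _ => False
  | .sqRight _ => True

/-- The vertices with a horizontal edge to the left. -/
def WordVertex.IsEntry : WordVertex ty w → Prop
  | .lo x => ¬ (HasSquare ty (w x.1.1) ∧ (x.1.2 : ℕ) = k + 1)
  | .hi x => ¬ (HasSquare ty (w x.1.1) ∧ (x.1.2 : ℕ) = k)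
  | .sqLeft _ => True
  | .sqRight _ => False

/-- A vertex is recovered from its letter and its wire once it is known to be an exit; this turns
incidences of horizontal edges into equations between indices. -/
theorem exitVertex_eq_iff (p : Fin m) (a : Fin (ty.dim k)) (h : Touches ty (w p) a)
    (v : WordVertex ty w) :
    exitVertex p a h = v ↔ v.letter = p ∧ v.wire = a ∧ v.IsExit := by
  unfold exitVertex
  constructor
  · split_ifs with hs hl
    · rintro rfl; exact ⟨rfl, hs.2.symm, trivial⟩
    · rintro rfl
      refine ⟨rfl, ?_, ?_⟩
      · simp [WordVertex.wire]
      · simp only [WordVertex.IsExit, Fin.val_succ]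
        exact fun h => hs ⟨h.1, by omega⟩
    · rintro rfl
      refine ⟨rfl, ?_, ?_⟩
      · simp [WordVertex.wire]
      · simp only [WordVertex.IsExit, Fin.val_castSucc]
        exact fun h => hs ⟨h.1, by omega⟩
  · rintro ⟨rfl, h2, h3⟩
    cases v with
    | lo x =>
      have hb := x.2.bounds
      have hw : (x.1.2 : ℕ) - 1 = a := h2
      have hx : (x.1.2 : ℕ) = a + 1 := by omega
      have hr : HasRung ty (w x.1.1) (a + 1) := hx ▸ x.2
      split_ifs with hs hl
      · exact absurd ⟨hs.1, by omega⟩ h3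
      · congr 1
        exact Subtype.ext (Prod.ext rfl (Fin.ext (by simp [hx])))
      · exact absurd hr hl
    | hi x =>
      have hw : (x.1.2 : ℕ) = a := h2
      split_ifs with hs hl
      · exact absurd ⟨hs.1, by omega⟩ h3
      · exact absurd (x.2.hasSquare (hw.symm ▸ hl)) h3
      · congr 1
        exact Subtype.ext (Prod.ext rfl (Fin.ext (by simp [hw])))
    | sqLeft p => exact h3.elim
    | sqRight p => rw [dif_pos ⟨p.2, h2.symm⟩]; rfl

theorem entryVertex_eq_iff (p : Fin m) (a : Fin (ty.dim k)) (h : Touches ty (w p) a)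
    (v : WordVertex ty w) :
    entryVertex p a h = v ↔ v.letter = p ∧ v.wire = a ∧ v.IsEntry := by
  unfold entryVertex
  constructor
  · split_ifs with hs hl
    · rintro rfl; exact ⟨rfl, hs.2.symm, trivial⟩
    · rintro rfl
      refine ⟨rfl, ?_, ?_⟩
      · simp [WordVertex.wire]
      · simp only [WordVertex.IsEntry, Fin.val_succ]
        exact fun h => hs ⟨h.1, by omega⟩
    · rintro rfl
      refine ⟨rfl, ?_, ?_⟩
      · simp [WordVertex.wire]
      · simp only [WordVertex.IsEntry, Fin.val_castSucc]
        exact fun h => hs ⟨h.1, by omega⟩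
  · rintro ⟨rfl, h2, h3⟩
    cases v with
    | lo x =>
      have hb := x.2.bounds
      have hw : (x.1.2 : ℕ) - 1 = a := h2
      have hx : (x.1.2 : ℕ) = a + 1 := by omega
      have hr : HasRung ty (w x.1.1) (a + 1) := hx ▸ x.2
      split_ifs with hs hl
      · exact absurd ⟨hs.1, by omega⟩ h3
      · congr 1
        exact Subtype.ext (Prod.ext rfl (Fin.ext (by simp [hx])))
      · exact absurd hr hl
    | hi x =>
      have hw : (x.1.2 : ℕ) = a := h2
      split_ifs with hs hl
      · exact absurd ⟨hs.1, by omega⟩ h3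
      · exact absurd (x.2.hasSquare (hw.symm ▸ hl)) h3
      · congr 1
        exact Subtype.ext (Prod.ext rfl (Fin.ext (by simp [hw])))
    | sqLeft p => rw [dif_pos ⟨p.2, h2.symm⟩]; rfl
    | sqRight p => exact h3.elim

theorem WordVertex.touches (v : WordVertex ty w) : Touches ty (w v.letter) v.wire := by
  cases v with
  | lo x =>
    right
    have := x.2.bounds
    have h2 : (x.1.2 : ℕ) - 1 + 1 = x.1.2 := by omega
    simp only [WordVertex.letter, WordVertex.wire]
    rw [h2]; exact x.2
  | hi x => left; exact x.2
  | sqLeft p => left; exact p.2.lowerRung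
  | sqRight p => left; exact p.2.lowerRung

theorem WordVertex.wire_lt (v : WordVertex ty w) : v.wire < ty.dim k := by
  rcases v.touches with h | h
  · exact h.bounds.2
  · have := h.bounds; omega

/-- The horizontal edge beginning at the left end of a wire. -/
def firstWire (a : Fin (ty.dim k)) : WireIdx ty w := ⟨(a, ⊥), fun _ hp => by simp at hp⟩

/-- The horizontal edge to the right of a vertex. -/
def WordVertex.rightWire (v : WordVertex ty w) : WireIdx ty w :=
  ⟨(⟨v.wire, v.wire_lt⟩, v.letter), fun p hp => by
    have : v.letter = p := WithBot.coe_injective hp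
    subst this; exact v.touches⟩

theorem WireIdx.tail_of_bot {x : WireIdx ty w} (h : x.1.2 = ⊥) : x.tail = .source x.1.1 := by
  obtain ⟨⟨a, s⟩, hx⟩ := x
  simp only at h
  subst h
  rfl

theorem WireIdx.tail_of_coe {x : WireIdx ty w} {p : Fin m} (h : x.1.2 = p) :
    x.tail = .inner (exitVertex p x.1.1 (x.2 p h)) := by
  obtain ⟨⟨a, s⟩, hx⟩ := x
  simp only at h
  subst h
  rfl

theorem WireIdx.head_of_top {x : WireIdx ty w} (h : x.next = ⊤) : x.head = .sink x.1.1 := by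
  unfold WireIdx.head
  split
  · rfl
  · rename_i q hq; exact absurd (h.symm.trans hq) (WithTop.top_ne_coe)

theorem WireIdx.head_of_coe {x : WireIdx ty w} {q : Fin m} (h : x.next = q) :
    x.head = .inner (entryVertex q x.1.1 (x.touches_next q h)) := by
  unfold WireIdx.head
  split
  · rename_i hq; exact absurd (h.symm.trans hq) (WithTop.coe_ne_top)
  · rename_i q' hq
    have : q' = q := WithTop.coe_injective (hq.symm.trans h)
    subst this; rfl

theorem WireIdx.tail_eq_source_iff (x : WireIdx ty w) (a : Fin (ty.dim k)) :
    x.tail = .source a ↔ x = firstWire a := by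
  constructor
  · intro h
    cases hs : x.1.2 with
    | bot =>
      rw [x.tail_of_bot hs] at h
      injection h with h
      exact Subtype.ext (Prod.ext h hs)
    | coe p => rw [x.tail_of_coe hs] at h; cases h
  · rintro rfl; rfl

theorem WireIdx.tail_eq_inner_iff (x : WireIdx ty w) (v : WordVertex ty w) :
    x.tail = .inner v ↔ v.IsExit ∧ x = v.rightWire := by
  cases hs : x.1.2 with
  | bot =>
    rw [x.tail_of_bot hs]
    constructor
    · intro h; cases h
    · rintro ⟨-, rfl⟩; cases hs
  | coe p =>
    rw [x.tail_of_coe hs, PlabicPoint.inner.injEq, exitVertex_eq_iff]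
    constructor
    · rintro ⟨h1, h2, h3⟩
      refine ⟨h3, Subtype.ext (Prod.ext (Fin.ext h2.symm) ?_)⟩
      rw [hs, ← h1]; rfl
    · rintro ⟨h1, rfl⟩
      exact ⟨WithBot.coe_injective hs, rfl, h1⟩

theorem WireIdx.tail_ne_sink (x : WireIdx ty w) (a : Fin (ty.dim k)) : x.tail ≠ .sink a := by
  cases hs : x.1.2 with
  | bot => rw [x.tail_of_bot hs]; intro h; cases h
  | coe p => rw [x.tail_of_coe hs]; intro h; cases h

theorem WireIdx.head_ne_source (x : WireIdx ty w) (a : Fin (ty.dim k)) : x.head ≠ .source a := by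
  cases hs : x.next with
  | top => rw [x.head_of_top hs]; intro h; cases h
  | coe p => rw [x.head_of_coe hs]; intro h; cases h

open Classical in
/-- The horizontal edge of the wire `a` that passes over the left end of the letter number `q`. -/
noncomputable def wireBefore (a : Fin (ty.dim k)) (q : ℕ) : WireIdx ty w :=
  ⟨(a, (Finset.univ.filter fun p : Fin m => Touches ty (w p) a ∧ (p : ℕ) < q).max), fun _ hp =>
    (Finset.mem_filter.mp (Finset.mem_of_max hp)).2.1⟩

theorem WireIdx.lt_of_next_eq {x : WireIdx ty w} {q : Fin m} (h : x.next = q) :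
    x.1.2 < (q : WithBot (Fin m)) := by
  classical
  exact (Finset.mem_filter.mp (Finset.mem_of_min h)).2.2

theorem WireIdx.eq_wireBefore {x : WireIdx ty w} {q : ℕ}
    (hlt : ∀ p : Fin m, x.1.2 = p → (p : ℕ) < q)
    (hno : ∀ p : Fin m, Touches ty (w p) x.1.1 → x.1.2 < (p : WithBot (Fin m)) → q ≤ p) :
    x = wireBefore x.1.1 q := by
  classical
  refine Subtype.ext (Prod.ext rfl ?_)
  apply le_antisymm
  · cases hs : x.1.2 with
    | bot => exact bot_le
    | coe p =>
      exact Finset.le_max (Finset.mem_filter.mpr ⟨Finset.mem_univ _, x.2 p hs, hlt p hs⟩)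
  · change (Finset.univ.filter fun p : Fin m => Touches ty (w p) x.1.1 ∧ (p : ℕ) < q).max ≤ _
    refine Finset.max_le fun p hp => ?_
    have hp := (Finset.mem_filter.mp hp).2
    by_contra hcon
    have := hno p hp.1 (not_le.mp hcon)
    omega

/-- The first letter after an edge and the last letter before a place determine each other among the
letters touching the wire. Hence each entry vertex receives exactly one horizontal edge. -/
theorem WireIdx.next_eq_coe_iff (x : WireIdx ty w) (q : Fin m) :
    x.next = q ↔ Touches ty (w q) x.1.1 ∧ x = wireBefore x.1.1 q := by
  classical
  constructor
  · intro h
    refine ⟨x.touches_next q h, WireIdx.eq_wireBefore ?_ ?_⟩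
    · intro p hp
      have := WireIdx.lt_of_next_eq h
      rw [hp] at this
      exact Fin.lt_def.mp (WithBot.coe_lt_coe.mp this)
    · intro p hp hlt
      have : x.next ≤ p := Finset.min_le (Finset.mem_filter.mpr ⟨Finset.mem_univ _, hp, hlt⟩)
      rw [h] at this
      exact Fin.le_def.mp (WithTop.coe_le_coe.mp this)
  · rintro ⟨h1, h2⟩
    have hmax : x.1.2 = (Finset.univ.filter fun p : Fin m => Touches ty (w p) x.1.1 ∧ p.val < q.val).max := by
      conv_lhs => rw [h2]
      rfl
    apply le_antisymm
    · refine Finset.min_le (Finset.mem_filter.mpr ⟨Finset.mem_univ _, h1, ?_⟩)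
      rw [hmax]
      by_contra hcon
      cases hm : (Finset.univ.filter fun p : Fin m => Touches ty (w p) x.1.1 ∧ p.val < q.val).max with
      | bot => rw [hm] at hcon; exact hcon (WithBot.bot_lt_coe q)
      | coe p =>
        rw [hm, WithBot.coe_lt_coe] at hcon
        exact hcon (Finset.mem_filter.mp (Finset.mem_of_max hm)).2.2
    · refine Finset.le_min fun p hp => ?_
      rw [Finset.mem_filter] at hp
      by_contra hcon
      rw [not_le, WithTop.coe_lt_coe] at hcon
      have : (p : WithBot (Fin m)) ≤ x.1.2 := by
        rw [hmax]
        exact Finset.le_max (Finset.mem_filter.mpr ⟨Finset.mem_univ _, hp.2.1, hcon⟩)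
      exact absurd hp.2.2 (not_lt.mpr this)

theorem WireIdx.next_eq_top_iff (x : WireIdx ty w) :
    x.next = ⊤ ↔ x = wireBefore x.1.1 m := by
  classical
  constructor
  · intro h
    rw [WireIdx.next, Finset.min_eq_top, Finset.filter_eq_empty_iff] at h
    exact WireIdx.eq_wireBefore (fun p _ => p.2)
      fun p hp hlt => absurd ⟨hp, hlt⟩ (h (Finset.mem_univ p))
  · intro h2
    have hmax : x.1.2 = (Finset.univ.filter fun p : Fin m => Touches ty (w p) x.1.1 ∧ p.val < m).max := by
      conv_lhs => rw [h2]
      rfl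
    rw [WireIdx.next, Finset.min_eq_top, Finset.filter_eq_empty_iff]
    rintro p - ⟨hp, hlt⟩
    have : (p : WithBot (Fin m)) ≤ x.1.2 := by
      rw [hmax]
      exact Finset.le_max (Finset.mem_filter.mpr ⟨Finset.mem_univ _, hp, p.2⟩)
    exact absurd hlt (not_lt.mpr this)

theorem WireIdx.head_eq_sink_iff (x : WireIdx ty w) (a : Fin (ty.dim k)) :
    x.head = .sink a ↔ x = wireBefore a m := by
  cases hs : x.next with
  | top =>
    rw [x.head_of_top hs, PlabicPoint.sink.injEq]
    constructor
    · rintro rfl; exact x.next_eq_top_iff.mp hs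
    · intro h; rw [h]; rfl
  | coe q =>
    rw [x.head_of_coe hs]
    constructor
    · intro h; cases h
    · intro h
      have h1 : x.1.1 = a := by rw [h]; rfl
      rw [← h1, ← x.next_eq_top_iff, hs] at h
      exact absurd h (by simp)

theorem WireIdx.head_eq_inner_iff (x : WireIdx ty w) (v : WordVertex ty w) :
    x.head = .inner v ↔ v.IsEntry ∧ x = wireBefore ⟨v.wire, v.wire_lt⟩ v.letter := by
  constructor
  · intro h
    cases hs : x.next with
    | top => rw [x.head_of_top hs] at h; cases h
    | coe q =>
      rw [x.head_of_coe hs, PlabicPoint.inner.injEq, entryVertex_eq_iff] at h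
      obtain ⟨h1, h2, h3⟩ := h
      refine ⟨h3, ?_⟩
      rw [((x.next_eq_coe_iff q).mp hs).2, h1]
      congr 1
      exact Fin.ext h2.symm
  · rintro ⟨h1, h2⟩
    have h3 : x.1.1 = ⟨v.wire, v.wire_lt⟩ := by rw [h2]; rfl
    have hs : x.next = v.letter := by
      rw [x.next_eq_coe_iff, h3]
      exact ⟨v.touches, h2⟩
    rw [x.head_of_coe hs, PlabicPoint.inner.injEq, entryVertex_eq_iff]
    exact ⟨rfl, by rw [h3], h1⟩

end WordGraphCombinatorics

/-! ### The perfect orientation, its height function and path potentials -/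

section WordOrientation

variable {k : ℕ} {ty : TypeBC} {m : ℕ} {w : Fin m → DoubleLetter k}

variable (ty w) in
/-- The orientation of the graph of a double word in which horizontal edges are directed to the
right, and rungs upwards for positive and downwards for negative letters. -/
def wordOrientation : WordEdge ty w → Bool
  | .wire _ => true
  | .rung x => (w x.1.1).pos
  | .leftTop _ => true
  | .leftBottom _ => true
  | .topRight p => !(w p.1).pos
  | .bottomRight p => (w p.1).pos

/-- The beginning of an edge in the orientation `wordOrientation`. -/
noncomputable def WordEdge.start : WordEdge ty w → PlabicPoint (WordVertex ty w) (ty.dim k)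
  | .wire x => x.tail
  | .rung x => .inner (if (w x.1.1).pos then .lo x else .hi x)
  | .leftTop p => .inner (.sqLeft p)
  | .leftBottom p => .inner (.sqLeft p)
  | .topRight p => .inner (if (w p.1).pos then .sqRight p else .lo p.upper)
  | .bottomRight p => .inner (if (w p.1).pos then .hi p.lower else .sqRight p)

/-- The end of an edge in the orientation `wordOrientation`. -/
noncomputable def WordEdge.finish : WordEdge ty w → PlabicPoint (WordVertex ty w) (ty.dim k)
  | .wire x => x.head
  | .rung x => .inner (if (w x.1.1).pos then .hi x else .lo x)
  | .leftTop p => .inner (.lo p.upper)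
  | .leftBottom p => .inner (.hi p.lower)
  | .topRight p => .inner (if (w p.1).pos then .lo p.upper else .sqRight p)
  | .bottomRight p => .inner (if (w p.1).pos then .sqRight p else .hi p.lower)

theorem tailOf_wordOrientation (e : WordEdge ty w) :
    PlabicGraph.tailOf (Γ := wordGraph ty w) (wordOrientation ty w) e = e.start := by
  unfold PlabicGraph.tailOf
  cases e with
  | wire x => rfl
  | rung x => cases h : (w x.1.1).pos <;> simp [wordOrientation, WordEdge.start, wordGraph, h]
  | leftTop p => rfl
  | leftBottom p => rfl
  | topRight p => cases h : (w p.1).pos <;> simp [wordOrientation, WordEdge.start, wordGraph, h]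
  | bottomRight p => cases h : (w p.1).pos <;> simp [wordOrientation, WordEdge.start, wordGraph, h]

theorem headOf_wordOrientation (e : WordEdge ty w) :
    PlabicGraph.headOf (Γ := wordGraph ty w) (wordOrientation ty w) e = e.finish := by
  unfold PlabicGraph.headOf
  cases e with
  | wire x => rfl
  | rung x => cases h : (w x.1.1).pos <;> simp [wordOrientation, WordEdge.finish, wordGraph, h]
  | leftTop p => rfl
  | leftBottom p => rfl
  | topRight p => cases h : (w p.1).pos <;> simp [wordOrientation, WordEdge.finish, wordGraph, h]
  | bottomRight p => cases h : (w p.1).pos <;> simp [wordOrientation, WordEdge.finish, wordGraph, h]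

open Classical in
/-- The edges going out of a vertex. -/
noncomputable def outEdges : WordVertex ty w → Finset (WordEdge ty w)
  | .lo x =>
    if h : HasSquare ty (w x.1.1) ∧ (x.1.2 : ℕ) = k + 1 then
      if (w x.1.1).pos then {.rung x} else {.topRight ⟨x.1.1, h.1⟩}
    else if (w x.1.1).pos then {.wire (WordVertex.lo x).rightWire, .rung x}
      else {.wire (WordVertex.lo x).rightWire}
  | .hi x =>
    if h : HasSquare ty (w x.1.1) ∧ (x.1.2 : ℕ) = k then
      if (w x.1.1).pos then {.bottomRight ⟨x.1.1, h.1⟩} else {.rung x}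
    else if (w x.1.1).pos then {.wire (WordVertex.hi x).rightWire}
      else {.wire (WordVertex.hi x).rightWire, .rung x}
  | .sqLeft p => {.leftTop p, .leftBottom p}
  | .sqRight p => {.wire (WordVertex.sqRight p).rightWire,
      if (w p.1).pos then .topRight p else .bottomRight p}

theorem SquareIdx.upper_eq_iff (p : SquareIdx ty w) (x : RungIdx ty w) :
    p.upper = x ↔ p.1 = x.1.1 ∧ (x.1.2 : ℕ) = k + 1 := by
  constructor
  · rintro rfl; exact ⟨rfl, rfl⟩
  · rintro ⟨h1, h2⟩; exact Subtype.ext (Prod.ext h1 (Fin.ext h2.symm))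

theorem SquareIdx.lower_eq_iff (p : SquareIdx ty w) (x : RungIdx ty w) :
    p.lower = x ↔ p.1 = x.1.1 ∧ (x.1.2 : ℕ) = k := by
  constructor
  · rintro rfl; exact ⟨rfl, rfl⟩
  · rintro ⟨h1, h2⟩; exact Subtype.ext (Prod.ext h1 (Fin.ext h2.symm))

theorem mem_outEdges_iff (v : WordVertex ty w) (e : WordEdge ty w) :
    e ∈ outEdges v ↔ e.start = .inner v := by
  cases v with
  | lo x =>
    simp only [outEdges]
    cases e with
    | wire y =>
      simp only [WordEdge.start, WireIdx.tail_eq_inner_iff, WordVertex.IsExit]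
      split_ifs with h1 h2 h2 <;> simp [h1]
    | rung y =>
      simp only [WordEdge.start, PlabicPoint.inner.injEq]
      by_cases hy : y = x
      · subst hy
        split_ifs with h1 h2 h2 <;> simp
      · split_ifs <;> simp [hy]
    | leftTop p => split_ifs <;> simp [WordEdge.start]
    | leftBottom p => split_ifs <;> simp [WordEdge.start]
    | topRight p =>
      simp only [WordEdge.start, PlabicPoint.inner.injEq]
      by_cases hp : p.1 = x.1.1
      · have hsq : HasSquare ty (w x.1.1) := hp ▸ p.2
        have hp' : ∀ h, p = ⟨x.1.1, h⟩ := fun h => Subtype.ext hp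
        rw [hp]
        split_ifs with h1 h2 h2 <;> simp [SquareIdx.upper_eq_iff, hp]
        · exact iff_of_true (hp' _) h1.2
        · exact fun h => h1 ⟨hsq, h⟩
      · have hp' : ∀ h, p ≠ ⟨x.1.1, h⟩ := fun h hne => hp (congrArg Subtype.val hne)
        split_ifs <;> simp [SquareIdx.upper_eq_iff, hp, hp']
    | bottomRight p => split_ifs <;> simp [WordEdge.start] <;> split_ifs <;> simp
  | hi x =>
    simp only [outEdges]
    cases e with
    | wire y =>
      simp only [WordEdge.start, WireIdx.tail_eq_inner_iff, WordVertex.IsExit]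
      split_ifs with h1 h2 h2 <;> simp [h1]
    | rung y =>
      simp only [WordEdge.start, PlabicPoint.inner.injEq]
      by_cases hy : y = x
      · subst hy
        split_ifs with h1 h2 h2 <;> simp
      · split_ifs <;> simp [hy]
    | leftTop p => split_ifs <;> simp [WordEdge.start]
    | leftBottom p => split_ifs <;> simp [WordEdge.start]
    | bottomRight p =>
      simp only [WordEdge.start, PlabicPoint.inner.injEq]
      by_cases hp : p.1 = x.1.1
      · have hsq : HasSquare ty (w x.1.1) := hp ▸ p.2
        have hp' : ∀ h, p = ⟨x.1.1, h⟩ := fun h => Subtype.ext hp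
        rw [hp]
        split_ifs with h1 h2 h2 <;> simp [SquareIdx.lower_eq_iff, hp]
        · exact iff_of_true (hp' _) h1.2
        · exact fun h => h1 ⟨hsq, h⟩
      · have hp' : ∀ h, p ≠ ⟨x.1.1, h⟩ := fun h hne => hp (congrArg Subtype.val hne)
        split_ifs <;> simp [SquareIdx.lower_eq_iff, hp, hp']
    | topRight p => split_ifs <;> simp [WordEdge.start] <;> split_ifs <;> simp
  | sqLeft p =>
    simp only [outEdges]
    cases e with
    | wire y => simp [WordEdge.start, WireIdx.tail_eq_inner_iff, WordVertex.IsExit]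
    | rung y => simp only [WordEdge.start]; split_ifs <;> simp
    | leftTop q => simp [WordEdge.start]
    | leftBottom q => simp [WordEdge.start]
    | topRight q => simp only [WordEdge.start]; split_ifs <;> simp
    | bottomRight q => simp only [WordEdge.start]; split_ifs <;> simp
  | sqRight p =>
    simp only [outEdges]
    cases e with
    | wire y =>
      simp only [WordEdge.start, WireIdx.tail_eq_inner_iff, WordVertex.IsExit]
      split_ifs <;> simp
    | rung y => simp only [WordEdge.start]; split_ifs <;> simp
    | leftTop q => simp only [WordEdge.start]; split_ifs <;> simp
    | leftBottom q => simp only [WordEdge.start]; split_ifs <;> simp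
    | topRight q =>
      simp only [WordEdge.start]
      by_cases hq : q = p
      · subst hq; split_ifs <;> simp
      · split_ifs <;> simp [hq]
    | bottomRight q =>
      simp only [WordEdge.start]
      by_cases hq : q = p
      · subst hq; split_ifs <;> simp
      · split_ifs <;> simp [hq]

theorem WordEdge.start_eq_source_iff (e : WordEdge ty w) (a : Fin (ty.dim k)) :
    e.start = .source a ↔ e = .wire (firstWire a) := by
  cases e <;> simp [WordEdge.start, WireIdx.tail_eq_source_iff]

theorem WordEdge.start_ne_sink (e : WordEdge ty w) (a : Fin (ty.dim k)) : e.start ≠ .sink a := by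
  cases e <;> simp [WordEdge.start, WireIdx.tail_ne_sink]

theorem WordEdge.finish_eq_sink_iff (e : WordEdge ty w) (a : Fin (ty.dim k)) :
    e.finish = .sink a ↔ e = .wire (wireBefore a m) := by
  cases e <;> simp [WordEdge.finish, WireIdx.head_eq_sink_iff]

theorem WordEdge.finish_ne_source (e : WordEdge ty w) (a : Fin (ty.dim k)) :
    e.finish ≠ .source a := by
  cases e <;> simp [WordEdge.finish, WireIdx.head_ne_source]

theorem existsUnique_finish_of_isWhite (v : WordVertex ty w) (hv : v.IsWhite) :
    ∃! e : WordEdge ty w, e.finish = .inner v := by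
  cases v with
  | lo x =>
    obtain ⟨h1, h2⟩ := hv
    rw [exists_eq_upper_iff] at h1
    refine ⟨.wire (wireBefore ⟨_, (WordVertex.lo x).wire_lt⟩ (WordVertex.lo x).letter),
      ((WireIdx.head_eq_inner_iff _ _).mpr ⟨h1, rfl⟩), fun e he => ?_⟩
    have h1' : ∀ p : SquareIdx ty w, p.upper ≠ x := fun p hp =>
      h1 ((exists_eq_upper_iff x).mp ⟨p, hp.symm⟩)
    cases e with
    | wire y => rw [((WireIdx.head_eq_inner_iff _ _).mp he).2]
    | rung y =>
      simp only [WordEdge.finish, PlabicPoint.inner.injEq] at he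
      split_ifs at he with hy
      injection he with he
      subst he
      exact absurd h2 hy
    | leftTop p =>
      simp only [WordEdge.finish, PlabicPoint.inner.injEq, WordVertex.lo.injEq] at he
      exact absurd he (h1' p)
    | leftBottom p => simp [WordEdge.finish] at he
    | topRight p =>
      simp only [WordEdge.finish, PlabicPoint.inner.injEq] at he
      split_ifs at he with hy
      injection he with he
      exact absurd he (h1' p)
    | bottomRight p =>
      simp only [WordEdge.finish, PlabicPoint.inner.injEq] at he
      split_ifs at he
  | hi x =>
    obtain ⟨h1, h2⟩ := hv
    rw [exists_eq_lower_iff] at h1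
    refine ⟨.wire (wireBefore ⟨_, (WordVertex.hi x).wire_lt⟩ (WordVertex.hi x).letter),
      ((WireIdx.head_eq_inner_iff _ _).mpr ⟨h1, rfl⟩), fun e he => ?_⟩
    have h1' : ∀ p : SquareIdx ty w, p.lower ≠ x := fun p hp =>
      h1 ((exists_eq_lower_iff x).mp ⟨p, hp.symm⟩)
    cases e with
    | wire y => rw [((WireIdx.head_eq_inner_iff _ _).mp he).2]
    | rung y =>
      simp only [WordEdge.finish, PlabicPoint.inner.injEq] at he
      split_ifs at he with hy
      injection he with he
      subst he
      rw [h2] at hy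
      exact absurd hy (by simp)
    | leftBottom p =>
      simp only [WordEdge.finish, PlabicPoint.inner.injEq, WordVertex.hi.injEq] at he
      exact absurd he (h1' p)
    | leftTop p => simp [WordEdge.finish] at he
    | bottomRight p =>
      simp only [WordEdge.finish, PlabicPoint.inner.injEq] at he
      split_ifs at he with hy
      injection he with he
      exact absurd he (h1' p)
    | topRight p =>
      simp only [WordEdge.finish, PlabicPoint.inner.injEq] at he
      split_ifs at he
  | sqLeft p =>
    refine ⟨.wire (wireBefore ⟨_, (WordVertex.sqLeft p).wire_lt⟩ (WordVertex.sqLeft p).letter),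
      ((WireIdx.head_eq_inner_iff _ _).mpr ⟨trivial, rfl⟩), fun e he => ?_⟩
    cases e with
    | wire y => rw [((WireIdx.head_eq_inner_iff _ _).mp he).2]
    | rung y => simp only [WordEdge.finish, PlabicPoint.inner.injEq] at he; split_ifs at he
    | leftBottom q => simp [WordEdge.finish] at he
    | leftTop q => simp [WordEdge.finish] at he
    | bottomRight q => simp only [WordEdge.finish, PlabicPoint.inner.injEq] at he; split_ifs at he
    | topRight q => simp only [WordEdge.finish, PlabicPoint.inner.injEq] at he; split_ifs at he
  | sqRight p =>
    refine ⟨if (w p.1).pos then .bottomRight p else .topRight p, ?_, fun e he => ?_⟩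
    · simp only
      split_ifs with h <;> simp [WordEdge.finish, h]
    cases e with
    | wire y => exact ((WireIdx.head_eq_inner_iff _ _).mp he).1.elim
    | rung y => simp only [WordEdge.finish, PlabicPoint.inner.injEq] at he; split_ifs at he
    | leftBottom q => simp [WordEdge.finish] at he
    | leftTop q => simp [WordEdge.finish] at he
    | bottomRight q =>
      simp only [WordEdge.finish, PlabicPoint.inner.injEq] at he
      split_ifs at he with h
      injection he with he
      subst he
      rw [if_pos h]
    | topRight q =>
      simp only [WordEdge.finish, PlabicPoint.inner.injEq] at he
      split_ifs at he with h
      injection he with he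
      subst he
      rw [if_neg h]

theorem existsUnique_start_of_not_isWhite (v : WordVertex ty w) (hv : ¬ v.IsWhite) :
    ∃! e : WordEdge ty w, e.start = .inner v := by
  simp only [← mem_outEdges_iff]
  cases v with
  | lo x =>
    simp only [WordVertex.IsWhite, exists_eq_upper_iff] at hv
    simp only [outEdges]
    split_ifs with h1 h2 h2
    · simp
    · simp
    · exact absurd ⟨h1, h2⟩ hv
    · simp
  | hi x =>
    simp only [WordVertex.IsWhite, exists_eq_lower_iff] at hv
    simp only [outEdges]
    split_ifs with h1 h2 h2
    · simp
    · simp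
    · simp
    · exact absurd ⟨h1, by simpa using h2⟩ hv
  | sqLeft p => exact absurd trivial hv
  | sqRight p => exact absurd trivial hv

variable (ty w) in
theorem isPerfect_wordOrientation :
    PlabicGraph.IsPerfect (Γ := wordGraph ty w) (wordOrientation ty w) where
  source_out a := ⟨WordEdge.wire (firstWire a),
    (tailOf_wordOrientation _).trans ((WordEdge.start_eq_source_iff _ a).mpr rfl),
    fun e he => (WordEdge.start_eq_source_iff e a).mp ((tailOf_wordOrientation e).symm.trans he)⟩
  source_in a e h := WordEdge.finish_ne_source e a ((headOf_wordOrientation e).symm.trans h)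
  sink_in a := ⟨WordEdge.wire (wireBefore a m),
    (headOf_wordOrientation _).trans ((WordEdge.finish_eq_sink_iff _ a).mpr rfl),
    fun e he => (WordEdge.finish_eq_sink_iff e a).mp ((headOf_wordOrientation e).symm.trans he)⟩
  sink_out a e h := WordEdge.start_ne_sink e a ((tailOf_wordOrientation e).symm.trans h)
  white v hv := by
    obtain ⟨e, he, hu⟩ := existsUnique_finish_of_isWhite v hv
    exact ⟨e, (headOf_wordOrientation e).trans he,
      fun e' he' => hu e' ((headOf_wordOrientation e').symm.trans he')⟩
  black v hv := by
    obtain ⟨e, he, hu⟩ := existsUnique_start_of_not_isWhite v hv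
    exact ⟨e, (tailOf_wordOrientation e).trans he,
      fun e' he' => hu e' ((tailOf_wordOrientation e').symm.trans he')⟩

open Classical in
/-- The horizontal position of a vertex inside the graph of a letter, after a deformation of the
graph that makes all edges go to the right. -/
noncomputable def WordVertex.offset : WordVertex ty w → ℕ
  | .lo x => if HasSquare ty (w x.1.1) ∧ (x.1.2 : ℕ) = k + 1 then (if (w x.1.1).pos then 4 else 2)
      else (if (w x.1.1).pos then 0 else 5)
  | .hi x => if HasSquare ty (w x.1.1) ∧ (x.1.2 : ℕ) = k then (if (w x.1.1).pos then 2 else 4)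
      else (if (w x.1.1).pos then 5 else 0)
  | .sqLeft _ => 1
  | .sqRight _ => 3

/-- A height function for `wordOrientation`. -/
noncomputable def wordHeight : PlabicPoint (WordVertex ty w) (ty.dim k) → ℕ
  | .source _ => 0
  | .inner v => 10 * v.letter + v.offset + 1
  | .sink _ => 10 * m + 1

theorem WordVertex.offset_le (v : WordVertex ty w) : v.offset ≤ 5 := by
  cases v <;> simp only [WordVertex.offset] <;> (try split_ifs) <;> omega

/-- Consecutive letters are `10` apart and offsets are at most `5`, so edges between letters rise.
In a square the order is left, bottom, right, top for a positive letter and left, top, right, bottom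
for a negative one. -/
theorem wordHeight_start_lt_finish (e : WordEdge ty w) :
    wordHeight e.start < wordHeight e.finish := by
  cases e with
  | wire x =>
    simp only [WordEdge.start, WordEdge.finish]
    cases hs : x.1.2 with
    | bot =>
      rw [x.tail_of_bot hs]
      cases hn : x.next with
      | top => rw [x.head_of_top hn]; simp only [wordHeight]; omega
      | coe q => rw [x.head_of_coe hn]; simp only [wordHeight]; omega
    | coe p =>
      have hp := ((exitVertex_eq_iff p x.1.1 (x.2 p hs) _).mp rfl).1
      rw [x.tail_of_coe hs]
      have h1 := (exitVertex p x.1.1 (x.2 p hs)).offset_le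
      cases hn : x.next with
      | top =>
        rw [x.head_of_top hn]
        simp only [wordHeight]
        rw [hp]
        omega
      | coe q =>
        have hq := ((entryVertex_eq_iff q x.1.1 (x.touches_next q hn) _).mp rfl).1
        have hlt := WireIdx.lt_of_next_eq hn
        rw [hs, WithBot.coe_lt_coe, Fin.lt_def] at hlt
        rw [x.head_of_coe hn]
        simp only [wordHeight]
        rw [hp, hq]
        omega
  | rung x =>
    have h := x.2
    simp only [WordEdge.start, WordEdge.finish, wordHeight]
    by_cases hp : (w x.1.1).pos
    · simp only [hp, if_true, WordVertex.letter, WordVertex.offset]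
      split_ifs <;> omega
    · simp only [hp, WordVertex.letter, WordVertex.offset]
      simp only [Bool.false_eq_true, if_false]
      split_ifs <;> omega
  | leftTop p =>
    have h1 : HasSquare ty (w p.upper.1.1) ∧ (p.upper.1.2 : ℕ) = k + 1 := ⟨p.2, rfl⟩
    have h2 : p.upper.1.1 = p.1 := rfl
    simp only [WordEdge.start, WordEdge.finish, wordHeight, WordVertex.letter, WordVertex.offset]
    rw [if_pos h1, h2]
    split_ifs <;> omega
  | leftBottom p =>
    have h1 : HasSquare ty (w p.lower.1.1) ∧ (p.lower.1.2 : ℕ) = k := ⟨p.2, rfl⟩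
    have h2 : p.lower.1.1 = p.1 := rfl
    simp only [WordEdge.start, WordEdge.finish, wordHeight, WordVertex.letter, WordVertex.offset]
    rw [if_pos h1, h2]
    split_ifs <;> omega
  | topRight p =>
    have h1 : HasSquare ty (w p.upper.1.1) ∧ (p.upper.1.2 : ℕ) = k + 1 := ⟨p.2, rfl⟩
    have h2 : p.upper.1.1 = p.1 := rfl
    simp only [WordEdge.start, WordEdge.finish, wordHeight]
    by_cases hp : (w p.1).pos
    · simp only [hp, if_true, WordVertex.letter, WordVertex.offset]
      rw [if_pos h1, h2, if_pos hp]; omega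
    · rw [if_neg hp, if_neg hp]
      simp only [WordVertex.letter, WordVertex.offset]
      rw [if_pos h1, h2, if_neg hp]; omega
  | bottomRight p =>
    have h1 : HasSquare ty (w p.lower.1.1) ∧ (p.lower.1.2 : ℕ) = k := ⟨p.2, rfl⟩
    have h2 : p.lower.1.1 = p.1 := rfl
    simp only [WordEdge.start, WordEdge.finish, wordHeight]
    by_cases hp : (w p.1).pos
    · simp only [hp, if_true, WordVertex.letter, WordVertex.offset]
      rw [if_pos h1, h2, if_pos hp]; omega
    · rw [if_neg hp, if_neg hp]
      simp only [WordVertex.letter, WordVertex.offset]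
      rw [if_pos h1, h2, if_neg hp]; omega

/-- The index of the first letter that begins to the right of a given place. -/
def letterAfter : WithBot (Fin m) → ℕ
  | ⊥ => 0
  | (p : Fin m) => p + 1

/-- The conditions under which the function `E`, whose value `E p a` belongs to the point of wire `a`
in front of letter number `p`, solves the recursion for the path sums towards the sink `j`.  The
numbers `J p a` belong to the points of the wires behind the letters, and `top`, `bot` and `right`
to the vertices of the squares. -/
structure IsPathPotential (wt : WordEdge ty w → ℂˣ) (j : Fin (ty.dim k)) (E : ℕ → ℕ → ℂ)
    (J : Fin m → ℕ → ℂ) (top bot right : Fin m → ℂ) : Prop where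
  terminal : ∀ a : Fin (ty.dim k), E m a = if a = j then 1 else 0
  skip : ∀ (p : Fin m) (a : Fin (ty.dim k)), ¬ Touches ty (w p) a → E p a = E (p + 1) a
  wire : ∀ (x : WireIdx ty w) (p : Fin m), x.1.2 = p → J p x.1.1 = wt (.wire x) * E (p + 1) x.1.1
  pos : ∀ x : RungIdx ty w, ¬ HasSquare ty (w x.1.1) → (w x.1.1).pos = true →
    E x.1.1 (x.1.2 - 1) = J x.1.1 (x.1.2 - 1) + wt (.rung x) * E x.1.1 x.1.2 ∧
    E x.1.1 x.1.2 = J x.1.1 x.1.2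
  neg : ∀ x : RungIdx ty w, ¬ HasSquare ty (w x.1.1) → (w x.1.1).pos = false →
    E x.1.1 x.1.2 = J x.1.1 x.1.2 + wt (.rung x) * E x.1.1 (x.1.2 - 1) ∧
    E x.1.1 (x.1.2 - 1) = J x.1.1 (x.1.2 - 1)
  square : ∀ p : SquareIdx ty w, E p.1 k = wt (.leftTop p) * top p.1 + wt (.leftBottom p) * bot p.1
  square_pos : ∀ p : SquareIdx ty w, (w p.1).pos = true →
    top p.1 = wt (.rung p.upper) * E p.1 (k + 1) ∧ bot p.1 = wt (.bottomRight p) * right p.1 ∧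
    right p.1 = J p.1 k + wt (.topRight p) * top p.1 ∧
    E p.1 (k - 1) = J p.1 (k - 1) + wt (.rung p.lower) * bot p.1 ∧ E p.1 (k + 1) = J p.1 (k + 1)
  square_neg : ∀ p : SquareIdx ty w, (w p.1).pos = false →
    bot p.1 = wt (.rung p.lower) * E p.1 (k - 1) ∧ top p.1 = wt (.topRight p) * right p.1 ∧
    right p.1 = J p.1 k + wt (.bottomRight p) * bot p.1 ∧
    E p.1 (k + 1) = J p.1 (k + 1) + wt (.rung p.upper) * top p.1 ∧ E p.1 (k - 1) = J p.1 (k - 1)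

open Classical in
/-- The values of a path potential at the vertices. -/
noncomputable def potentialAt (E : ℕ → ℕ → ℂ) (top bot right : Fin m → ℂ) : WordVertex ty w → ℂ
  | .lo x => if HasSquare ty (w x.1.1) ∧ (x.1.2 : ℕ) = k + 1 then top x.1.1 else E x.1.1 (x.1.2 - 1)
  | .hi x => if HasSquare ty (w x.1.1) ∧ (x.1.2 : ℕ) = k then bot x.1.1 else E x.1.1 x.1.2
  | .sqLeft p => E p.1 k
  | .sqRight p => right p.1

theorem potentialAt_of_isEntry {E : ℕ → ℕ → ℂ} {top bot right : Fin m → ℂ} {v : WordVertex ty w}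
    (hv : v.IsEntry) : potentialAt E top bot right v = E v.letter v.wire := by
  cases v with
  | lo x => exact if_neg hv
  | hi x => exact if_neg hv
  | sqLeft p => rfl
  | sqRight p => exact hv.elim

/-- The values of a path potential. -/
noncomputable def potentialAtPoint (wt : WordEdge ty w → ℂˣ) (j : Fin (ty.dim k)) (E : ℕ → ℕ → ℂ)
    (top bot right : Fin m → ℂ) : PlabicPoint (WordVertex ty w) (ty.dim k) → ℂ
  | .source a => wt (.wire (firstWire a)) * E 0 a
  | .inner v => potentialAt E top bot right v
  | .sink a => if a = j then 1 else 0

variable {wt : WordEdge ty w → ℂˣ} {j : Fin (ty.dim k)} {E : ℕ → ℕ → ℂ} {J : Fin m → ℕ → ℂ}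
  {top bot right : Fin m → ℂ}

theorem IsPathPotential.eq_of_not_touches (h : IsPathPotential wt j E J top bot right)
    (a : Fin (ty.dim k)) {s t : ℕ} (hst : s ≤ t) (htm : t ≤ m)
    (hno : ∀ p : Fin m, s ≤ p → (p : ℕ) < t → ¬ Touches ty (w p) a) : E s a = E t a := by
  induction t, hst using Nat.le_induction with
  | base => rfl
  | succ t hst ih =>
    rw [ih (by omega) fun p h1 h2 => hno p h1 (by omega)]
    exact h.skip ⟨t, htm⟩ a (hno ⟨t, htm⟩ hst (Nat.lt_succ_self t))

theorem letterAfter_le_iff (s : WithBot (Fin m)) (p : Fin m) :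
    letterAfter s ≤ p ↔ s < (p : WithBot (Fin m)) := by
  cases s with
  | bot => simp [letterAfter]
  | coe q =>
    rw [WithBot.coe_lt_coe, Fin.lt_def]
    exact Nat.succ_le_iff

/-- The letters between the two ends of a horizontal edge do not touch its wire, so the potential
just behind its beginning already has the value that belongs to its end. -/
theorem IsPathPotential.head_eq (h : IsPathPotential wt j E J top bot right) (x : WireIdx ty w) :
    potentialAtPoint wt j E top bot right x.head = E (letterAfter x.1.2) x.1.1 := by
  classical
  cases hn : x.next with
  | top =>
    rw [x.head_of_top hn]
    rw [WireIdx.next, Finset.min_eq_top, Finset.filter_eq_empty_iff] at hn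
    rw [h.eq_of_not_touches x.1.1 (t := m) ?_ le_rfl, h.terminal]
    · rfl
    · exact fun p h1 _ ht => hn (Finset.mem_univ p) ⟨ht, (letterAfter_le_iff _ p).mp h1⟩
    · cases x.1.2 with
      | bot => exact Nat.zero_le _
      | coe p => exact p.2
  | coe q =>
    rw [x.head_of_coe hn]
    obtain ⟨h1, h2, h3⟩ := (entryVertex_eq_iff q x.1.1 (x.touches_next q hn) _).mp rfl
    rw [potentialAtPoint, potentialAt_of_isEntry h3, h1, h2]
    refine (h.eq_of_not_touches x.1.1 ?_ q.2.le ?_).symm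
    · exact (letterAfter_le_iff _ q).mpr (WireIdx.lt_of_next_eq hn)
    · intro p h4 h5 ht
      have : x.next ≤ p := Finset.min_le
        (Finset.mem_filter.mpr ⟨Finset.mem_univ _, ht, (letterAfter_le_iff _ p).mp h4⟩)
      rw [hn, WithTop.coe_le_coe, Fin.le_def] at this
      omega

theorem IsPathPotential.rightWire_eq (h : IsPathPotential wt j E J top bot right)
    (v : WordVertex ty w) :
    wt (.wire v.rightWire) * potentialAtPoint wt j E top bot right v.rightWire.head =
      J v.letter v.wire := by
  rw [h.head_eq]
  exact (h.wire v.rightWire v.letter rfl).symm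

/-- The fields of `IsPathPotential` are the recursion at the individual kinds of vertices;
horizontal edges are accounted for by the numbers `J`. -/
theorem IsPathPotential.potentialAt_eq_sum (h : IsPathPotential wt j E J top bot right)
    (v : WordVertex ty w) :
    potentialAt E top bot right v =
      ∑ e ∈ outEdges v, (wt e : ℂ) * potentialAtPoint wt j E top bot right e.finish := by
  classical
  have hw := h.rightWire_eq v
  cases v with
  | lo x =>
    simp only [outEdges, potentialAt]
    by_cases hsq : HasSquare ty (w x.1.1) ∧ (x.1.2 : ℕ) = k + 1
    · have hx : x = SquareIdx.upper ⟨x.1.1, hsq.1⟩ :=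
        ((SquareIdx.upper_eq_iff _ x).mpr ⟨rfl, hsq.2⟩).symm
      rw [if_pos hsq, dif_pos hsq]
      by_cases hp : (w x.1.1).pos = true
      · rw [if_pos hp, Finset.sum_singleton]
        simp only [WordEdge.finish, potentialAtPoint, potentialAt, hp, if_true]
        rw [if_neg (by omega), hsq.2]
        conv_rhs => rw [hx]
        exact (h.square_pos ⟨x.1.1, hsq.1⟩ hp).1
      · rw [if_neg hp, Finset.sum_singleton]
        simp only [WordEdge.finish, potentialAtPoint]
        rw [if_neg hp]
        exact (h.square_neg ⟨x.1.1, hsq.1⟩ (by simpa using hp)).2.1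
    · rw [if_neg hsq, dif_neg hsq]
      have hb := x.2.bounds
      by_cases hp : (w x.1.1).pos = true
      · rw [if_pos hp, Finset.sum_pair (by simp), WordEdge.finish, hw]
        simp only [WordEdge.finish, potentialAtPoint, potentialAt, hp, if_true, WordVertex.letter,
          WordVertex.wire]
        by_cases hs : HasSquare ty (w x.1.1)
        · have hk : (x.1.2 : ℕ) = k :=
            ((hs.hasRung_iff _).mp x.2).resolve_right fun hk => hsq ⟨hs, hk⟩
          have hx : x = SquareIdx.lower ⟨x.1.1, hs⟩ :=
            ((SquareIdx.lower_eq_iff _ x).mpr ⟨rfl, hk⟩).symm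
          rw [if_pos ⟨hs, hk⟩, hk]
          conv_rhs => rw [hx]
          exact (h.square_pos ⟨x.1.1, hs⟩ hp).2.2.2.1
        · rw [if_neg (fun h => hs h.1)]
          exact (h.pos x hs hp).1
      · rw [if_neg hp, Finset.sum_singleton, WordEdge.finish, hw]
        have hp' : (w x.1.1).pos = false := by simpa using hp
        simp only [WordVertex.letter, WordVertex.wire]
        by_cases hs : HasSquare ty (w x.1.1)
        · have hk : (x.1.2 : ℕ) = k :=
            ((hs.hasRung_iff _).mp x.2).resolve_right fun hk => hsq ⟨hs, hk⟩
          rw [hk]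
          exact (h.square_neg ⟨x.1.1, hs⟩ hp').2.2.2.2
        · exact (h.neg x hs hp').2
  | hi x =>
    simp only [outEdges, potentialAt]
    by_cases hsq : HasSquare ty (w x.1.1) ∧ (x.1.2 : ℕ) = k
    · have hx : x = SquareIdx.lower ⟨x.1.1, hsq.1⟩ :=
        ((SquareIdx.lower_eq_iff _ x).mpr ⟨rfl, hsq.2⟩).symm
      rw [if_pos hsq, dif_pos hsq]
      by_cases hp : (w x.1.1).pos = true
      · rw [if_pos hp, Finset.sum_singleton]
        simp only [WordEdge.finish, potentialAtPoint]
        rw [if_pos hp]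
        exact (h.square_pos ⟨x.1.1, hsq.1⟩ hp).2.1
      · rw [if_neg hp, Finset.sum_singleton]
        simp only [WordEdge.finish, potentialAtPoint]
        rw [if_neg hp]
        simp only [potentialAt]
        rw [if_neg (by omega), hsq.2]
        conv_rhs => rw [hx]
        exact (h.square_neg ⟨x.1.1, hsq.1⟩ (by simpa using hp)).1
    · rw [if_neg hsq, dif_neg hsq]
      have hb := x.2.bounds
      by_cases hp : (w x.1.1).pos = true
      · rw [if_pos hp, Finset.sum_singleton, WordEdge.finish, hw]
        simp only [WordVertex.letter, WordVertex.wire]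
        by_cases hs : HasSquare ty (w x.1.1)
        · have hk : (x.1.2 : ℕ) = k + 1 :=
            ((hs.hasRung_iff _).mp x.2).resolve_left fun hk => hsq ⟨hs, hk⟩
          rw [hk]
          exact (h.square_pos ⟨x.1.1, hs⟩ hp).2.2.2.2
        · exact (h.pos x hs hp).2
      · rw [if_neg hp, Finset.sum_pair (by simp), WordEdge.finish, hw]
        have hp' : (w x.1.1).pos = false := by simpa using hp
        simp only [WordEdge.finish, potentialAtPoint]
        rw [if_neg hp]
        simp only [potentialAt, WordVertex.letter, WordVertex.wire]
        by_cases hs : HasSquare ty (w x.1.1)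
        · have hk : (x.1.2 : ℕ) = k + 1 :=
            ((hs.hasRung_iff _).mp x.2).resolve_left fun hk => hsq ⟨hs, hk⟩
          have hx : x = SquareIdx.upper ⟨x.1.1, hs⟩ :=
            ((SquareIdx.upper_eq_iff _ x).mpr ⟨rfl, hk⟩).symm
          rw [if_pos ⟨hs, hk⟩, hk]
          conv_rhs => rw [hx]
          exact (h.square_neg ⟨x.1.1, hs⟩ hp').2.2.2.1
        · rw [if_neg (fun h => hs h.1)]
          exact (h.neg x hs hp').1
  | sqLeft p =>
    simp only [outEdges, potentialAt]
    rw [Finset.sum_pair (by simp)]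
    simp only [WordEdge.finish, potentialAtPoint, potentialAt]
    rw [if_pos ⟨p.2, rfl⟩, if_pos ⟨p.2, rfl⟩]
    exact h.square p
  | sqRight p =>
    simp only [outEdges, potentialAt]
    by_cases hp : (w p.1).pos = true
    · rw [if_pos hp, Finset.sum_pair (by simp), WordEdge.finish, hw, WordEdge.finish, if_pos hp]
      simp only [potentialAtPoint, potentialAt]
      rw [if_pos ⟨p.2, rfl⟩]
      exact (h.square_pos p hp).2.2.1
    · rw [if_neg hp, Finset.sum_pair (by simp), WordEdge.finish, hw, WordEdge.finish, if_neg hp]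
      simp only [potentialAtPoint, potentialAt]
      rw [if_pos ⟨p.2, rfl⟩]
      exact (h.square_neg p (by simpa using hp)).2.2.1

/-- The boundary measurements of the graph of a double word are given by a path potential. -/
theorem IsPathPotential.boundaryMatrix_eq (h : IsPathPotential wt j E J top bot right)
    (i : Fin (ty.dim k)) :
    PlabicGraph.boundaryMatrix (Γ := wordGraph ty w) (wordOrientation ty w) wt i j =
      wt (.wire (firstWire i)) * E 0 i := by
  refine PlabicGraph.boundaryMatrix_eq_of_recursion (Γ := wordGraph ty w) (ht := wordHeight)
    (fun e => ?_) (isPerfect_wordOrientation ty w).sink_out wt j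
    (potentialAtPoint wt j E top bot right) (fun _ => rfl) (fun x hx => ?_) i
  · exact ((congrArg wordHeight (tailOf_wordOrientation e)).trans_lt
      (wordHeight_start_lt_finish e)).trans_eq (congrArg wordHeight (headOf_wordOrientation e).symm)
  · cases x with
    | sink a => exact absurd rfl (hx a)
    | source a =>
      refine ⟨({WordEdge.wire (firstWire a)} : Finset (WordEdge ty w)), fun e => ?_, ?_⟩
      · exact Finset.mem_singleton.trans ((WordEdge.start_eq_source_iff e a).symm.trans
          (Eq.congr_left (tailOf_wordOrientation e).symm))
      · refine Eq.trans ?_ (Finset.sum_singleton _ _).symm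
        exact congrArg (fun z : ℂ => (wt (.wire (firstWire a)) : ℂ) * z)
          (h.head_eq (firstWire a)).symm
    | inner v =>
      refine ⟨outEdges v, fun e => (mem_outEdges_iff v e).trans
        (Eq.congr_left (tailOf_wordOrientation e).symm), ?_⟩
      refine (h.potentialAt_eq_sum v).trans (Finset.sum_congr rfl fun e _ => ?_)
      exact congrArg (fun y => (wt e : ℂ) * potentialAtPoint wt j E top bot right y)
        (headOf_wordOrientation e).symm

end WordOrientation

/-! ### Products of face weights along a strip -/

section FaceProducts

variable {k : ℕ} {ty : TypeBC} {m : ℕ} {w : Fin m → DoubleLetter k}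

/-- The face on the left of an edge in the orientation `wordOrientation`. -/
noncomputable def WordEdge.leftSide : WordEdge ty w → WordFace ty w
  | .wire x => lastFace x.1.1.succ fun q => (q : WithBot (Fin m)) ≤ x.1.2
  | .rung x => if (w x.1.1).pos then x.leftFace else x.rightFace
  | .leftTop p => p.upper.leftFace
  | .leftBottom p => .square p
  | .topRight p => if (w p.1).pos then .square p else p.upper.rightFace
  | .bottomRight p => if (w p.1).pos then .square p else p.lower.rightFace

/-- The face on the right of an edge in the orientation `wordOrientation`. -/
noncomputable def WordEdge.rightSide : WordEdge ty w → WordFace ty w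
  | .wire x => lastFace x.1.1.castSucc fun q => (q : WithBot (Fin m)) ≤ x.1.2
  | .rung x => if (w x.1.1).pos then x.rightFace else x.leftFace
  | .leftTop p => .square p
  | .leftBottom p => p.lower.leftFace
  | .topRight p => if (w p.1).pos then p.upper.rightFace else .square p
  | .bottomRight p => if (w p.1).pos then p.lower.rightFace else .square p

theorem leftOf_wordOrientation (e : WordEdge ty w) :
    PlabicGraph.leftOf (Γ := wordGraph ty w) (wordOrientation ty w) e = e.leftSide := by
  unfold PlabicGraph.leftOf
  cases e with
  | wire x => rfl
  | rung x => cases h : (w x.1.1).pos <;> simp [wordOrientation, WordEdge.leftSide, wordGraph, h]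
  | leftTop p => rfl
  | leftBottom p => rfl
  | topRight p => cases h : (w p.1).pos <;> simp [wordOrientation, WordEdge.leftSide, wordGraph, h]
  | bottomRight p =>
    cases h : (w p.1).pos <;> simp [wordOrientation, WordEdge.leftSide, wordGraph, h]

theorem rightOf_wordOrientation (e : WordEdge ty w) :
    PlabicGraph.rightOf (Γ := wordGraph ty w) (wordOrientation ty w) e = e.rightSide := by
  unfold PlabicGraph.rightOf
  cases e with
  | wire x => rfl
  | rung x => cases h : (w x.1.1).pos <;> simp [wordOrientation, WordEdge.rightSide, wordGraph, h]
  | leftTop p => rfl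
  | leftBottom p => rfl
  | topRight p => cases h : (w p.1).pos <;> simp [wordOrientation, WordEdge.rightSide, wordGraph, h]
  | bottomRight p =>
    cases h : (w p.1).pos <;> simp [wordOrientation, WordEdge.rightSide, wordGraph, h]

/-- Edges sorted by their kind. -/
def WordEdge.equivSum : WordEdge ty w ≃ (WireIdx ty w ⊕ RungIdx ty w) ⊕ (SquareIdx ty w ⊕ SquareIdx ty w) ⊕
    (SquareIdx ty w ⊕ SquareIdx ty w) where
  toFun
    | .wire x => .inl (.inl x)
    | .rung x => .inl (.inr x)
    | .leftTop p => .inr (.inl (.inl p))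
    | .leftBottom p => .inr (.inl (.inr p))
    | .topRight p => .inr (.inr (.inl p))
    | .bottomRight p => .inr (.inr (.inr p))
  invFun
    | .inl (.inl x) => .wire x
    | .inl (.inr x) => .rung x
    | .inr (.inl (.inl p)) => .leftTop p
    | .inr (.inl (.inr p)) => .leftBottom p
    | .inr (.inr (.inl p)) => .topRight p
    | .inr (.inr (.inr p)) => .bottomRight p
  left_inv e := by cases e <;> rfl
  right_inv e := by rcases e with (_ | _) | (_ | _) | (_ | _) <;> rfl

open Classical in
theorem prod_wordEdge {M : Type*} [CommMonoid M] (f : WordEdge ty w → M) :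
    ∏ e, f e = (∏ x, f (.wire x)) * (∏ x, f (.rung x)) *
      ∏ p, (f (.leftTop p) * f (.leftBottom p) * (f (.topRight p) * f (.bottomRight p))) := by
  rw [← Equiv.prod_comp WordEdge.equivSum.symm, Fintype.prod_sum_type, Fintype.prod_sum_type,
    Fintype.prod_sum_type, Fintype.prod_sum_type, Fintype.prod_sum_type, Finset.prod_mul_distrib,
    Finset.prod_mul_distrib, Finset.prod_mul_distrib]
  rfl

open Classical in
/-- The contribution of an edge to the product of the weights of the faces in `S`. -/
noncomputable def edgeFactor (S : Finset (WordFace ty w)) (wt : WordEdge ty w → ℂˣ)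
    (e : WordEdge ty w) : ℂˣ :=
  (if e.leftSide ∈ S then wt e else 1) * if e.rightSide ∈ S then (wt e)⁻¹ else 1

/-- Face weights in the orientation `wordOrientation`. -/
noncomputable abbrev wordFaceWeight (wt : WordEdge ty w → ℂˣ) (f : WordFace ty w) : ℂˣ :=
  PlabicGraph.faceWeight (Γ := wordGraph ty w) (wordOrientation ty w) wt f

open Classical in
-- Interchange the products over faces and edges. An edge with both sides in `S` contributes its
-- weight and the inverse, so only the boundary of the region `S` counts.
theorem prod_wordFaceWeight (S : Finset (WordFace ty w)) (wt : WordEdge ty w → ℂˣ) :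
    ∏ f ∈ S, wordFaceWeight wt f = ∏ e, edgeFactor S wt e := by
  have h : ∀ f, wordFaceWeight wt f = (∏ e : WordEdge ty w, if e.leftSide = f then wt e else 1) *
      ∏ e : WordEdge ty w, if e.rightSide = f then (wt e)⁻¹ else 1 := by
    intro f
    unfold wordFaceWeight PlabicGraph.faceWeight
    congr 1
    · exact Finset.prod_congr rfl fun e _ => by
        rw [← leftOf_wordOrientation e]; rfl
    · exact Finset.prod_congr rfl fun e _ => by
        rw [← rightOf_wordOrientation e]; rfl
  simp only [h]
  rw [Finset.prod_mul_distrib, Finset.prod_comm, Finset.prod_comm (s := S)]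
  unfold edgeFactor
  rw [Finset.prod_mul_distrib]
  congr 1 <;> exact Finset.prod_congr rfl fun e _ => Finset.prod_ite_eq S _ _

open Classical in
/-- The faces in strip `r` that begin in front of the letter number `p`. -/
noncomputable def stripFaces (r : ℕ) (p : ℕ) : Finset (WordFace ty w) :=
  (Finset.univ.filter fun x : StripIdx ty w => (x.1.1 : ℕ) = r ∧ letterAfter x.1.2 ≤ p).image
    WordFace.strip

theorem strip_mem_stripFaces_iff (r p : ℕ) (x : StripIdx ty w) :
    WordFace.strip x ∈ stripFaces (ty := ty) (w := w) r p ↔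
      (x.1.1 : ℕ) = r ∧ letterAfter x.1.2 ≤ p := by
  classical
  simp [stripFaces]

theorem square_notMem_stripFaces (r p : ℕ) (q : SquareIdx ty w) :
    WordFace.square q ∉ stripFaces (ty := ty) (w := w) r p := by
  classical
  simp [stripFaces]

theorem letterAfter_max_le_iff (S : Finset (Fin m)) (p : ℕ) :
    letterAfter S.max ≤ p ↔ ∀ q ∈ S, (q : ℕ) < p := by
  constructor
  · intro h q hq
    have h1 := Finset.le_max hq
    cases hm : S.max with
    | bot => rw [hm] at h1; exact absurd h1 (by simp)
    | coe q' =>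
      rw [hm, WithBot.coe_le_coe, Fin.le_def] at h1
      rw [hm] at h
      have : (q' : ℕ) + 1 ≤ p := h
      omega
  · intro h
    cases hm : S.max with
    | bot => exact Nat.zero_le _
    | coe q' => exact h q' (Finset.mem_of_max hm)

theorem lastFace_mem_stripFaces_iff (r p : ℕ) (r' : Fin (ty.dim k + 1)) (P : Fin m → Prop) :
    lastFace r' P ∈ stripFaces (ty := ty) (w := w) r p ↔
      (r' : ℕ) = r ∧ ∀ q, HasRung ty (w q) r' → P q → (q : ℕ) < p := by
  classical
  rw [lastFace, strip_mem_stripFaces_iff]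
  refine and_congr_right fun _ => ?_
  rw [letterAfter_max_le_iff]
  simp

/-- The number `p` is the number of a letter with a rung in strip `r`, or it is beyond the last
letter. -/
def IsCut (w : Fin m → DoubleLetter k) (ty : TypeBC) (r p : ℕ) : Prop :=
  ∀ q : Fin m, (q : ℕ) = p → HasRung ty (w q) r

theorem lt_letterAfter_of_le {q : Fin m} {s : WithBot (Fin m)} (h : (q : WithBot (Fin m)) ≤ s) :
    (q : ℕ) < letterAfter s := by
  cases s with
  | bot => exact absurd h (by simp)
  | coe p =>
    rw [WithBot.coe_le_coe, Fin.le_def] at h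
    exact Nat.lt_succ_of_le h

theorem letterAfter_le (s : WithBot (Fin m)) : letterAfter s ≤ m := by
  cases s with
  | bot => exact Nat.zero_le _
  | coe p => exact p.2

variable {r p : ℕ}

/-- At a cut, the rung of the letter number `p` closes the faces that begin in front of it, so an
edge borders one of them only if it begins there too. Away from cuts such a face would extend beyond
`p`. -/
theorem lastFace_le_mem_stripFaces_iff (hc : IsCut w ty r p) (r' : Fin (ty.dim k + 1))
    (s : WithBot (Fin m)) :
    lastFace r' (fun q => (q : WithBot (Fin m)) ≤ s) ∈ stripFaces (ty := ty) (w := w) r p ↔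
      (r' : ℕ) = r ∧ letterAfter s ≤ p := by
  rw [lastFace_mem_stripFaces_iff]
  refine and_congr_right fun hr => ⟨fun h => ?_, fun h q _ hq => ?_⟩
  · by_contra hcon
    have hm := letterAfter_le s
    have hle : ¬ s < ((⟨p, by omega⟩ : Fin m) : WithBot (Fin m)) := by
      rw [← letterAfter_le_iff]; exact hcon
    have := h ⟨p, by omega⟩ (hr ▸ hc ⟨p, by omega⟩ rfl) (not_lt.mp hle)
    exact absurd this (lt_irrefl p)
  · exact (lt_letterAfter_of_le hq).trans_le h

theorem RungIdx.leftFace_mem_stripFaces_iff (hc : IsCut w ty r p) (x : RungIdx ty w) :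
    x.leftFace ∈ stripFaces (ty := ty) (w := w) r p ↔ (x.1.2 : ℕ) = r ∧ (x.1.1 : ℕ) ≤ p := by
  rw [RungIdx.leftFace, lastFace_mem_stripFaces_iff]
  refine and_congr_right fun hr => ⟨fun h => ?_, fun h q _ hq => ?_⟩
  · by_contra hcon
    have hm := x.1.1.2
    have := h ⟨p, by omega⟩ (hr ▸ hc ⟨p, by omega⟩ rfl) (Fin.lt_def.mpr (not_le.mp hcon))
    exact absurd this (lt_irrefl p)
  · exact (Fin.lt_def.mp hq).trans_le h

theorem RungIdx.rightFace_mem_stripFaces_iff (x : RungIdx ty w) :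
    x.rightFace ∈ stripFaces (ty := ty) (w := w) r p ↔ (x.1.2 : ℕ) = r ∧ (x.1.1 : ℕ) < p := by
  rw [RungIdx.rightFace, strip_mem_stripFaces_iff]
  rfl

open Classical in
/-- The product of the weights of the edges of wire `a` that begin in front of the letter
number `p`. -/
noncomputable def wireProd (wt : WordEdge ty w → ℂˣ) (p a : ℕ) : ℂˣ :=
  ∏ x : WireIdx ty w, if (x.1.1 : ℕ) = a ∧ letterAfter x.1.2 ≤ p then wt (.wire x) else 1

/-- The weight of the passage of the middle wire through a square. -/
noncomputable def passWeight (wt : WordEdge ty w → ℂˣ) (q : SquareIdx ty w) : ℂˣ :=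
  wt (.leftBottom q) * signPow (w q.1).pos (wt (.bottomRight q))

open Classical in
/-- The product of the weights of wire `a` in front of the letter number `p`, with the passages
through squares. -/
noncomputable def railProd (wt : WordEdge ty w → ℂˣ) (p a : ℕ) : ℂˣ :=
  wireProd wt p a * if a = k then
    ∏ q : SquareIdx ty w, (if (q.1 : ℕ) < p then passWeight wt q else 1) else 1

open Classical in
/-- The contribution of the letter number `p` to the weights of the faces in strip `r` that begin
in front of it. -/
noncomputable def cutFactor (wt : WordEdge ty w → ℂˣ) (r p : ℕ) : ℂˣ :=
  (∏ x : RungIdx ty w, if (x.1.2 : ℕ) = r ∧ (x.1.1 : ℕ) = p then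
      signPow (w x.1.1).pos (wt (.rung x)) else 1) *
    ∏ q : SquareIdx ty w, if (q.1 : ℕ) = p then
      (if r = k then (wt (.leftBottom q))⁻¹ else if r = k + 1 then wt (.leftTop q) else 1) else 1

open Classical in
theorem prod_wire_edgeFactor (hc : IsCut w ty r p) (hr : 1 ≤ r) (wt : WordEdge ty w → ℂˣ) :
    ∏ x : WireIdx ty w, edgeFactor (stripFaces r p) wt (.wire x) =
      wireProd wt p (r - 1) / wireProd wt p r := by
  unfold wireProd edgeFactor
  rw [Finset.prod_mul_distrib, div_eq_mul_inv, ← Finset.prod_inv_distrib]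
  congr 1
  · refine Finset.prod_congr rfl fun x _ => ?_
    have : (x.1.1.succ : ℕ) = r ↔ (x.1.1 : ℕ) = r - 1 := by rw [Fin.val_succ]; omega
    simp only [WordEdge.leftSide, lastFace_le_mem_stripFaces_iff hc, this]
  · refine Finset.prod_congr rfl fun x _ => ?_
    have : (x.1.1.castSucc : ℕ) = r ↔ (x.1.1 : ℕ) = r := by rw [Fin.val_castSucc]
    simp only [WordEdge.rightSide, lastFace_le_mem_stripFaces_iff hc, this]
    split_ifs <;> simp

theorem edgeFactor_rung (hc : IsCut w ty r p) (wt : WordEdge ty w → ℂˣ) (x : RungIdx ty w) :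
    edgeFactor (stripFaces r p) wt (.rung x) =
      if (x.1.2 : ℕ) = r ∧ (x.1.1 : ℕ) = p then signPow (w x.1.1).pos (wt (.rung x)) else 1 := by
  classical
  unfold edgeFactor
  simp only [WordEdge.leftSide, WordEdge.rightSide, signPow]
  by_cases hp : (w x.1.1).pos = true
  · simp only [hp, if_true, RungIdx.leftFace_mem_stripFaces_iff hc,
      RungIdx.rightFace_mem_stripFaces_iff]
    split_ifs <;> first | omega | simp
  · rw [Bool.not_eq_true] at hp
    simp only [hp, Bool.false_eq_true, if_false, RungIdx.leftFace_mem_stripFaces_iff hc,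
      RungIdx.rightFace_mem_stripFaces_iff]
    split_ifs <;> first | omega | simp

theorem edgeFactor_leftTop (hc : IsCut w ty r p) (wt : WordEdge ty w → ℂˣ) (q : SquareIdx ty w) :
    edgeFactor (stripFaces r p) wt (.leftTop q) =
      if r = k + 1 ∧ (q.1 : ℕ) ≤ p then wt (.leftTop q) else 1 := by
  classical
  have h : q.upper.leftFace ∈ stripFaces (ty := ty) (w := w) r p ↔ r = k + 1 ∧ (q.1 : ℕ) ≤ p :=
    (RungIdx.leftFace_mem_stripFaces_iff hc _).trans (and_congr_left fun _ => eq_comm)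
  unfold edgeFactor
  simp only [WordEdge.leftSide, WordEdge.rightSide, h, square_notMem_stripFaces, if_false, mul_one]

theorem edgeFactor_leftBottom (hc : IsCut w ty r p) (wt : WordEdge ty w → ℂˣ)
    (q : SquareIdx ty w) :
    edgeFactor (stripFaces r p) wt (.leftBottom q) =
      if r = k ∧ (q.1 : ℕ) ≤ p then (wt (.leftBottom q))⁻¹ else 1 := by
  classical
  have h : q.lower.leftFace ∈ stripFaces (ty := ty) (w := w) r p ↔ r = k ∧ (q.1 : ℕ) ≤ p :=
    (RungIdx.leftFace_mem_stripFaces_iff hc _).trans (and_congr_left fun _ => eq_comm)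
  unfold edgeFactor
  simp only [WordEdge.leftSide, WordEdge.rightSide, h, square_notMem_stripFaces, if_false, one_mul]

theorem edgeFactor_topRight (wt : WordEdge ty w → ℂˣ) (q : SquareIdx ty w) :
    edgeFactor (stripFaces r p) wt (.topRight q) =
      if r = k + 1 ∧ (q.1 : ℕ) < p then (signPow (w q.1).pos (wt (.topRight q)))⁻¹ else 1 := by
  classical
  have h : q.upper.rightFace ∈ stripFaces (ty := ty) (w := w) r p ↔ r = k + 1 ∧ (q.1 : ℕ) < p :=
    (RungIdx.rightFace_mem_stripFaces_iff _).trans (and_congr_left fun _ => eq_comm)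
  unfold edgeFactor
  by_cases hp : (w q.1).pos = true
  · simp only [WordEdge.leftSide, WordEdge.rightSide, h, square_notMem_stripFaces, if_false, one_mul,
      hp, if_true, signPow]
  · rw [Bool.not_eq_true] at hp
    simp only [WordEdge.leftSide, WordEdge.rightSide, h, square_notMem_stripFaces, if_false, mul_one,
      hp, signPow, inv_inv, Bool.false_eq_true]

theorem edgeFactor_bottomRight (wt : WordEdge ty w → ℂˣ) (q : SquareIdx ty w) :
    edgeFactor (stripFaces r p) wt (.bottomRight q) =
      if r = k ∧ (q.1 : ℕ) < p then (signPow (w q.1).pos (wt (.bottomRight q)))⁻¹ else 1 := by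
  classical
  have h : q.lower.rightFace ∈ stripFaces (ty := ty) (w := w) r p ↔ r = k ∧ (q.1 : ℕ) < p :=
    (RungIdx.rightFace_mem_stripFaces_iff _).trans (and_congr_left fun _ => eq_comm)
  unfold edgeFactor
  by_cases hp : (w q.1).pos = true
  · simp only [WordEdge.leftSide, WordEdge.rightSide, h, square_notMem_stripFaces, if_false, one_mul,
      hp, if_true, signPow]
  · rw [Bool.not_eq_true] at hp
    simp only [WordEdge.leftSide, WordEdge.rightSide, h, square_notMem_stripFaces, if_false, mul_one,
      hp, signPow, inv_inv, Bool.false_eq_true]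

theorem wordFaceWeight_square (wt : WordEdge ty w → ℂˣ) (q : SquareIdx ty w) :
    wordFaceWeight wt (.square q) =
      passWeight wt q * signPow (w q.1).pos (wt (.topRight q)) / wt (.leftTop q) := by
  classical
  have h := prod_wordFaceWeight {WordFace.square q} wt
  rw [Finset.prod_singleton] at h
  rw [h, prod_wordEdge, Finset.prod_eq_one, Finset.prod_eq_one, one_mul, one_mul,
    Finset.prod_eq_single q]
  · unfold edgeFactor passWeight
    by_cases hp : (w q.1).pos = true
    · simp only [WordEdge.leftSide, WordEdge.rightSide, hp, if_true, signPow]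
      simp [RungIdx.leftFace, RungIdx.rightFace, lastFace]
      simp only [div_eq_mul_inv, mul_comm, mul_left_comm, mul_assoc]
    · rw [Bool.not_eq_true] at hp
      simp only [WordEdge.leftSide, WordEdge.rightSide, hp, Bool.false_eq_true, if_false, signPow]
      simp [RungIdx.leftFace, RungIdx.rightFace, lastFace]
      simp only [div_eq_mul_inv, mul_comm, mul_left_comm, mul_assoc]
  · intro q' _ hq'
    unfold edgeFactor
    by_cases hp : (w q'.1).pos = true
    · simp only [WordEdge.leftSide, WordEdge.rightSide, hp, if_true]
      simp [RungIdx.leftFace, RungIdx.rightFace, lastFace, hq']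
    · rw [Bool.not_eq_true] at hp
      simp only [WordEdge.leftSide, WordEdge.rightSide, hp, Bool.false_eq_true, if_false]
      simp [RungIdx.leftFace, RungIdx.rightFace, lastFace, hq']
  · simp
  · intro x _
    unfold edgeFactor
    by_cases hp : (w x.1.1).pos = true
    · simp only [WordEdge.leftSide, WordEdge.rightSide, hp, if_true]
      simp [RungIdx.leftFace, RungIdx.rightFace, lastFace]
    · rw [Bool.not_eq_true] at hp
      simp only [WordEdge.leftSide, WordEdge.rightSide, hp, Bool.false_eq_true, if_false]
      simp [RungIdx.leftFace, RungIdx.rightFace, lastFace]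
  · intro x _
    simp [edgeFactor, WordEdge.leftSide, WordEdge.rightSide, lastFace]

/-- For a square of weight `1` the passages over its top and under its bottom have equal weight, so
one rail weight of the middle wire serves both neighbouring strips. For the square of the letter `p`
itself only a left side borders the faces considered. -/
theorem edgeFactor_sides (hc : IsCut w ty r p) (hr : 1 ≤ r) (wt : WordEdge ty w → ℂˣ)
    (q : SquareIdx ty w) (hq : wordFaceWeight wt (.square q) = 1) :
    edgeFactor (stripFaces r p) wt (.leftTop q) * edgeFactor (stripFaces r p) wt (.leftBottom q) *
      (edgeFactor (stripFaces r p) wt (.topRight q) *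
        edgeFactor (stripFaces r p) wt (.bottomRight q)) =
    (if r - 1 = k then (if (q.1 : ℕ) < p then passWeight wt q else 1) else 1) *
      (if r = k then (if (q.1 : ℕ) < p then passWeight wt q else 1) else 1)⁻¹ *
      if (q.1 : ℕ) = p then
        (if r = k then (wt (.leftBottom q))⁻¹ else if r = k + 1 then wt (.leftTop q) else 1)
      else 1 := by
  have hpass :
      passWeight wt q = wt (.leftTop q) * (signPow (w q.1).pos (wt (.topRight q)))⁻¹ := by
    rw [wordFaceWeight_square, div_eq_one] at hq
    rw [← hq, mul_inv_cancel_right]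
  simp only [edgeFactor_leftTop hc, edgeFactor_leftBottom hc, edgeFactor_topRight,
    edgeFactor_bottomRight]
  have hk : r - 1 = k ↔ r = k + 1 := by omega
  simp only [hk]
  by_cases h1 : r = k
  · have h2 : r ≠ k + 1 := by omega
    simp only [h1, true_and, if_true, passWeight]
    rw [h1] at h2
    simp only [h2, false_and, if_false, one_mul]
    rcases lt_trichotomy (q.1 : ℕ) p with h | h | h
    · simp [h, h.le, h.ne, mul_comm]
    · simp [h]
    · simp [h.not_gt, h.not_ge, h.ne']
  · by_cases h2 : r = k + 1
    · simp only [h2, true_and, if_true]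
      have h3 : k + 1 ≠ k := by omega
      simp only [h3, false_and, if_false, mul_one, inv_one]
      rcases lt_trichotomy (q.1 : ℕ) p with h | h | h
      · simp [h, h.le, h.ne, hpass]
      · simp [h]
      · simp [h.not_gt, h.not_ge, h.ne']
    · simp [h1, h2]

theorem prod_ite_const {ι M : Type*} [CommMonoid M] (s : Finset ι) (P : Prop) [Decidable P]
    (f : ι → M) : ∏ q ∈ s, (if P then f q else 1) = if P then ∏ q ∈ s, f q else 1 := by
  split_ifs
  · rfl
  · exact Finset.prod_const_one

theorem div_mul_mul_regroup {M : Type*} [CommGroup M] (A B C D D' F : M) :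
    A / B * C * (D * D'⁻¹ * F) = A * D / (B * D') * (C * F) := by
  rw [mul_div_mul_comm, div_eq_mul_inv D]
  ac_rfl

/-- The product of the weights of the faces of a strip in front of a cut. -/
theorem prod_stripFaces_wordFaceWeight (hc : IsCut w ty r p) (hr : 1 ≤ r)
    (wt : WordEdge ty w → ℂˣ) (hq : ∀ q, wordFaceWeight wt (.square q) = 1) :
    ∏ f ∈ stripFaces r p, wordFaceWeight wt f =
      railProd wt p (r - 1) / railProd wt p r * cutFactor wt r p := by
  classical
  rw [prod_wordFaceWeight, prod_wordEdge, prod_wire_edgeFactor hc hr,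
    Finset.prod_congr rfl fun q _ => edgeFactor_sides hc hr wt q (hq q),
    Finset.prod_congr rfl fun x _ => edgeFactor_rung hc wt x,
    Finset.prod_mul_distrib, Finset.prod_mul_distrib, Finset.prod_inv_distrib, prod_ite_const,
    prod_ite_const]
  exact div_mul_mul_regroup _ _ _ _ _ _

end FaceProducts

/-! ### Strip products in terms of Fock–Goncharov variables -/

section StripProducts

variable {k : ℕ} {ty : TypeBC} {m : ℕ} {w : Fin m → DoubleLetter k}

/-- The face of strip `r` at the left side of the rectangle. -/
def leftmostFace (r : Fin (ty.dim k + 1)) : StripIdx ty w := ⟨(r, ⊥), fun _ hp => by simp at hp⟩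

/-- The face to the right of a rung, as a place in its strip. -/
def RungIdx.next (x : RungIdx ty w) : StripIdx ty w :=
  ⟨(x.1.2, (x.1.1 : WithBot (Fin m))), fun p hp => by
    have : x.1.1 = p := WithBot.coe_injective hp
    subst this; exact x.2⟩

theorem StripIdx.eq_leftmostFace_or (x : StripIdx ty w) :
    x = leftmostFace x.1.1 ∨ ∃ y : RungIdx ty w, y.1.2 = x.1.1 ∧ x = y.next := by
  cases hs : x.1.2 with
  | bot => exact Or.inl (Subtype.ext (Prod.ext rfl hs))
  | coe p => exact Or.inr ⟨⟨(p, x.1.1), x.2 p hs⟩, rfl, Subtype.ext (Prod.ext rfl hs)⟩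

theorem stripFaces_zero {r : ℕ} (hr : r < ty.dim k + 1) :
    stripFaces (ty := ty) (w := w) r 0 = {.strip (leftmostFace ⟨r, hr⟩)} := by
  ext f
  rw [Finset.mem_singleton]
  cases f with
  | square q => exact iff_of_false (square_notMem_stripFaces r 0 q) (by simp)
  | strip x =>
    rw [strip_mem_stripFaces_iff, WordFace.strip.injEq]
    constructor
    · rintro ⟨h1, h2⟩
      rcases x.eq_leftmostFace_or with h | ⟨y, -, h⟩
      · rw [h]; congr 1; exact Fin.ext h1
      · rw [h] at h2; exact absurd h2 (by simp [RungIdx.next, letterAfter])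
    · rintro rfl; exact ⟨rfl, le_rfl⟩

theorem stripFaces_succ_of_rung (y : RungIdx ty w) {M : Type*} [CommMonoid M]
    (f : WordFace ty w → M) :
    ∏ x ∈ stripFaces y.1.2 (y.1.1 + 1), f x =
      (∏ x ∈ stripFaces (ty := ty) (w := w) y.1.2 y.1.1, f x) * f (.strip y.next) := by
  classical
  have h : stripFaces (ty := ty) (w := w) y.1.2 (y.1.1 + 1) =
      insert (.strip y.next) (stripFaces y.1.2 y.1.1) := by
    ext f
    rw [Finset.mem_insert]
    cases f with
    | square q =>
      exact iff_of_false (square_notMem_stripFaces _ _ q)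
        (by simpa using square_notMem_stripFaces _ _ q)
    | strip x =>
      rw [strip_mem_stripFaces_iff, strip_mem_stripFaces_iff, WordFace.strip.injEq]
      constructor
      · rintro ⟨h1, h2⟩
        rcases x.eq_leftmostFace_or with h | ⟨z, hz, h⟩
        · exact Or.inr ⟨h1, by rw [h]; exact Nat.zero_le _⟩
        · by_cases hzy : z.1.1 = y.1.1
          · left
            rw [h]; congr 1; exact Subtype.ext (Prod.ext hzy (hz.trans (Fin.ext h1)))
          · right
            refine ⟨h1, ?_⟩
            rw [h] at h2 ⊢
            have h3 : (z.1.1 : ℕ) + 1 ≤ y.1.1 + 1 := h2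
            have h4 : (z.1.1 : ℕ) ≠ y.1.1 := fun h => hzy (Fin.ext h)
            change (z.1.1 : ℕ) + 1 ≤ y.1.1
            omega
      · rintro (rfl | ⟨h1, h2⟩)
        · exact ⟨rfl, le_rfl⟩
        · exact ⟨h1, by omega⟩
  rw [h, Finset.prod_insert, mul_comm]
  rw [strip_mem_stripFaces_iff]
  rintro ⟨-, h2⟩
  have : (y.1.1 : ℕ) + 1 ≤ y.1.1 := h2
  omega

theorem stripFaces_succ_of_not_hasRung {r : ℕ} (p : Fin m) (h : ¬ HasRung ty (w p) r) :
    stripFaces (ty := ty) (w := w) r (p + 1) = stripFaces r p := by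
  ext f
  cases f with
  | square q => exact iff_of_false (square_notMem_stripFaces _ _ q) (square_notMem_stripFaces _ _ q)
  | strip x =>
    rw [strip_mem_stripFaces_iff, strip_mem_stripFaces_iff]
    refine and_congr_right fun hr => ⟨fun h2 => ?_, fun h2 => by omega⟩
    rcases x.eq_leftmostFace_or with hx | ⟨z, hz, hx⟩
    · rw [hx]; exact Nat.zero_le _
    · by_cases hzp : z.1.1 = p
      · exact absurd (hzp ▸ hr ▸ hz ▸ z.2) h
      · rw [hx] at h2 ⊢
        have h3 : (z.1.1 : ℕ) + 1 ≤ p + 1 := h2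
        have h4 : (z.1.1 : ℕ) ≠ p := fun h => hzp (Fin.ext h)
        change (z.1.1 : ℕ) + 1 ≤ p
        omega

open Classical in
/-- The variable attached to the places `x` of the strips. -/
noncomputable def stripVar (t : Fin k ⊕ Fin m → ℂˣ) (x : StripIdx ty w) : ℂˣ :=
  match x.1.2 with
  | ⊥ => if h : ∃ i : Fin k, (x.1.1 : ℕ) = i + 1 ∨ (x.1.1 : ℕ) + (i + 1) = ty.dim k then
      t (.inl h.choose) else 1
  | (p : Fin m) => t (.inr p)

theorem stripVar_leftmostFace (t : Fin k ⊕ Fin m → ℂˣ) (r : Fin (ty.dim k + 1)) (i : Fin k)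
    (hi : (r : ℕ) = i + 1 ∨ (r : ℕ) + (i + 1) = ty.dim k) :
    stripVar t (leftmostFace r : StripIdx ty w) = t (.inl i) := by
  have h : ∃ i : Fin k, (r : ℕ) = i + 1 ∨ (r : ℕ) + (i + 1) = ty.dim k := ⟨i, hi⟩
  have hd := ty.two_mul_le_dim k
  have : stripVar t (leftmostFace r : StripIdx ty w) = t (.inl h.choose) := dif_pos h
  rw [this]
  congr 2
  have h1 := h.choose_spec
  have h2 := h.choose.2
  have h3 := i.2
  apply Fin.ext
  omega

theorem stripVar_next (t : Fin k ⊕ Fin m → ℂˣ) (y : RungIdx ty w) :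
    stripVar t y.next = t (.inr y.1.1) := rfl

/-- The diagonal part of the Fock–Goncharov product in front of the letter number `p`. -/
noncomputable def canonDiag (w : Fin m → DoubleLetter k) (ty : TypeBC) (t : Fin k ⊕ Fin m → ℂˣ)
    (p : ℕ) (a : Fin (ty.dim k)) : ℂˣ :=
  torusDiag ty (fun i => t (.inl i)) a *
    ∏ q : Fin m, if (q : ℕ) < p then cocharDiag ty (w q).idx (t (.inr q)) a else 1

theorem canonDiag_zero (t : Fin k ⊕ Fin m → ℂˣ) (a : Fin (ty.dim k)) :
    canonDiag w ty t 0 a = torusDiag ty (fun i => t (.inl i)) a := by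
  simp [canonDiag]

theorem canonDiag_succ (t : Fin k ⊕ Fin m → ℂˣ) (p : Fin m) (a : Fin (ty.dim k)) :
    canonDiag w ty t (p + 1) a = canonDiag w ty t p a * cocharDiag ty (w p).idx (t (.inr p)) a := by
  unfold canonDiag
  rw [mul_assoc]
  congr 1
  rw [← Finset.mul_prod_erase _ _ (Finset.mem_univ p),
    ← Finset.mul_prod_erase Finset.univ (fun q : Fin m => if (q : ℕ) < p then _ else 1)
      (Finset.mem_univ p), if_pos (Nat.lt_succ_self _), if_neg (lt_irrefl _), one_mul, mul_comm]
  congr 1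
  refine Finset.prod_congr rfl fun q hq => ?_
  have : (q : ℕ) ≠ p := fun h => (Finset.mem_erase.mp hq).1 (Fin.ext h)
  have h2 : (q : ℕ) < p + 1 ↔ (q : ℕ) < p := by omega
  simp only [h2]

/-- A factor `Y_i` changes the ratio of the entries next to strip `b` by its variable exactly if the
letter `±i` has a rung in that strip, hence exactly if a new face of the strip begins behind it. -/
theorem prod_stripFaces_eq_canonDiag {φ : WordFace ty w → ℂˣ} (t : Fin k ⊕ Fin m → ℂˣ)
    (hφ : ∀ x, φ (.strip x) = stripVar t x) (p : ℕ) (hp : p ≤ m) (a b : Fin (ty.dim k))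
    (hab : (b : ℕ) = a + 1) :
    ∏ f ∈ stripFaces b p, φ f = canonDiag w ty t p a / canonDiag w ty t p b := by
  induction p with
  | zero =>
    obtain ⟨i, hi⟩ := exists_stripIndex ty (r := b) (by omega) b.2
    rw [stripFaces_zero (by omega), Finset.prod_singleton, hφ, canonDiag_zero, canonDiag_zero,
      torusDiag_div ty _ a b hab i hi, stripVar_leftmostFace t _ i hi]
  | succ p ih =>
    have h1 := canonDiag_succ (ty := ty) (w := w) t ⟨p, hp⟩
    have h2 : HasRung ty (w ⟨p, hp⟩) b ↔
        ((b : ℕ) = (w ⟨p, hp⟩).idx + 1 ∨ (b : ℕ) + ((w ⟨p, hp⟩).idx + 1) = ty.dim k) := Iff.rfl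
    simp only at h1
    rw [h1, h1, mul_div_mul_comm, cocharDiag_div ty _ _ a b hab, ← ih (by omega)]
    by_cases hr : HasRung ty (w ⟨p, hp⟩) b
    · rw [if_pos (h2.mp hr)]
      have := stripFaces_succ_of_rung (ty := ty) (w := w) ⟨(⟨p, hp⟩, b.castSucc), hr⟩ φ
      rw [hφ, stripVar_next] at this
      exact this
    · rw [if_neg fun h => hr (h2.mpr h), mul_one]
      rw [show stripFaces (ty := ty) (w := w) b (p + 1) = stripFaces b p from
        stripFaces_succ_of_not_hasRung ⟨p, hp⟩ hr]

/-- The unit `√2`. -/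
noncomputable def sqrtTwo : ℂˣ := Units.mk0 ((Real.sqrt 2 : ℝ) : ℂ) sqrt_two_ne_zero

open Classical in
/-- The factor by which the weight of a face in a move-symmetric weighting differs from the geometric
mean of the weights of the face and its mirror image. -/
noncomputable def faceScale (f : WordFace ty w) : ℂˣ :=
  ∏ q : SquareIdx ty w, ((if q.lower.leftFace = f then sqrtTwo else 1) *
    (if q.lower.rightFace = f then sqrtTwo⁻¹ else 1) *
    ((if q.upper.leftFace = f then sqrtTwo⁻¹ else 1) *
    (if q.upper.rightFace = f then sqrtTwo else 1)))

open Classical in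
/-- The product of the scaling factors of the faces of strip `r` in front of the letter
number `p`. -/
noncomputable def scaleFactor (w : Fin m → DoubleLetter k) (ty : TypeBC) (r p : ℕ) : ℂˣ :=
  ∏ q : SquareIdx ty w, if (q.1 : ℕ) = p then
    (if r = k then sqrtTwo else if r = k + 1 then sqrtTwo⁻¹ else 1) else 1

/-- The factors to the left and to the right of a rung are inverse to each other, so in front of a
cut only the factor of the cutting rung survives. -/
theorem prod_stripFaces_faceScale {r p : ℕ} (hc : IsCut w ty r p) :
    ∏ f ∈ stripFaces (ty := ty) (w := w) r p, faceScale f = scaleFactor w ty r p := by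
  classical
  unfold faceScale scaleFactor
  rw [Finset.prod_comm]
  refine Finset.prod_congr rfl fun q _ => ?_
  rw [Finset.prod_mul_distrib, Finset.prod_mul_distrib, Finset.prod_mul_distrib, Finset.prod_ite_eq,
    Finset.prod_ite_eq, Finset.prod_ite_eq, Finset.prod_ite_eq]
  simp only [RungIdx.leftFace_mem_stripFaces_iff hc, RungIdx.rightFace_mem_stripFaces_iff]
  have h1 : (q.lower.1.1 : ℕ) = q.1 := rfl
  have h2 : (q.upper.1.1 : ℕ) = q.1 := rfl
  have h3 : (q.lower.1.2 : ℕ) = k := rfl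
  have h4 : (q.upper.1.2 : ℕ) = k + 1 := rfl
  rw [h1, h2, h3, h4]
  split_ifs <;> first | omega | simp

/-- The relation between edge weights and Fock–Goncharov variables. -/
theorem railProd_div_mul_cutFactor {t : Fin k ⊕ Fin m → ℂˣ} {wt : WordEdge ty w → ℂˣ}
    (hsq : ∀ q, wordFaceWeight wt (.square q) = 1)
    (hst : ∀ x : StripIdx ty w, 1 ≤ (x.1.1 : ℕ) → (x.1.1 : ℕ) < ty.dim k →
      wordFaceWeight wt (.strip x) = faceScale (.strip x) * stripVar t x)
    {p : ℕ} (hp : p ≤ m) {a b : Fin (ty.dim k)} (hab : (b : ℕ) = a + 1) (hc : IsCut w ty b p) :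
    railProd wt p a / railProd wt p b * cutFactor wt b p =
      scaleFactor w ty b p * (canonDiag w ty t p a / canonDiag w ty t p b) := by
  have h1 := prod_stripFaces_wordFaceWeight hc (by omega) wt hsq
  rw [show (b : ℕ) - 1 = a by omega] at h1
  rw [← h1, ← prod_stripFaces_faceScale hc,
    ← prod_stripFaces_eq_canonDiag (φ := fun f => match f with
      | .strip x => stripVar t x
      | .square _ => 1) t (fun _ => rfl) p hp a b hab, ← Finset.prod_mul_distrib]
  refine Finset.prod_congr rfl fun f hf => ?_
  cases f with
  | square q => exact absurd hf (square_notMem_stripFaces _ _ q)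
  | strip x =>
    have h2 := ((strip_mem_stripFaces_iff _ _ x).mp hf).1
    exact hst x (by omega) (by have := b.2; omega)

theorem cutFactor_of_le (wt : WordEdge ty w → ℂˣ) (r : ℕ) {p : ℕ} (hp : m ≤ p) :
    cutFactor wt r p = 1 := by
  classical
  unfold cutFactor
  rw [Finset.prod_eq_one, Finset.prod_eq_one, one_mul]
  · exact fun q _ => if_neg (by have := q.1.2; omega)
  · exact fun x _ => if_neg (by have := x.1.1.2; omega)

theorem scaleFactor_of_le (r : ℕ) {p : ℕ} (hp : m ≤ p) : scaleFactor w ty r p = 1 := by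
  classical
  unfold scaleFactor
  exact Finset.prod_eq_one fun q _ => if_neg (by have := q.1.2; omega)

open Classical in
theorem prod_square_ite (f : SquareIdx ty w → ℂˣ) (p : Fin m) :
    (∏ q : SquareIdx ty w, if (q.1 : ℕ) = p then f q else 1) =
      if h : HasSquare ty (w p) then f ⟨p, h⟩ else 1 := by
  split_ifs with h
  · rw [Finset.prod_eq_single ⟨p, h⟩]
    · exact if_pos rfl
    · intro q _ hq
      exact if_neg fun h => hq (Subtype.ext (Fin.ext h))
    · simp
  · exact Finset.prod_eq_one fun q _ => if_neg fun hq => h (by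
      have : q.1 = p := Fin.ext hq
      exact this ▸ q.2)

open Classical in
theorem cutFactor_rung (wt : WordEdge ty w → ℂˣ) (x : RungIdx ty w) :
    cutFactor wt x.1.2 x.1.1 = signPow (w x.1.1).pos (wt (.rung x)) *
      if h : HasSquare ty (w x.1.1) then
        (if (x.1.2 : ℕ) = k then (wt (.leftBottom ⟨x.1.1, h⟩))⁻¹
          else if (x.1.2 : ℕ) = k + 1 then wt (.leftTop ⟨x.1.1, h⟩) else 1) else 1 := by
  unfold cutFactor
  rw [prod_square_ite (fun q => if (x.1.2 : ℕ) = k then (wt (.leftBottom q))⁻¹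
          else if (x.1.2 : ℕ) = k + 1 then wt (.leftTop q) else 1)]
  congr 1
  rw [Finset.prod_eq_single x]
  · exact if_pos ⟨rfl, rfl⟩
  · intro y _ hy
    exact if_neg fun h => hy (Subtype.ext (Prod.ext (Fin.ext h.2) (Fin.ext h.1)))
  · simp

open Classical in
theorem scaleFactor_rung (x : RungIdx ty w) :
    scaleFactor w ty x.1.2 x.1.1 = if HasSquare ty (w x.1.1) then
      (if (x.1.2 : ℕ) = k then sqrtTwo else if (x.1.2 : ℕ) = k + 1 then sqrtTwo⁻¹ else 1) else 1 := by
  unfold scaleFactor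
  rw [prod_square_ite (fun _ => if (x.1.2 : ℕ) = k then sqrtTwo else if (x.1.2 : ℕ) = k + 1
    then sqrtTwo⁻¹ else 1)]
  rfl

theorem isCut_rung (x : RungIdx ty w) : IsCut w ty x.1.2 x.1.1 := fun q hq => by
  have : q = x.1.1 := Fin.ext hq
  rw [this]; exact x.2

theorem isCut_last (r : ℕ) : IsCut w ty r m := fun q hq => absurd hq (by have := q.2; omega)

theorem wireProd_zero (wt : WordEdge ty w → ℂˣ) (a : Fin (ty.dim k)) :
    wireProd wt 0 a = wt (.wire (firstWire a)) := by
  classical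
  unfold wireProd
  rw [Finset.prod_eq_single (firstWire a)]
  · exact if_pos ⟨rfl, le_rfl⟩
  · rintro x - hx
    refine if_neg fun h => hx ?_
    cases hs : x.1.2 with
    | bot => exact Subtype.ext (Prod.ext (Fin.ext h.1) hs)
    | coe p =>
      rw [hs] at h
      have : (p : ℕ) + 1 ≤ 0 := h.2
      omega
  · simp

theorem railProd_zero (wt : WordEdge ty w → ℂˣ) (a : Fin (ty.dim k)) :
    railProd wt 0 a = wt (.wire (firstWire a)) := by
  classical
  unfold railProd
  rw [wireProd_zero]
  simp

open Classical in
theorem wireProd_succ (wt : WordEdge ty w → ℂˣ) (p : Fin m) (a : ℕ) :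
    wireProd wt (p + 1) a = wireProd wt p a *
      ∏ x : WireIdx ty w, if (x.1.1 : ℕ) = a ∧ x.1.2 = p then wt (.wire x) else 1 := by
  unfold wireProd
  rw [← Finset.prod_mul_distrib]
  refine Finset.prod_congr rfl fun x _ => ?_
  cases hs : x.1.2 with
  | bot => simp [letterAfter]
  | coe q =>
    have h1 : ∀ n, letterAfter (q : WithBot (Fin m)) ≤ n ↔ (q : ℕ) + 1 ≤ n := fun n => Iff.rfl
    simp only [h1, WithBot.coe_inj, Fin.ext_iff]
    split_ifs <;> first | omega | simp

open Classical in
theorem railProd_succ (wt : WordEdge ty w → ℂˣ) (p : Fin m) (a : ℕ) :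
    railProd wt (p + 1) a = railProd wt p a *
      (∏ x : WireIdx ty w, if (x.1.1 : ℕ) = a ∧ x.1.2 = p then wt (.wire x) else 1) *
      if h : HasSquare ty (w p) ∧ a = k then passWeight wt ⟨p, h.1⟩ else 1 := by
  unfold railProd
  rw [wireProd_succ]
  by_cases ha : a = k
  · have h1 : (∏ q : SquareIdx ty w, if (q.1 : ℕ) < p + 1 then passWeight wt q else 1) =
        (∏ q : SquareIdx ty w, if (q.1 : ℕ) < p then passWeight wt q else 1) *
          if h : HasSquare ty (w p) then passWeight wt ⟨p, h⟩ else 1 := by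
      rw [← prod_square_ite, ← Finset.prod_mul_distrib]
      refine Finset.prod_congr rfl fun q _ => ?_
      split_ifs <;> first | omega | simp
    rw [if_pos ha, if_pos ha, h1]
    by_cases hs : HasSquare ty (w p)
    · rw [dif_pos hs, dif_pos ⟨hs, ha⟩]; ac_rfl
    · rw [dif_neg hs, dif_neg fun h => hs h.1]; ac_rfl
  · rw [if_neg ha, if_neg ha, dif_neg fun h => ha h.2]
    simp only [mul_one]

open Classical in
theorem railProd_succ_of_wire (wt : WordEdge ty w → ℂˣ) (x : WireIdx ty w) (p : Fin m)
    (hx : x.1.2 = p) :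
    railProd wt (p + 1) x.1.1 = railProd wt p x.1.1 * wt (.wire x) *
      if h : HasSquare ty (w p) ∧ (x.1.1 : ℕ) = k then passWeight wt ⟨p, h.1⟩ else 1 := by
  rw [railProd_succ, Finset.prod_eq_single x, if_pos ⟨rfl, hx⟩]
  · intro y _ hy
    exact if_neg fun h => hy (Subtype.ext (Prod.ext (Fin.ext h.1) (h.2.trans hx.symm)))
  · simp

/-- A letter that does not touch the wire neither starts an edge on it nor has a square there. -/
theorem railProd_succ_of_not_touches (wt : WordEdge ty w → ℂˣ) (p : Fin m) (a : ℕ)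
    (h : ¬ Touches ty (w p) a) : railProd wt (p + 1) a = railProd wt p a := by
  classical
  rw [railProd_succ, Finset.prod_eq_one, dif_neg, mul_one, mul_one]
  · rintro ⟨h1, rfl⟩
    exact h (Or.inl h1.lowerRung)
  · refine fun x _ => if_neg ?_
    rintro ⟨h1, h2⟩
    exact h (h1 ▸ x.2 p h2)

end StripProducts

/-! ### Rows of the unipotent factors -/

section RowFormulas

/-- A function on `Fin n`, extended by zero. -/
noncomputable def extendZero {n : ℕ} (g : Fin n → ℂ) (a : ℕ) : ℂ := if h : a < n then g ⟨a, h⟩ else 0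

theorem extendZero_val {n : ℕ} (g : Fin n → ℂ) (a : Fin n) : extendZero g a = g a := dif_pos a.2

theorem sum_ite_val_eq {n : ℕ} (g : Fin n → ℂ) (c : ℕ) :
    (∑ b : Fin n, if (b : ℕ) = c then g b else 0) = extendZero g c := by
  unfold extendZero
  split_ifs with h
  · rw [Finset.sum_eq_single ⟨c, h⟩]
    · exact if_pos rfl
    · exact fun b _ hb => if_neg fun hbc => hb (Fin.ext hbc)
    · simp
  · exact Finset.sum_eq_zero fun b _ => if_neg (by have := b.2; omega)

variable {k : ℕ} {ty : TypeBC}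

theorem HasSquare.rootScale_eq {x : DoubleLetter k} (h : HasSquare ty x) :
    rootScale ty x.idx = ((Real.sqrt 2 : ℝ) : ℂ) := by
  obtain ⟨h1, h2⟩ := h
  subst h1
  have : ¬ (x.idx : ℕ) + 1 < k := by
    have : (x.idx : ℕ) + 1 = k := h2
    omega
  simp [rootScale, this]

theorem rootScale_of_not_hasSquare {x : DoubleLetter k} (h : ¬ HasSquare ty x) :
    rootScale ty x.idx = 1 := by
  cases ty with
  | C => rfl
  | B =>
    have h1 : ¬ (x.idx : ℕ) + 1 = k := fun h1 => h ⟨rfl, h1⟩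
    have h2 := x.idx.2
    simp only [rootScale]
    rw [if_pos (by omega)]

theorem hasSquare_iff {x : DoubleLetter k} :
    HasSquare ty x ↔ 2 * ((x.idx : ℕ) + 1) + 1 = ty.dim k := by
  have h2 := x.idx.2
  unfold HasSquare DoubleLetter.abs
  cases ty
  · have hB : TypeBC.B.dim k = 2 * k + 1 := rfl
    simp only [true_and]; omega
  · have hC : TypeBC.C.dim k = 2 * k := rfl
    simp only [reduceCtorEq, false_and, false_iff]; omega

open Classical in
-- Next to the diagonal entry, a row of `exp E_i` has at most one entry on the first superdiagonal
-- and, in front of a square, one on the second. Extension by zero makes the formula uniform at the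
-- last rows.
theorem sum_rootElement_pos_mul {x : DoubleLetter k} (hx : x.pos = true)
    (g : Fin (ty.dim k) → ℂ) (a : Fin (ty.dim k)) :
    ∑ b, (rootElement ty x 1 : Matrix (Fin (ty.dim k)) (Fin (ty.dim k)) ℂ) a b * g b =
      g a + (if HasRung ty x (a + 1) then rootScale ty x.idx else 0) * extendZero g (a + 1) +
        (if HasSquare ty x ∧ (a : ℕ) + 1 = k then 1 else 0) * extendZero g (a + 2) := by
  obtain ⟨i, s⟩ := x
  simp only at hx
  subst hx
  have h2 := i.2
  have hsq : (HasSquare ty (⟨i, true⟩ : DoubleLetter k) ∧ (a : ℕ) + 1 = k) ↔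
      ((a : ℕ) = i ∧ (a : ℕ) + 2 + (i + 1) = ty.dim k) := by
    have h3 := ty.two_mul_le_dim k
    have h4 := ty.dim_le k
    rw [hasSquare_iff]; simp only; omega
  have hr : HasRung ty (⟨i, true⟩ : DoubleLetter k) (a + 1) ↔
      ((a : ℕ) + 1 = i + 1 ∨ (a : ℕ) + 1 + (i + 1) = ty.dim k) := Iff.rfl
  rw [← extendZero_val g a, ← sum_ite_val_eq, ← sum_ite_val_eq, ← sum_ite_val_eq, Finset.mul_sum,
    Finset.mul_sum, ← Finset.sum_add_distrib, ← Finset.sum_add_distrib]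
  refine Finset.sum_congr rfl fun b _ => ?_
  rw [rootElement_pos_apply]
  simp only [hsq, hr, Fin.ext_iff, one_mul, one_pow]
  split_ifs <;> first | omega | simp

open Classical in
theorem sum_rootElement_neg_mul {x : DoubleLetter k} (hx : x.pos = false)
    (g : Fin (ty.dim k) → ℂ) (a : Fin (ty.dim k)) :
    ∑ b, (rootElement ty x 1 : Matrix (Fin (ty.dim k)) (Fin (ty.dim k)) ℂ) a b * g b =
      g a + (if HasRung ty x a then rootScale ty x.idx else 0) * extendZero g (a - 1) +
        (if HasSquare ty x ∧ (a : ℕ) = k + 1 then 1 else 0) * extendZero g (a - 2) := by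
  obtain ⟨i, s⟩ := x
  simp only at hx
  subst hx
  have h2 := i.2
  have ha := a.2
  have h3 := ty.two_mul_le_dim k
  have h4 := ty.dim_le k
  have hsq : (HasSquare ty (⟨i, false⟩ : DoubleLetter k) ∧ (a : ℕ) = k + 1) ↔
      ((a : ℕ) = i + 2 ∧ (a : ℕ) + (i + 1) = ty.dim k) := by
    rw [hasSquare_iff]; simp only; omega
  have hr : HasRung ty (⟨i, false⟩ : DoubleLetter k) a ↔
      ((a : ℕ) = i + 1 ∨ (a : ℕ) + (i + 1) = ty.dim k) := Iff.rfl
  rw [← extendZero_val g a, ← sum_ite_val_eq, ← sum_ite_val_eq, ← sum_ite_val_eq, Finset.mul_sum,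
    Finset.mul_sum, ← Finset.sum_add_distrib, ← Finset.sum_add_distrib]
  refine Finset.sum_congr rfl fun b _ => ?_
  rw [rootElement_neg_apply, rootElement_pos_apply]
  simp only [hsq, hr, Fin.ext_iff, one_mul, one_pow]
  split_ifs <;> first | omega | simp

end RowFormulas

/-! ### Rows of the partial Fock–Goncharov products -/

section Potential

variable {k : ℕ} {ty : TypeBC} {m : ℕ} {w : Fin m → DoubleLetter k}

/-- The factors of the Fock–Goncharov product. -/
noncomputable def letterGL (w : Fin m → DoubleLetter k) (ty : TypeBC) (t : Fin k ⊕ Fin m → ℂˣ)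
    (p : Fin m) : GL (Fin (ty.dim k)) ℂ :=
  rootElement ty (w p) 1 * diagGL (cocharDiag ty (w p).idx (t (.inr p)))

/-- The product of the factors from the letter number `p` on. -/
noncomputable def tailGL (w : Fin m → DoubleLetter k) (ty : TypeBC) (t : Fin k ⊕ Fin m → ℂˣ)
    (p : ℕ) : GL (Fin (ty.dim k)) ℂ :=
  ((List.ofFn (letterGL w ty t)).drop p).prod

theorem tailGL_last (t : Fin k ⊕ Fin m → ℂˣ) : tailGL w ty t m = 1 := by
  rw [tailGL, List.drop_eq_nil_of_le (by simp), List.prod_nil]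

theorem tailGL_eq (t : Fin k ⊕ Fin m → ℂˣ) (p : Fin m) :
    tailGL w ty t p = letterGL w ty t p * tailGL w ty t (p + 1) := by
  rw [tailGL, List.drop_eq_getElem_cons (by simp), List.prod_cons, tailGL]
  simp

theorem fockGoncharov_eq_mk (t : Fin k ⊕ Fin m → ℂˣ) :
    fockGoncharov ty w t =
      Matrix.ProjGenLinGroup.mk (diagGL (torusDiag ty fun i => t (.inl i)) * tailGL w ty t 0) := by
  rw [fockGoncharov, prod_cocharacterY, map_mul, tailGL, List.drop_zero, map_list_prod,
    List.map_ofFn]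
  congr 3
  funext p
  simp only [Function.comp, letterGL, map_mul, letterX_eq]
  rw [show (w p).abs = (w p).idx + 1 from rfl, cocharacterY_eq]

/-- The ratio of the actual weights of the wires and the weights in the Fock–Goncharov product. -/
noncomputable def wireGauge (wt : WordEdge ty w → ℂˣ) (t : Fin k ⊕ Fin m → ℂˣ) (p : ℕ)
    (a : Fin (ty.dim k)) : ℂˣ :=
  railProd wt p a / canonDiag w ty t p a

/-- The rows of the Fock–Goncharov product in front of a letter. -/
noncomputable def rowBefore (w : Fin m → DoubleLetter k) (ty : TypeBC) (t : Fin k ⊕ Fin m → ℂˣ)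
    (j : Fin (ty.dim k)) (p : ℕ) (a : Fin (ty.dim k)) : ℂ :=
  (tailGL w ty t p : Matrix (Fin (ty.dim k)) (Fin (ty.dim k)) ℂ) a j

/-- The rows of the Fock–Goncharov product behind a unipotent factor. -/
noncomputable def rowAfter (w : Fin m → DoubleLetter k) (ty : TypeBC) (t : Fin k ⊕ Fin m → ℂˣ)
    (j : Fin (ty.dim k)) (p : Fin m) (a : Fin (ty.dim k)) : ℂ :=
  cocharDiag ty (w p).idx (t (.inr p)) a * rowBefore w ty t j (p + 1) a

variable (t : Fin k ⊕ Fin m → ℂˣ) (j : Fin (ty.dim k))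

theorem rowBefore_eq_sum (p : Fin m) (a : Fin (ty.dim k)) :
    rowBefore w ty t j p a =
      ∑ b, (rootElement ty (w p) 1 : Matrix (Fin (ty.dim k)) (Fin (ty.dim k)) ℂ) a b *
        rowAfter w ty t j p b := by
  rw [rowBefore, tailGL_eq, letterGL, mul_assoc, Units.val_mul, Matrix.mul_apply]
  refine Finset.sum_congr rfl fun b _ => ?_
  rw [Units.val_mul, diagGL_val, Matrix.diagonal_mul]
  rfl

theorem rowBefore_of_pos (p : Fin m) (hp : (w p).pos = true) (a : Fin (ty.dim k))
    (ha : ¬ HasRung ty (w p) (a + 1)) : rowBefore w ty t j p a = rowAfter w ty t j p a := by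
  classical
  rw [rowBefore_eq_sum, sum_rootElement_pos_mul hp, if_neg ha, if_neg, zero_mul, zero_mul, add_zero,
    add_zero]
  rintro ⟨h1, h2⟩
  exact ha ((h1.hasRung_iff _).mpr (Or.inl h2))

theorem rowBefore_of_neg (p : Fin m) (hp : (w p).pos = false) (a : Fin (ty.dim k))
    (ha : ¬ HasRung ty (w p) a) : rowBefore w ty t j p a = rowAfter w ty t j p a := by
  classical
  rw [rowBefore_eq_sum, sum_rootElement_neg_mul hp, if_neg ha, if_neg, zero_mul, zero_mul, add_zero,
    add_zero]
  rintro ⟨h1, h2⟩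
  exact ha ((h1.hasRung_iff _).mpr (Or.inr h2))

theorem rowBefore_of_pos_of_hasRung (p : Fin m) (hp : (w p).pos = true)
    (hs : ¬ HasSquare ty (w p)) (a b : Fin (ty.dim k)) (hab : (b : ℕ) = a + 1)
    (ha : HasRung ty (w p) b) :
    rowBefore w ty t j p a = rowAfter w ty t j p a + rowAfter w ty t j p b := by
  classical
  rw [rowBefore_eq_sum, sum_rootElement_pos_mul hp, ← hab, if_pos ha, if_neg fun h => hs h.1,
    rootScale_of_not_hasSquare hs, zero_mul, add_zero, one_mul, extendZero_val]

theorem rowBefore_of_neg_of_hasRung (p : Fin m) (hp : (w p).pos = false)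
    (hs : ¬ HasSquare ty (w p)) (a b : Fin (ty.dim k)) (hab : (b : ℕ) = a + 1)
    (ha : HasRung ty (w p) b) :
    rowBefore w ty t j p b = rowAfter w ty t j p b + rowAfter w ty t j p a := by
  classical
  rw [rowBefore_eq_sum, sum_rootElement_neg_mul hp, if_pos ha, if_neg fun h => hs h.1,
    rootScale_of_not_hasSquare hs, zero_mul, add_zero, one_mul, show (b : ℕ) - 1 = a by omega,
    extendZero_val]

/-- The block of `exp E_k` in type `B` on the three middle coordinates is upper unitriangular with
entries `√2`, `√2` next to the diagonal and `1` in the corner. -/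
theorem rowBefore_of_pos_of_hasSquare (p : Fin m) (hp : (w p).pos = true)
    (hs : HasSquare ty (w p)) (a b c : Fin (ty.dim k)) (ha : (a : ℕ) + 1 = k) (hb : (b : ℕ) = k)
    (hc : (c : ℕ) = k + 1) :
    rowBefore w ty t j p a = rowAfter w ty t j p a + sqrtTwo * rowAfter w ty t j p b +
      rowAfter w ty t j p c ∧
    rowBefore w ty t j p b = rowAfter w ty t j p b + sqrtTwo * rowAfter w ty t j p c ∧
    rowBefore w ty t j p c = rowAfter w ty t j p c := by
  classical
  refine ⟨?_, ?_, rowBefore_of_pos t j p hp c fun h => ?_⟩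
  · rw [rowBefore_eq_sum, sum_rootElement_pos_mul hp, hs.rootScale_eq,
      if_pos ((hs.hasRung_iff _).mpr (Or.inl ha)), if_pos ⟨hs, ha⟩,
      show (a : ℕ) + 1 = b by omega, show (a : ℕ) + 2 = c by omega, extendZero_val, extendZero_val,
      one_mul]
    rfl
  · rw [rowBefore_eq_sum, sum_rootElement_pos_mul hp, hs.rootScale_eq,
      if_pos ((hs.hasRung_iff _).mpr (Or.inr (by omega))), if_neg (by omega),
      show (b : ℕ) + 1 = c by omega, extendZero_val, zero_mul, add_zero]
    rfl
  · have := (hs.hasRung_iff _).mp h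
    omega

theorem rowBefore_of_neg_of_hasSquare (p : Fin m) (hp : (w p).pos = false)
    (hs : HasSquare ty (w p)) (a b c : Fin (ty.dim k)) (ha : (a : ℕ) + 1 = k) (hb : (b : ℕ) = k)
    (hc : (c : ℕ) = k + 1) :
    rowBefore w ty t j p c = rowAfter w ty t j p c + sqrtTwo * rowAfter w ty t j p b +
      rowAfter w ty t j p a ∧
    rowBefore w ty t j p b = rowAfter w ty t j p b + sqrtTwo * rowAfter w ty t j p a ∧
    rowBefore w ty t j p a = rowAfter w ty t j p a := by
  classical
  refine ⟨?_, ?_, rowBefore_of_neg t j p hp a fun h => ?_⟩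
  · rw [rowBefore_eq_sum, sum_rootElement_neg_mul hp, hs.rootScale_eq,
      if_pos ((hs.hasRung_iff _).mpr (Or.inr hc)), if_pos ⟨hs, hc⟩,
      show (c : ℕ) - 1 = b by omega, show (c : ℕ) - 2 = a by omega, extendZero_val, extendZero_val,
      one_mul]
    rfl
  · rw [rowBefore_eq_sum, sum_rootElement_neg_mul hp, hs.rootScale_eq,
      if_pos ((hs.hasRung_iff _).mpr (Or.inl hb)), if_neg (by omega),
      show (b : ℕ) - 1 = a by omega, extendZero_val, zero_mul, add_zero]
    rfl
  · have := (hs.hasRung_iff _).mp h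
    omega

end Potential

/-! ### The gauge between path sums and rows -/

section PotentialOfWeights

variable {k : ℕ} {ty : TypeBC} {m : ℕ} {w : Fin m → DoubleLetter k}

/-- The identity behind the squares. Here `l₁`, `l₂` are the weights from the left vertex, `r₁`,
`r₂` those at the right vertex, and `c₁`, `c₂` those of the rungs. By `h3` the two paths from the
middle wire to the far wire have equal weight, and by `h2` each contributes `1/s` relative to the
gauge; since `s * s = 2` they add up to `s`. Coming from the near wire one finds `s` for the middle
wire and `s * (1/s) = 1` for the far one. -/
theorem square_transfer {s da db dc l₁ l₂ r₁ r₂ c₁ c₂ ga gb gc u : ℂ} (ha : da ≠ 0) (hb : db ≠ 0)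
    (hc : dc ≠ 0) (hl₁ : l₁ ≠ 0) (hr₁ : r₁ ≠ 0) (hs : s * s = 2) (h1 : da * c₁ = s * db * l₁)
    (h2 : s * db * c₂ * l₂ = dc) (h3 : l₂ = l₁ * r₁ * r₂) :
    db⁻¹ * (gb + s * gc) * u = l₂ * (c₂ * (dc⁻¹ * gc * u)) +
      l₁ * (r₁ * (db⁻¹ * (l₁ * r₁)⁻¹ * gb * u + r₂ * (c₂ * (dc⁻¹ * gc * u)))) ∧
    da⁻¹ * (ga + s * gb + gc) * u = da⁻¹ * ga * u +
      c₁ * (r₁ * (db⁻¹ * (l₁ * r₁)⁻¹ * gb * u + r₂ * (c₂ * (dc⁻¹ * gc * u)))) := by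
  have hs0 : s ≠ 0 := by rintro rfl; norm_num at hs
  subst h3
  have hr₂ : r₂ ≠ 0 := by rintro rfl; apply hc; rw [← h2]; ring
  have e2 : c₂ = dc / (s * db * (l₁ * r₁ * r₂)) := by
    rw [eq_div_iff (by positivity)]; linear_combination h2
  have e1 : c₁ = s * db * l₁ / da := by rw [eq_div_iff ha]; linear_combination h1
  subst e1 e2
  constructor
  · field_simp
    linear_combination u * gc * hs
  · field_simp
    ring

variable (wt : WordEdge ty w → ℂˣ) (t : Fin k ⊕ Fin m → ℂˣ) (j : Fin (ty.dim k))

/-- The potential in front of the letters. -/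
noncomputable def potentialBefore (p a : ℕ) : ℂ :=
  extendZero (fun a => (wireGauge wt t p a : ℂ)⁻¹ * rowBefore w ty t j p a * wireGauge wt t m j) a

open Classical in
/-- The weight of the passage of a wire through a letter. -/
noncomputable def passFactor (p : Fin m) (a : Fin (ty.dim k)) : ℂˣ :=
  if h : HasSquare ty (w p) ∧ (a : ℕ) = k then passWeight wt ⟨p, h.1⟩ else 1

/-- The potential behind the letters. -/
noncomputable def potentialAfter (p : Fin m) (a : ℕ) : ℂ :=
  extendZero (fun a => (wireGauge wt t p a : ℂ)⁻¹ * (passFactor wt p a : ℂ)⁻¹ *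
    rowAfter w ty t j p a * wireGauge wt t m j) a

open Classical in
/-- The potential at the top vertices of the squares. -/
noncomputable def potentialTop (p : Fin m) : ℂ :=
  if h : HasSquare ty (w p) then
    if (w p).pos then wt (.rung (SquareIdx.upper ⟨p, h⟩)) * potentialBefore wt t j p (k + 1)
    else wt (.topRight ⟨p, h⟩) * (potentialAfter wt t j p k + wt (.bottomRight ⟨p, h⟩) *
      (wt (.rung (SquareIdx.lower ⟨p, h⟩)) * potentialBefore wt t j p (k - 1)))
  else 0

open Classical in
/-- The potential at the bottom vertices of the squares. -/
noncomputable def potentialBot (p : Fin m) : ℂ :=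
  if h : HasSquare ty (w p) then
    if (w p).pos then wt (.bottomRight ⟨p, h⟩) * (potentialAfter wt t j p k + wt (.topRight ⟨p, h⟩) *
      (wt (.rung (SquareIdx.upper ⟨p, h⟩)) * potentialBefore wt t j p (k + 1)))
    else wt (.rung (SquareIdx.lower ⟨p, h⟩)) * potentialBefore wt t j p (k - 1)
  else 0

open Classical in
/-- The potential at the right vertices of the squares. -/
noncomputable def potentialRight (p : Fin m) : ℂ :=
  if h : HasSquare ty (w p) then
    if (w p).pos then potentialAfter wt t j p k + wt (.topRight ⟨p, h⟩) *
      (wt (.rung (SquareIdx.upper ⟨p, h⟩)) * potentialBefore wt t j p (k + 1))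
    else potentialAfter wt t j p k + wt (.bottomRight ⟨p, h⟩) *
      (wt (.rung (SquareIdx.lower ⟨p, h⟩)) * potentialBefore wt t j p (k - 1))
  else 0

variable {wt t}

/-- A reformulation of `railProd_div_mul_cutFactor`: the gauges of two neighbouring wires at a rung
differ by the weight of the rung, so that after the gauge an ordinary rung has weight `1`, the entry
of the Chevalley generator. -/
theorem wireGauge_rung
    (hsq : ∀ q, wordFaceWeight wt (.square q) = 1)
    (hst : ∀ x : StripIdx ty w, 1 ≤ (x.1.1 : ℕ) → (x.1.1 : ℕ) < ty.dim k →
      wordFaceWeight wt (.strip x) = faceScale (.strip x) * stripVar t x)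
    {p : ℕ} (hp : p ≤ m) {a b : Fin (ty.dim k)} (hab : (b : ℕ) = a + 1) (hc : IsCut w ty b p) :
    wireGauge wt t p a * cutFactor wt b p = scaleFactor w ty b p * wireGauge wt t p b := by
  have h := railProd_div_mul_cutFactor hsq hst hp hab hc
  unfold wireGauge
  rw [div_mul_eq_mul_div, div_eq_iff_eq_mul] at h
  rw [div_mul_eq_mul_div, h, div_eq_iff_eq_mul]
  simp only [div_eq_mul_inv]
  ac_rfl

theorem wireGauge_of_not_touches (p : Fin m) (a : Fin (ty.dim k)) (ht : ¬ Touches ty (w p) a) :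
    wireGauge wt t p a = wireGauge wt t (p + 1) a * cocharDiag ty (w p).idx (t (.inr p)) a := by
  unfold wireGauge
  rw [railProd_succ_of_not_touches wt p a ht, canonDiag_succ, div_mul_eq_mul_div,
    mul_div_mul_right_eq_div]

theorem wireGauge_of_wire (x : WireIdx ty w) (p : Fin m) (hx : x.1.2 = p) :
    wireGauge wt t (p + 1) x.1.1 * cocharDiag ty (w p).idx (t (.inr p)) x.1.1 =
      wireGauge wt t p x.1.1 * wt (.wire x) * passFactor wt p x.1.1 := by
  unfold wireGauge passFactor
  rw [railProd_succ_of_wire wt x p hx, canonDiag_succ, div_mul_eq_mul_div, mul_div_mul_right_eq_div,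
    div_mul_eq_mul_div, div_mul_eq_mul_div]

/-- Behind the last letter there are neither rungs nor scaling factors left. The gauge is then the
same on all wires, which is why the boundary matrix and the Fock–Goncharov product differ by a
scalar only. -/
theorem wireGauge_last
    (hsq : ∀ q, wordFaceWeight wt (.square q) = 1)
    (hst : ∀ x : StripIdx ty w, 1 ≤ (x.1.1 : ℕ) → (x.1.1 : ℕ) < ty.dim k →
      wordFaceWeight wt (.strip x) = faceScale (.strip x) * stripVar t x)
    (a b : Fin (ty.dim k)) : wireGauge wt t m a = wireGauge wt t m b := by
  have key : ∀ (c : ℕ) (hc : c < ty.dim k), wireGauge wt t m ⟨c, hc⟩ =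
      wireGauge wt t m ⟨0, by omega⟩ := by
    intro c
    induction c with
    | zero => intro _; rfl
    | succ c ih =>
      intro hc
      have h := wireGauge_rung hsq hst le_rfl (a := ⟨c, by omega⟩) (b := ⟨c + 1, hc⟩) rfl (isCut_last _)
      rw [cutFactor_of_le wt _ le_rfl, scaleFactor_of_le _ le_rfl, mul_one, one_mul] at h
      rw [← h, ih (by omega)]
  rw [key a a.2, key b b.2]

theorem potentialBefore_eq (p : ℕ) {a : ℕ} (ha : a < ty.dim k) :
    potentialBefore wt t j p a =
      (wireGauge wt t p ⟨a, ha⟩ : ℂ)⁻¹ * rowBefore w ty t j p ⟨a, ha⟩ * wireGauge wt t m j :=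
  dif_pos ha

theorem potentialAfter_eq (p : Fin m) {a : ℕ} (ha : a < ty.dim k)
    (h : ¬ (HasSquare ty (w p) ∧ a = k)) :
    potentialAfter wt t j p a =
      (wireGauge wt t p ⟨a, ha⟩ : ℂ)⁻¹ * rowAfter w ty t j p ⟨a, ha⟩ * wireGauge wt t m j := by
  unfold potentialAfter
  rw [extendZero, dif_pos ha, passFactor, dif_neg h, Units.val_one, inv_one, mul_one]

theorem potentialAfter_square (p : SquareIdx ty w) (ha : k < ty.dim k) :
    potentialAfter wt t j p.1 k =
      (wireGauge wt t p.1 ⟨k, ha⟩ : ℂ)⁻¹ * (passWeight wt p : ℂ)⁻¹ * rowAfter w ty t j p.1 ⟨k, ha⟩ *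
        wireGauge wt t m j := by
  unfold potentialAfter
  rw [extendZero, dif_pos ha, passFactor, dif_pos ⟨p.2, rfl⟩]

theorem wireGauge_lower
    (hsq : ∀ q, wordFaceWeight wt (.square q) = 1)
    (hst : ∀ x : StripIdx ty w, 1 ≤ (x.1.1 : ℕ) → (x.1.1 : ℕ) < ty.dim k →
      wordFaceWeight wt (.strip x) = faceScale (.strip x) * stripVar t x)
    (p : SquareIdx ty w) {a b : Fin (ty.dim k)} (ha : (a : ℕ) + 1 = k)
    (hb : (b : ℕ) = k) :
    wireGauge wt t p.1 a * signPow (w p.1).pos (wt (.rung p.lower)) =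
      sqrtTwo * wireGauge wt t p.1 b * wt (.leftBottom p) := by
  classical
  have hs : HasSquare ty (w p.lower.1.1) := p.2
  have h := wireGauge_rung hsq hst (p := p.1) p.1.2.le (a := a) (b := b) (by omega)
    (by rw [hb]; exact isCut_rung p.lower)
  rw [hb, show cutFactor wt k p.1 = _ from cutFactor_rung wt p.lower,
    show scaleFactor w ty k p.1 = _ from scaleFactor_rung p.lower, dif_pos hs, if_pos hs,
    if_pos (show (p.lower.1.2 : ℕ) = k from rfl), if_pos (show (p.lower.1.2 : ℕ) = k from rfl),
    ← mul_assoc, mul_inv_eq_iff_eq_mul] at h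
  exact h

theorem wireGauge_upper
    (hsq : ∀ q, wordFaceWeight wt (.square q) = 1)
    (hst : ∀ x : StripIdx ty w, 1 ≤ (x.1.1 : ℕ) → (x.1.1 : ℕ) < ty.dim k →
      wordFaceWeight wt (.strip x) = faceScale (.strip x) * stripVar t x)
    (p : SquareIdx ty w) {a b : Fin (ty.dim k)} (ha : (a : ℕ) = k)
    (hb : (b : ℕ) = k + 1) :
    sqrtTwo * wireGauge wt t p.1 a * signPow (w p.1).pos (wt (.rung p.upper)) * wt (.leftTop p) =
      wireGauge wt t p.1 b := by
  classical
  have h := wireGauge_rung hsq hst (p := p.1) p.1.2.le (a := a) (b := b) (by omega)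
    (by rw [hb]; exact isCut_rung p.upper)
  have hs : HasSquare ty (w p.upper.1.1) := p.2
  have hk : ((p.upper.1.2 : ℕ) = k) = False := eq_false (Nat.succ_ne_self k)
  have hk' : ((p.upper.1.2 : ℕ) = k + 1) = True := eq_true rfl
  rw [hb, show cutFactor wt (k + 1) p.1 = _ from cutFactor_rung wt p.upper,
    show scaleFactor w ty (k + 1) p.1 = _ from scaleFactor_rung p.upper, dif_pos hs, if_pos hs] at h
  simp only [hk, hk', if_true, if_false] at h
  rw [← mul_assoc, eq_inv_mul_iff_mul_eq, ← mul_assoc, ← mul_assoc] at h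
  exact h

/-- The values at the top, bottom and right vertices are defined by the recursion itself; what has
to be checked are the values on the middle and lower wires, and these are the two equations of
`square_transfer`. -/
theorem potential_square_pos
    (hsq : ∀ q, wordFaceWeight wt (.square q) = 1)
    (hst : ∀ x : StripIdx ty w, 1 ≤ (x.1.1 : ℕ) → (x.1.1 : ℕ) < ty.dim k →
      wordFaceWeight wt (.strip x) = faceScale (.strip x) * stripVar t x)
    (p : SquareIdx ty w) (hp : (w p.1).pos = true) :
    potentialBefore wt t j p.1 k = wt (.leftTop p) * potentialTop wt t j p.1 +
      wt (.leftBottom p) * potentialBot wt t j p.1 ∧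
    potentialTop wt t j p.1 = wt (.rung p.upper) * potentialBefore wt t j p.1 (k + 1) ∧
    potentialBot wt t j p.1 = wt (.bottomRight p) * potentialRight wt t j p.1 ∧
    potentialRight wt t j p.1 =
      potentialAfter wt t j p.1 k + wt (.topRight p) * potentialTop wt t j p.1 ∧
    potentialBefore wt t j p.1 (k - 1) =
      potentialAfter wt t j p.1 (k - 1) + wt (.rung p.lower) * potentialBot wt t j p.1 ∧
    potentialBefore wt t j p.1 (k + 1) = potentialAfter wt t j p.1 (k + 1) := by
  have hd := p.2.dim_eq
  have hk0 := (w p.1).idx.2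
  have hT : potentialTop wt t j p.1 = _ := (dif_pos p.2).trans (if_pos hp)
  have hB : potentialBot wt t j p.1 = _ := (dif_pos p.2).trans (if_pos hp)
  have hR : potentialRight wt t j p.1 = _ := (dif_pos p.2).trans (if_pos hp)
  have ha : k - 1 < ty.dim k := by omega
  have hb : k < ty.dim k := by omega
  have hc : k + 1 < ty.dim k := by omega
  have h1 := congrArg Units.val (wireGauge_lower hsq hst p (a := ⟨k - 1, ha⟩) (b := ⟨k, hb⟩)
    (Nat.sub_add_cancel (by omega)) rfl)
  have h2 := congrArg Units.val (wireGauge_upper hsq hst p (a := ⟨k, hb⟩) (b := ⟨k + 1, hc⟩) rfl rfl)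
  have h3 := congrArg Units.val (div_eq_one.mp ((wordFaceWeight_square wt p).symm.trans (hsq p)))
  simp only [passWeight, signPow, hp, if_true, Units.val_mul] at h1 h2 h3
  obtain ⟨r1, r2, r3⟩ := rowBefore_of_pos_of_hasSquare t j p.1 hp p.2 ⟨k - 1, ha⟩ ⟨k, hb⟩ ⟨k + 1, hc⟩
    (Nat.sub_add_cancel (by omega)) rfl rfl
  obtain ⟨e1, e2⟩ := square_transfer (ga := rowAfter w ty t j p.1 ⟨k - 1, ha⟩)
    (gb := rowAfter w ty t j p.1 ⟨k, hb⟩) (gc := rowAfter w ty t j p.1 ⟨k + 1, hc⟩)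
    (u := wireGauge wt t m j) (Units.ne_zero _) (Units.ne_zero _)
    (Units.ne_zero _) (Units.ne_zero _) (Units.ne_zero (wt (.bottomRight p))) sqrt_two_mul_self h1 h2 h3.symm
  rw [hB, hR, hT]
  rw [potentialBefore_eq j _ ha, potentialBefore_eq j _ hb, potentialBefore_eq j _ hc,
    potentialAfter_eq j _ ha (fun h => by omega), potentialAfter_eq j _ hc (fun h => by omega),
    potentialAfter_square j p hb, r1, r2, r3, passWeight, hp, signPow, if_pos rfl, Units.val_mul]
  exact ⟨e1, rfl, rfl, rfl, e2, rfl⟩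

/-- The positive case turned upside down: `square_transfer` is applied with the upper and lower
rungs, and the top and bottom sides, interchanged. -/
theorem potential_square_neg
    (hsq : ∀ q, wordFaceWeight wt (.square q) = 1)
    (hst : ∀ x : StripIdx ty w, 1 ≤ (x.1.1 : ℕ) → (x.1.1 : ℕ) < ty.dim k →
      wordFaceWeight wt (.strip x) = faceScale (.strip x) * stripVar t x)
    (p : SquareIdx ty w) (hp : (w p.1).pos = false) :
    potentialBefore wt t j p.1 k = wt (.leftTop p) * potentialTop wt t j p.1 +
      wt (.leftBottom p) * potentialBot wt t j p.1 ∧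
    potentialBot wt t j p.1 = wt (.rung p.lower) * potentialBefore wt t j p.1 (k - 1) ∧
    potentialTop wt t j p.1 = wt (.topRight p) * potentialRight wt t j p.1 ∧
    potentialRight wt t j p.1 =
      potentialAfter wt t j p.1 k + wt (.bottomRight p) * potentialBot wt t j p.1 ∧
    potentialBefore wt t j p.1 (k + 1) =
      potentialAfter wt t j p.1 (k + 1) + wt (.rung p.upper) * potentialTop wt t j p.1 ∧
    potentialBefore wt t j p.1 (k - 1) = potentialAfter wt t j p.1 (k - 1) := by
  have hd := p.2.dim_eq
  have hk0 := (w p.1).idx.2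
  have hp' : ¬ (w p.1).pos = true := by rw [hp]; exact Bool.false_ne_true
  have hT : potentialTop wt t j p.1 = _ := (dif_pos p.2).trans (if_neg hp')
  have hB : potentialBot wt t j p.1 = _ := (dif_pos p.2).trans (if_neg hp')
  have hR : potentialRight wt t j p.1 = _ := (dif_pos p.2).trans (if_neg hp')
  have ha : k - 1 < ty.dim k := by omega
  have hb : k < ty.dim k := by omega
  have hc : k + 1 < ty.dim k := by omega
  have g1 := wireGauge_lower hsq hst p (a := ⟨k - 1, ha⟩) (b := ⟨k, hb⟩)
    (Nat.sub_add_cancel (by omega)) rfl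
  have g2 := wireGauge_upper hsq hst p (a := ⟨k, hb⟩) (b := ⟨k + 1, hc⟩) rfl rfl
  have g3 := div_eq_one.mp ((wordFaceWeight_square wt p).symm.trans (hsq p))
  have g4 : passWeight wt p = wt (.leftTop p) * wt (.topRight p) := by
    rw [← g3, hp]; simp only [signPow, Bool.false_eq_true, if_false, inv_mul_cancel_right]
  simp only [passWeight, signPow, hp, Bool.false_eq_true, if_false] at g1 g2 g3
  rw [mul_inv_eq_iff_eq_mul] at g1 g3
  rw [mul_inv_eq_iff_eq_mul] at g3
  rw [mul_right_comm, mul_inv_eq_iff_eq_mul] at g2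
  have h1 := congrArg Units.val g2.symm
  have h2 : (sqrtTwo : ℂ) * wireGauge wt t p.1 ⟨k, hb⟩ * wt (.rung p.lower) * wt (.leftBottom p) =
      wireGauge wt t p.1 ⟨k - 1, ha⟩ := by
    rw [mul_right_comm]; exact congrArg Units.val g1.symm
  have h3 := congrArg Units.val g3
  obtain ⟨r1, r2, r3⟩ := rowBefore_of_neg_of_hasSquare t j p.1 hp p.2 ⟨k - 1, ha⟩ ⟨k, hb⟩ ⟨k + 1, hc⟩
    (Nat.sub_add_cancel (by omega)) rfl rfl
  simp only [Units.val_mul] at h1 h3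
  obtain ⟨e1, e2⟩ := square_transfer (ga := rowAfter w ty t j p.1 ⟨k + 1, hc⟩)
    (gb := rowAfter w ty t j p.1 ⟨k, hb⟩) (gc := rowAfter w ty t j p.1 ⟨k - 1, ha⟩)
    (u := wireGauge wt t m j) (Units.ne_zero _) (Units.ne_zero _)
    (Units.ne_zero _) (Units.ne_zero _) (Units.ne_zero (wt (.topRight p))) sqrt_two_mul_self h1 h2 h3
  rw [hT, hR, hB]
  rw [potentialBefore_eq j _ ha, potentialBefore_eq j _ hb, potentialBefore_eq j _ hc,
    potentialAfter_eq j _ ha (fun h => by omega), potentialAfter_eq j _ hc (fun h => by omega),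
    potentialAfter_square j p hb, r1, r2, r3, g4, Units.val_mul]
  exact ⟨e1.trans (add_comm _ _), rfl, rfl, rfl, e2, rfl⟩

/-- Passing a letter multiplies the rows by its unipotent and diagonal factors. The gauge converts
the diagonal factors into weights of horizontal edges and the unipotent entries into weights of
rungs and squares. -/
theorem isPathPotential
    (hsq : ∀ q, wordFaceWeight wt (.square q) = 1)
    (hst : ∀ x : StripIdx ty w, 1 ≤ (x.1.1 : ℕ) → (x.1.1 : ℕ) < ty.dim k →
      wordFaceWeight wt (.strip x) = faceScale (.strip x) * stripVar t x) :
    IsPathPotential wt j (potentialBefore wt t j) (potentialAfter wt t j) (potentialTop wt t j)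
      (potentialBot wt t j) (potentialRight wt t j) where
  terminal a := by
    rw [potentialBefore_eq j m a.2, rowBefore, tailGL_last, Units.val_one, Matrix.one_apply]
    split_ifs with h
    · subst h; simp
    · simp
  skip p a ht := by
    have h1 : rowBefore w ty t j p a = rowAfter w ty t j p a := by
      cases hp : (w p).pos with
      | true => exact rowBefore_of_pos t j p hp a fun h => ht (Or.inr h)
      | false => exact rowBefore_of_neg t j p hp a fun h => ht (Or.inl h)
    have h2 := congrArg Units.val (wireGauge_of_not_touches (wt := wt) (t := t) p a ht)
    rw [Units.val_mul] at h2
    rw [potentialBefore_eq j p a.2, potentialBefore_eq j (p + 1) a.2]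
    simp only [Fin.eta]
    rw [h1, rowAfter, h2]
    field_simp
  wire x p hx := by
    have h := congrArg Units.val (wireGauge_of_wire (wt := wt) (t := t) x p hx)
    simp only [Units.val_mul] at h
    rw [potentialBefore_eq j (p + 1) x.1.1.2, potentialAfter, extendZero_val, rowAfter]
    simp only [Fin.eta]
    field_simp
    linear_combination rowBefore w ty t j (p + 1) x.1.1 * h
  pos x hns hp := by
    classical
    have hb := x.2.bounds
    have h := wireGauge_rung hsq hst (p := x.1.1) x.1.1.2.le (a := ⟨x.1.2 - 1, by omega⟩)
      (b := ⟨x.1.2, hb.2⟩) (by simp only []; omega) (isCut_rung x)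
    rw [show cutFactor wt (⟨x.1.2, hb.2⟩ : Fin (ty.dim k)) x.1.1 = _ from cutFactor_rung wt x,
      show scaleFactor w ty (⟨x.1.2, hb.2⟩ : Fin (ty.dim k)) x.1.1 = _ from scaleFactor_rung x,
      dif_neg hns, if_neg hns, mul_one, one_mul, hp] at h
    have h' := congrArg Units.val h
    simp only [signPow, if_true, Units.val_mul] at h'
    have hr : rowBefore w ty t j x.1.1 ⟨x.1.2, hb.2⟩ = rowAfter w ty t j x.1.1 ⟨x.1.2, hb.2⟩ :=
      rowBefore_of_pos t j x.1.1 hp _ fun h => hns (x.2.hasSquare h).1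
    rw [potentialBefore_eq j _ hb.2, potentialBefore_eq j _ (show (x.1.2 : ℕ) - 1 < _ by omega),
      potentialAfter_eq j _ hb.2 fun h => hns h.1,
      potentialAfter_eq j _ (show (x.1.2 : ℕ) - 1 < _ by omega) fun h => hns h.1, hr,
      rowBefore_of_pos_of_hasRung t j x.1.1 hp hns ⟨x.1.2 - 1, by omega⟩ ⟨x.1.2, hb.2⟩
        (by simp only []; omega) x.2, ← h']
    refine ⟨?_, rfl⟩
    field_simp
  neg x hns hp := by
    classical
    have hb := x.2.bounds
    have h := wireGauge_rung hsq hst (p := x.1.1) x.1.1.2.le (a := ⟨x.1.2 - 1, by omega⟩)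
      (b := ⟨x.1.2, hb.2⟩) (by simp only []; omega) (isCut_rung x)
    rw [show cutFactor wt (⟨x.1.2, hb.2⟩ : Fin (ty.dim k)) x.1.1 = _ from cutFactor_rung wt x,
      show scaleFactor w ty (⟨x.1.2, hb.2⟩ : Fin (ty.dim k)) x.1.1 = _ from scaleFactor_rung x,
      dif_neg hns, if_neg hns, mul_one, one_mul, hp] at h
    simp only [signPow, Bool.false_eq_true, if_false] at h
    rw [mul_inv_eq_iff_eq_mul] at h
    have h' := congrArg Units.val h
    simp only [Units.val_mul] at h'
    have hr : rowBefore w ty t j x.1.1 ⟨x.1.2 - 1, by omega⟩ =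
        rowAfter w ty t j x.1.1 ⟨x.1.2 - 1, by omega⟩ :=
      rowBefore_of_neg t j x.1.1 hp _ fun h => hns (h.hasSquare (by
        rw [show (x.1.2 : ℕ) - 1 + 1 = x.1.2 by omega]; exact x.2)).1
    rw [potentialBefore_eq j _ hb.2, potentialBefore_eq j _ (show (x.1.2 : ℕ) - 1 < _ by omega),
      potentialAfter_eq j _ hb.2 fun h => hns h.1,
      potentialAfter_eq j _ (show (x.1.2 : ℕ) - 1 < _ by omega) fun h => hns h.1, hr,
      rowBefore_of_neg_of_hasRung t j x.1.1 hp hns ⟨x.1.2 - 1, by omega⟩ ⟨x.1.2, hb.2⟩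
        (by simp only []; omega) x.2, h']
    refine ⟨?_, rfl⟩
    field_simp
  square p := by
    cases hp : (w p.1).pos with
    | true => exact (potential_square_pos j hsq hst p hp).1
    | false => exact (potential_square_neg j hsq hst p hp).1
  square_pos p hp := (potential_square_pos j hsq hst p hp).2
  square_neg p hp := (potential_square_neg j hsq hst p hp).2

end PotentialOfWeights

/-! ### Boundary measurements, and edge weights with given face weights -/

section Measurement

variable {k : ℕ} {ty : TypeBC} {m : ℕ} {w : Fin m → DoubleLetter k}

/-- At the left side the gauge is the weight of the first edge divided by the torus entry, so
multiplying by the weight of that edge leaves the torus entry. -/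
theorem boundaryMatrix_wordOrientation {wt : WordEdge ty w → ℂˣ} {t : Fin k ⊕ Fin m → ℂˣ}
    (hsq : ∀ q, wordFaceWeight wt (.square q) = 1)
    (hst : ∀ x : StripIdx ty w, 1 ≤ (x.1.1 : ℕ) → (x.1.1 : ℕ) < ty.dim k →
      wordFaceWeight wt (.strip x) = faceScale (.strip x) * stripVar t x)
    (i j : Fin (ty.dim k)) :
    PlabicGraph.boundaryMatrix (Γ := wordGraph ty w) (wordOrientation ty w) wt i j =
      torusDiag ty (fun i => t (.inl i)) i * rowBefore w ty t j 0 i * wireGauge wt t m j := by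
  rw [(isPathPotential j hsq hst).boundaryMatrix_eq i, potentialBefore_eq j 0 i.2]
  simp only [Fin.eta, wireGauge, railProd_zero, canonDiag_zero]
  push_cast
  field_simp

theorem exists_boundaryMatrix_eq (hk : 0 < ty.dim k) {wt : WordEdge ty w → ℂˣ}
    {t : Fin k ⊕ Fin m → ℂˣ} (hsq : ∀ q, wordFaceWeight wt (.square q) = 1)
    (hst : ∀ x : StripIdx ty w, 1 ≤ (x.1.1 : ℕ) → (x.1.1 : ℕ) < ty.dim k →
      wordFaceWeight wt (.strip x) = faceScale (.strip x) * stripVar t x) :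
    ∃ A : GL (Fin (ty.dim k)) ℂ, (A : Matrix (Fin (ty.dim k)) (Fin (ty.dim k)) ℂ) =
      PlabicGraph.boundaryMatrix (Γ := wordGraph ty w) (wordOrientation ty w) wt ∧
        Matrix.ProjGenLinGroup.mk A = fockGoncharov ty w t := by
  refine ⟨diagGL (torusDiag ty fun i => t (.inl i)) * tailGL w ty t 0 *
    Matrix.GeneralLinearGroup.scalar _ (wireGauge wt t m ⟨0, hk⟩), ?_, ?_⟩
  · ext i j
    rw [boundaryMatrix_wordOrientation hsq hst, wireGauge_last hsq hst j ⟨0, hk⟩, Units.val_mul,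
      Units.val_mul, diagGL_val, Matrix.GeneralLinearGroup.coe_scalar, Matrix.scalar_apply,
      Matrix.mul_diagonal, Matrix.diagonal_mul]
    rfl
  · rw [fockGoncharov_eq_mk, map_mul _ (diagGL _ * tailGL _ _ _ _),
      Matrix.ProjGenLinGroup.mk_scalar, mul_one]

theorem wordHeight_tailOf_lt_headOf (e : WordEdge ty w) :
    wordHeight (PlabicGraph.tailOf (Γ := wordGraph ty w) (wordOrientation ty w) e) <
      wordHeight (PlabicGraph.headOf (Γ := wordGraph ty w) (wordOrientation ty w) e) :=
  ((congrArg wordHeight (tailOf_wordOrientation e)).trans_lt (wordHeight_start_lt_finish e)).trans_eq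
    (congrArg wordHeight (headOf_wordOrientation e).symm)

/-- Faces in a strip are determined by the products of their weights in front of the rungs. -/
theorem eq_of_prod_stripFaces_eq {φ ψ : WordFace ty w → ℂˣ} {r : ℕ}
    (h : ∀ p ≤ m, IsCut w ty r p → ∏ f ∈ stripFaces r p, φ f = ∏ f ∈ stripFaces r p, ψ f)
    (x : StripIdx ty w) (hx : (x.1.1 : ℕ) = r) : φ (.strip x) = ψ (.strip x) := by
  -- Go downwards from the end of the word: if `p` is not a cut, no face of the strip begins at it,
  -- and the products in front of `p` and `p + 1` coincide. Quotients of successive products then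
  -- isolate single faces.
  have key : ∀ d p : ℕ, p + d = m → ∏ f ∈ stripFaces r p, φ f = ∏ f ∈ stripFaces r p, ψ f := by
    intro d
    induction d with
    | zero => intro p hp; obtain rfl : p = m := hp; exact h p le_rfl (isCut_last r)
    | succ d ih =>
      intro p hp
      by_cases hr : HasRung ty (w ⟨p, by omega⟩) r
      · exact h p (by omega) fun q hq => by
          rw [show q = ⟨p, by omega⟩ from Fin.ext hq]; exact hr
      · have := ih (p + 1) (by omega)
        rwa [stripFaces_succ_of_not_hasRung ⟨p, by omega⟩ hr] at this
  subst hx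
  rcases x.eq_leftmostFace_or with hx | ⟨y, hy, hx⟩
  · have := key m 0 (by omega)
    rw [stripFaces_zero x.1.1.2, Finset.prod_singleton, Finset.prod_singleton] at this
    rw [hx]; exact this
  · have h1 := key (m - y.1.1) y.1.1 (by omega)
    have h2 := key (m - (y.1.1 + 1)) (y.1.1 + 1) (by omega)
    rw [← hy, stripFaces_succ_of_rung, stripFaces_succ_of_rung] at h2
    rw [← hy] at h1
    rw [h1] at h2
    rw [hx]; exact mul_left_cancel h2

/-- The weights of the first edges of the wires, in the edge weights that induce `φ`. -/
noncomputable def wireLevel (φ : WordFace ty w → ℂˣ) (a : ℕ) : ℂˣ :=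
  ∏ r ∈ Finset.range a, (∏ f ∈ stripFaces (ty := ty) (w := w) (r + 1) m, φ f)⁻¹

open Classical in
/-- Edge weights that induce the face weights `φ`. -/
noncomputable def edgeWeightOf (φ : WordFace ty w → ℂˣ) : WordEdge ty w → ℂˣ
  | .wire x => if x.1.2 = ⊥ then wireLevel φ x.1.1 else 1
  | .rung x => signPow (w x.1.1).pos ((∏ f ∈ stripFaces x.1.2 x.1.1, φ f) *
      (wireLevel φ x.1.2 / wireLevel φ (x.1.2 - 1)))
  | _ => 1

theorem signPow_signPow (s : Bool) (c : ℂˣ) : signPow s (signPow s c) = c := by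
  cases s <;> simp [signPow]

theorem signPow_one (s : Bool) : signPow s 1 = 1 := by cases s <;> simp [signPow]

/-- In this choice of weights only the first edge of each wire and the rungs are non-trivial, so
rail products do not depend on `p`. -/
theorem railProd_edgeWeightOf (φ : WordFace ty w → ℂˣ) {p : ℕ} (hp : p ≤ m) (a : Fin (ty.dim k)) :
    railProd (edgeWeightOf φ) p a = wireLevel φ a := by
  classical
  induction p with
  | zero => rw [railProd_zero, edgeWeightOf, if_pos (show (firstWire a : WireIdx ty w).1.2 = ⊥ from rfl)]; rfl
  | succ p ih =>
    rw [show p + 1 = ((⟨p, hp⟩ : Fin m) : ℕ) + 1 from rfl, railProd_succ, ih (by omega),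
      Finset.prod_eq_one, mul_one]
    · split_ifs
      · rw [passWeight, show edgeWeightOf φ (.leftBottom _) = 1 from rfl,
          show edgeWeightOf φ (.bottomRight _) = 1 from rfl, signPow_one, mul_one, mul_one]
      · exact mul_one _
    · intro x _
      split_ifs with h
      · exact if_neg (by rw [h.2]; exact WithBot.coe_ne_bot)
      · rfl

theorem wordFaceWeight_edgeWeightOf_square (φ : WordFace ty w → ℂˣ) (q : SquareIdx ty w) :
    wordFaceWeight (edgeWeightOf φ) (.square q) = 1 := by
  rw [wordFaceWeight_square, passWeight, show edgeWeightOf φ (.leftBottom _) = 1 from rfl,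
    show edgeWeightOf φ (.bottomRight _) = 1 from rfl, show edgeWeightOf φ (.leftTop _) = 1 from rfl,
    show edgeWeightOf φ (.topRight _) = 1 from rfl, signPow_one, mul_one, mul_one, div_one]

theorem wordFaceWeight_edgeWeightOf_strip (φ : WordFace ty w → ℂˣ) (x : StripIdx ty w)
    (h1 : 1 ≤ (x.1.1 : ℕ)) (h2 : (x.1.1 : ℕ) < ty.dim k) :
    wordFaceWeight (edgeWeightOf φ) (.strip x) = φ (.strip x) := by
  classical
  refine eq_of_prod_stripFaces_eq (ψ := φ) (φ := wordFaceWeight (edgeWeightOf φ)) (r := x.1.1)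
    (fun p hp hc => ?_) x rfl
  rw [prod_stripFaces_wordFaceWeight hc h1 _ (wordFaceWeight_edgeWeightOf_square φ)]
  have e1 := railProd_edgeWeightOf φ hp ⟨x.1.1 - 1, by omega⟩
  have e2 := railProd_edgeWeightOf φ hp ⟨x.1.1, h2⟩
  simp only at e1 e2
  rw [e1, e2]
  rcases hp.lt_or_eq with hp | rfl
  -- The rung at the cut was given the weight that corrects the strip product in front of it.
  · have hr := hc ⟨p, hp⟩ rfl
    have h3 := cutFactor_rung (edgeWeightOf φ) ⟨(⟨p, hp⟩, x.1.1), hr⟩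
    simp only at h3
    rw [h3, edgeWeightOf, signPow_signPow]
    simp only
    rw [show (if h : HasSquare ty (w ⟨p, hp⟩) then _ else (1 : ℂˣ)) = 1 from ?_, mul_one]
    · rw [mul_comm, mul_assoc, div_mul_div_cancel, div_self', mul_one]
    · split_ifs <;> simp [edgeWeightOf]
  -- At the end no rung is available for a correction; the ratio of the levels of the two wires was
  -- chosen to be the total product of the strip.
  · rw [cutFactor_of_le _ _ le_rfl, mul_one]
    obtain ⟨r, hr⟩ : ∃ r, (x.1.1 : ℕ) = r + 1 := ⟨x.1.1 - 1, by omega⟩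
    rw [hr, Nat.add_sub_cancel]
    unfold wireLevel
    rw [Finset.prod_range_succ, div_mul_cancel_left, inv_inv]

end Measurement

/-! ### Square moves, the reflection and scaling factors -/

section MoveSymmetry

variable {k : ℕ} {ty : TypeBC} {m : ℕ} {w : Fin m → DoubleLetter k}

theorem top_eq : (wordGraph ty w).top = .strip (leftmostFace (Fin.last _)) := by
  show lastFace _ _ = _
  simp [lastFace, leftmostFace]

theorem bot_eq : (wordGraph ty w).bot = .strip (leftmostFace 0) := by
  show lastFace _ _ = _
  simp [lastFace, leftmostFace]

theorem StripIdx.eq_leftmostFace_of_forall_not_hasRung {x : StripIdx ty w}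
    (h : ∀ p, ¬ HasRung ty (w p) x.1.1) : x = leftmostFace x.1.1 := by
  rcases x.eq_leftmostFace_or with hx | ⟨y, hy, -⟩
  · exact hx
  · exact absurd y.2 (by rw [hy]; exact h _)

theorem strip_eq_top_iff (x : StripIdx ty w) :
    WordFace.strip x = (wordGraph ty w).top ↔ (x.1.1 : ℕ) = ty.dim k := by
  rw [top_eq]
  constructor
  · intro h
    rw [WordFace.strip.inj h]; rfl
  · intro h
    rw [StripIdx.eq_leftmostFace_of_forall_not_hasRung (x := x) fun p hp => by
      have := hp.bounds; omega]
    rw [show x.1.1 = Fin.last _ from Fin.ext h]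

theorem strip_eq_bot_iff (x : StripIdx ty w) :
    WordFace.strip x = (wordGraph ty w).bot ↔ (x.1.1 : ℕ) = 0 := by
  rw [bot_eq]
  constructor
  · intro h
    rw [WordFace.strip.inj h]; rfl
  · intro h
    rw [StripIdx.eq_leftmostFace_of_forall_not_hasRung (x := x) fun p hp => by
      have := hp.bounds; omega]
    rw [show x.1.1 = 0 from Fin.ext h]

/-- No letter has a rung in the two outer strips, so each consists of a single face, the uppermost
or the lowermost one. -/
theorem strip_ne_top_bot_iff (x : StripIdx ty w) :
    (WordFace.strip x ≠ (wordGraph ty w).top ∧ WordFace.strip x ≠ (wordGraph ty w).bot) ↔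
      1 ≤ (x.1.1 : ℕ) ∧ (x.1.1 : ℕ) < ty.dim k := by
  have := x.1.1.2
  exact (and_congr (not_congr (strip_eq_top_iff x)) (not_congr (strip_eq_bot_iff x))).trans (by omega)

theorem square_ne_top_bot (q : SquareIdx ty w) :
    WordFace.square q ≠ (wordGraph ty w).top ∧ WordFace.square q ≠ (wordGraph ty w).bot := by
  rw [top_eq, bot_eq]
  exact ⟨nofun, nofun⟩

theorem reflect_lastFace (r : Fin (ty.dim k + 1)) (P : Fin m → Prop) :
    (lastFace r P : WordFace ty w).reflect = lastFace r.rev P := by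
  classical
  have h : ∀ q : Fin m, HasRung ty (w q) r.rev ↔ HasRung ty (w q) r := fun q =>
    ⟨fun h => by have := h.rev; rwa [Fin.rev_rev] at this, fun h => h.rev⟩
  simp only [lastFace, WordFace.reflect, h]

theorem WordFace.reflect_reflect (f : WordFace ty w) : f.reflect.reflect = f := by
  cases f with
  | strip x => simp [WordFace.reflect]
  | square q => rfl

theorem reflect_leftFace_lower (q : SquareIdx ty w) : q.lower.leftFace.reflect = q.upper.leftFace := by
  have hd := q.2.dim_eq
  unfold RungIdx.leftFace
  rw [reflect_lastFace, show q.lower.1.2.rev = q.upper.1.2 from Fin.ext (by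
    rw [Fin.val_rev]; simp only [SquareIdx.lower, SquareIdx.upper]; omega)]
  rfl

theorem reflect_rightFace_lower (q : SquareIdx ty w) :
    q.lower.rightFace.reflect = q.upper.rightFace := by
  have hd := q.2.dim_eq
  have h : q.lower.1.2.rev = q.upper.1.2 := Fin.ext (by
    rw [Fin.val_rev]; simp only [SquareIdx.lower, SquareIdx.upper]; omega)
  simp only [RungIdx.rightFace, WordFace.reflect, h]
  rfl

theorem reflect_eq_iff {f g : WordFace ty w} : g.reflect = f ↔ g = f.reflect :=
  ⟨fun h => by rw [← h, WordFace.reflect_reflect], fun h => by rw [h, WordFace.reflect_reflect]⟩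

/-- The reflection interchanges the faces next to the lower and the upper rung of each square, and
these carry inverse powers of `√2`. -/
theorem faceScale_reflect (f : WordFace ty w) : faceScale f.reflect = (faceScale f)⁻¹ := by
  classical
  unfold faceScale
  rw [← Finset.prod_inv_distrib]
  refine Finset.prod_congr rfl fun q _ => ?_
  simp only [← reflect_eq_iff, ← reflect_leftFace_lower, ← reflect_rightFace_lower,
    WordFace.reflect_reflect]
  simp only [mul_inv, apply_ite (·⁻¹), inv_one, inv_inv]
  ac_rfl

theorem exists_pos_faceScale_eq (f : WordFace ty w) : ∃ r : ℝ, 0 < r ∧ (faceScale f : ℂ) = r := by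
  classical
  let H : Submonoid ℂˣ :=
    { carrier := {u | ∃ r : ℝ, 0 < r ∧ (u : ℂ) = r}
      one_mem' := ⟨1, one_pos, by simp⟩
      mul_mem' := fun {a b} ⟨r, hr, ha⟩ ⟨s, hs, hb⟩ =>
        ⟨r * s, mul_pos hr hs, by push_cast; rw [ha, hb]⟩ }
  have h2 : sqrtTwo ∈ H := ⟨Real.sqrt 2, by positivity, rfl⟩
  have h3 : sqrtTwo⁻¹ ∈ H := ⟨(Real.sqrt 2)⁻¹, by positivity, by push_cast; rfl⟩
  have hite : ∀ (c : Prop) [Decidable c] (a : ℂˣ), a ∈ H → (if c then a else 1) ∈ H := by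
    intro c _ a ha
    split_ifs
    exacts [ha, H.one_mem]
  exact H.prod_mem fun q _ => H.mul_mem (H.mul_mem (hite _ _ h2) (hite _ _ h3))
    (H.mul_mem (hite _ _ h3) (hite _ _ h2))

open Classical in
/-- The extension of a projective weighting to all faces by `1`. -/
noncomputable def fullWeight (Y : (wordGraph ty w).ProjWeighting) (f : WordFace ty w) : ℂˣ :=
  if h : f ≠ (wordGraph ty w).top ∧ f ≠ (wordGraph ty w).bot then Y ⟨f, h⟩ else 1

theorem extend_eq_fullWeight (Y : (wordGraph ty w).ProjWeighting) (f : WordFace ty w) :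
    PlabicGraph.extend Y f = fullWeight Y f := by
  by_cases h : f ≠ (wordGraph ty w).top ∧ f ≠ (wordGraph ty w).bot
  · have h1 : fullWeight Y f = Y ⟨f, h⟩ := dif_pos h
    rw [h1]; exact dif_pos h
  · have h1 : fullWeight Y f = 1 := dif_neg h
    rw [h1]; exact dif_neg h

theorem fullWeight_of_proj (Y : (wordGraph ty w).ProjWeighting) (f : (wordGraph ty w).ProjFace) :
    fullWeight Y f.1 = Y f := dif_pos f.2

theorem sqrtTwo_mul_self : (sqrtTwo : ℂ) * sqrtTwo = 2 := sqrt_two_mul_self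

theorem moveFactor_of_black {n : ℕ} {Γ : PlabicGraph n} {x : PlabicPoint Γ.V n}
    (h : PlabicGraph.IsBlackPoint x) {y : ℂ} (hy : y = 1) : PlabicGraph.moveFactor x y = 2 := by
  rw [PlabicGraph.moveFactor, if_pos h, hy]; norm_num

theorem moveFactor_of_white {n : ℕ} {Γ : PlabicGraph n} {x : PlabicPoint Γ.V n}
    (h : ¬ PlabicGraph.IsBlackPoint x) {y : ℂ} (hy : y = 1) : PlabicGraph.moveFactor x y = 2⁻¹ := by
  rw [PlabicGraph.moveFactor, if_neg h, hy]; norm_num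

theorem ite_and_of_right {M : Type*} {c d : Prop} [Decidable (c ∧ d)] [Decidable c] (hd : d)
    {a b z : M} (hab : a = b) : (if c ∧ d then a else z) = if c then b else z := by
  subst hab
  simp only [hd, and_true]

/-- A move at a square of weight `1` multiplies the weight of a neighbour by `2` or `1/2`, according
to the colour at which the common side starts. These factors are the inverse squares of those in
`faceScale`. -/
theorem squareMoves_strip {y : WordFace ty w → ℂ} (hy : ∀ q, y (.square q) = 1)
    (x : StripIdx ty w) :
    PlabicGraph.squareMoves (Γ := wordGraph ty w) (midSquares ty w) y (.strip x) *
      faceScale (.strip x) ^ 2 = y (.strip x) := by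
  classical
  have hx : WordFace.strip x ∉ midSquares ty w := by rintro ⟨q, hq⟩; cases hq
  have hS : ∀ (r) (P : Fin m → Prop), (lastFace r P : WordFace ty w) ∉ midSquares ty w := by
    rintro r P ⟨q, hq⟩; cases hq
  have hS' : ∀ z : RungIdx ty w, z.rightFace ∉ midSquares ty w := by
    rintro r ⟨q, hq⟩; cases hq
  have hsq : ∀ q : SquareIdx ty w, ¬ WordFace.square q = WordFace.strip x := nofun
  have hmem : ∀ q, WordFace.square q ∈ midSquares ty w := fun q => ⟨q, rfl⟩
  have hwl : ∀ q : SquareIdx ty w, ¬ PlabicGraph.IsBlackPoint (Γ := wordGraph ty w)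
    (.inner (.sqLeft q)) := fun q h => h trivial
  have hwr : ∀ q : SquareIdx ty w, ¬ PlabicGraph.IsBlackPoint (Γ := wordGraph ty w)
    (.inner (.sqRight q)) := fun q h => h trivial
  have hL : (∏ e : (wordGraph ty w).E, if (wordGraph ty w).left e = WordFace.strip x ∧
      (wordGraph ty w).right e ∈ midSquares ty w then
      PlabicGraph.moveFactor ((wordGraph ty w).head e) (y ((wordGraph ty w).right e)) else (1 : ℂ)) =
      1 * 1 * ∏ q : SquareIdx ty w, ((if q.upper.leftFace = WordFace.strip x then (2 : ℂ) else 1) * 1 *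
        ((if q.upper.rightFace = WordFace.strip x then (2⁻¹ : ℂ) else 1) * 1)) :=
    (prod_wordEdge _).trans (congrArg₂ (· * ·) (congrArg₂ (· * ·)
      (Finset.prod_eq_one fun x _ => if_neg fun h => hS _ _ h.2)
      (Finset.prod_eq_one fun x _ => if_neg fun h => hS' _ h.2))
      (Finset.prod_congr rfl fun q _ => congrArg₂ (· * ·)
        (congrArg₂ (· * ·) (ite_and_of_right (hmem q)
          (moveFactor_of_black (fun h => h.1 ⟨q, rfl⟩) (hy q))) (if_neg fun h => hsq q h.1))
        (congrArg₂ (· * ·) (ite_and_of_right (hmem q)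
          (moveFactor_of_white (hwr q) (hy q))) (if_neg fun h => hsq q h.1))))
  have hR : (∏ e : (wordGraph ty w).E, if (wordGraph ty w).right e = WordFace.strip x ∧
      (wordGraph ty w).left e ∈ midSquares ty w then
      PlabicGraph.moveFactor ((wordGraph ty w).tail e) (y ((wordGraph ty w).left e)) else (1 : ℂ)) =
      1 * 1 * ∏ q : SquareIdx ty w, (1 * (if q.lower.leftFace = WordFace.strip x then (2⁻¹ : ℂ) else 1) *
        (1 * (if q.lower.rightFace = WordFace.strip x then (2 : ℂ) else 1))) :=
    (prod_wordEdge _).trans (congrArg₂ (· * ·) (congrArg₂ (· * ·)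
      (Finset.prod_eq_one fun x _ => if_neg fun h => hS _ _ h.2)
      (Finset.prod_eq_one fun x _ => if_neg fun h => hS _ _ h.2))
      (Finset.prod_congr rfl fun q _ => congrArg₂ (· * ·)
        (congrArg₂ (· * ·) (if_neg fun h => hsq q h.1) (ite_and_of_right (hmem q)
          (moveFactor_of_white (hwl q) (hy q))))
        (congrArg₂ (· * ·) (if_neg fun h => hsq q h.1) (ite_and_of_right (hmem q)
          (moveFactor_of_black (fun h => h.1 ⟨q, rfl⟩) (hy q))))))
  have hM : PlabicGraph.squareMoves (Γ := wordGraph ty w) (midSquares ty w) y (.strip x) =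
      y (.strip x) * _ * _ :=
    (if_neg hx).trans (congrArg₂ (· * ·) (congrArg₂ (· * ·) rfl hL) hR)
  have hsi : ((sqrtTwo⁻¹ : ℂˣ) : ℂ) * ((sqrtTwo⁻¹ : ℂˣ) : ℂ) = 2⁻¹ := by
    rw [Units.val_inv_eq_inv_val, ← mul_inv, sqrtTwo_mul_self]
  rw [hM, mul_assoc, mul_assoc]
  conv_rhs => rw [← mul_one (y (.strip x))]
  congr 1
  rw [one_mul, one_mul, one_mul, faceScale, Units.coe_prod, ← Finset.prod_pow,
    ← Finset.prod_mul_distrib, ← Finset.prod_mul_distrib]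
  refine Finset.prod_eq_one fun q _ => ?_
  have hite : ∀ (c : Prop) [Decidable c] (u : ℂˣ) (a : ℂ), (u : ℂ) * u * a = 1 →
      (((if c then u else 1 : ℂˣ) : ℂ)) ^ 2 * (if c then a else 1) = 1 := by
    intro c _ u a h
    split_ifs
    · rw [sq]; exact h
    · simp
  have i1 := hite (q.lower.leftFace = WordFace.strip x) sqrtTwo 2⁻¹ (by rw [sqrtTwo_mul_self]; norm_num)
  have i2 := hite (q.lower.rightFace = WordFace.strip x) sqrtTwo⁻¹ 2 (by rw [hsi]; norm_num)
  have i3 := hite (q.upper.leftFace = WordFace.strip x) sqrtTwo⁻¹ 2 (by rw [hsi]; norm_num)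
  have i4 := hite (q.upper.rightFace = WordFace.strip x) sqrtTwo 2⁻¹ (by rw [sqrtTwo_mul_self]; norm_num)
  simp only [Units.val_mul, mul_pow, mul_one, one_mul]
  have e : ∀ a b c d a' b' c' d' : ℂ, a * a' = 1 → b * b' = 1 → c * c' = 1 → d * d' = 1 →
      c' * d' * (a' * b' * (a * b * (c * d))) = 1 := by
    intro a b c d a' b' c' d' h1 h2 h3 h4
    calc _ = (a * a') * (b * b') * (c * c') * (d * d') := by ring
      _ = 1 := by rw [h1, h2, h3, h4]; norm_num
  exact e _ _ _ _ _ _ _ _ i1 i2 i3 i4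

end MoveSymmetry

/-! ### Face weight coordinates of move-symmetric weightings -/

section Coordinates

variable {k : ℕ} {ty : TypeBC} {m : ℕ} {w : Fin m → DoubleLetter k}

/-- The mirror image of a face inside a strip. -/
def StripIdx.reflect (x : StripIdx ty w) : StripIdx ty w :=
  ⟨(x.1.1.rev, x.1.2), fun p hp => (x.2 p hp).rev⟩

theorem reflect_strip (x : StripIdx ty w) : (WordFace.strip x).reflect = .strip x.reflect := rfl

/-- A square is its own mirror image and the move inverts its weight, which is therefore `1`. Then
the moves are scalings by fixed powers of `2`, and the symmetry condition becomes multiplicative. -/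
theorem isMS_iff (Y : (wordGraph ty w).ProjWeighting) :
    IsMS Y ↔ (∀ q, fullWeight Y (.square q) = 1) ∧
      ∀ x : StripIdx ty w, 1 ≤ (x.1.1 : ℕ) → (x.1.1 : ℕ) < ty.dim k →
        fullWeight Y (.strip x.reflect) * faceScale (.strip x) ^ 2 = fullWeight Y (.strip x) := by
  have hext : PlabicGraph.extend Y = fun f => (fullWeight Y f : ℂ) :=
    funext fun f => extend_eq_fullWeight Y f
  have hsquare : ∀ q, PlabicGraph.squareMoves (Γ := wordGraph ty w) (midSquares ty w)
      (PlabicGraph.extend Y) (.square q) = (fullWeight Y (.square q) : ℂ)⁻¹ := fun q => by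
    rw [hext]; exact if_pos ⟨q, rfl⟩
  have hstrip : (∀ q, fullWeight Y (.square q) = 1) → ∀ x : StripIdx ty w,
      (PlabicGraph.squareMoves (Γ := wordGraph ty w) (midSquares ty w) (PlabicGraph.extend Y)
        (.strip x.reflect) = fullWeight Y (.strip x) ↔
      fullWeight Y (.strip x.reflect) * faceScale (.strip x) ^ 2 = fullWeight Y (.strip x)) := by
    intro hq x
    have h := squareMoves_strip (y := fun f => (fullWeight Y f : ℂ)) (fun q => by rw [hq]; rfl) x.reflect
    rw [← reflect_strip, faceScale_reflect, Units.val_inv_eq_inv_val, inv_pow,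
      mul_inv_eq_iff_eq_mul₀ (pow_ne_zero _ (Units.ne_zero _))] at h
    rw [hext, ← reflect_strip, h, ← Units.val_inj]
    push_cast
    rfl
  constructor
  · rintro ⟨h1, h2⟩
    have hq : ∀ q, fullWeight Y (.square q) = 1 := by
      intro q
      have e1 := h1 (.square q) ⟨q, rfl⟩
      have e2 : (fullWeight Y (.square q) : ℂ)⁻¹ = fullWeight Y (.square q) :=
        (hsquare q).symm.trans ((h2 ⟨.square q, square_ne_top_bot q⟩).trans
          (congrArg Units.val (fullWeight_of_proj Y ⟨_, square_ne_top_bot q⟩).symm))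
      rw [extend_eq_fullWeight] at e1
      have e3 : (fullWeight Y (.square q) : ℂ) * fullWeight Y (.square q) = 1 := by
        nth_rewrite 1 [← e2]; exact inv_mul_cancel₀ (Units.ne_zero _)
      rw [← Units.val_inj, Units.val_one]
      -- The value `-1` is excluded because the square move must be defined: `1 + y ≠ 0`.
      exact (mul_self_eq_one_iff.mp e3).resolve_right fun h => e1 (by rw [h]; norm_num)
    refine ⟨hq, fun x hx1 hx2 => (hstrip hq x).mp ?_⟩
    have hx := (strip_ne_top_bot_iff x).mpr ⟨hx1, hx2⟩
    exact (h2 ⟨.strip x, hx⟩).trans (congrArg Units.val (fullWeight_of_proj Y ⟨_, hx⟩).symm)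
  · rintro ⟨hq, h2⟩
    refine ⟨?_, ?_⟩
    · rintro _ ⟨q, rfl⟩
      rw [extend_eq_fullWeight, hq]; norm_num
    · rintro ⟨f, hf⟩
      refine Eq.trans ?_ (congrArg Units.val (fullWeight_of_proj Y ⟨f, hf⟩))
      cases f with
      | square q =>
        refine (hsquare q).trans ?_
        rw [hq]; simp
      | strip x =>
        obtain ⟨h3, h4⟩ := (strip_ne_top_bot_iff x).mp hf
        exact (hstrip hq x).mpr (h2 x h3 h4)

/-- By symmetry the mirror weight is `faceScale ^ (-2)` times the weight. As `faceScale` is a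
positive real number, the principal square root in `geomMean` is its inverse. In type `C` there are
no squares, so it is `1`. -/
theorem faceCoord_eq {Y : (wordGraph ty w).ProjWeighting} (hY : IsMS Y) (x : StripIdx ty w)
    (h1 : 1 ≤ (x.1.1 : ℕ)) (h2 : (x.1.1 : ℕ) < ty.dim k) :
    faceCoord Y (.strip x) = ((fullWeight Y (.strip x) / faceScale (.strip x) : ℂˣ) : ℂ) := by
  have h := ((isMS_iff Y).mp hY).2 x h1 h2
  cases ty with
  | C =>
    have : IsEmpty (SquareIdx .C w) := ⟨fun q => by have := q.2.1; cases this⟩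
    have h3 : faceScale (.strip x) = 1 := by
      unfold faceScale; exact Finset.prod_of_isEmpty _
    rw [h3, div_one]
    exact extend_eq_fullWeight Y _
  | B =>
    obtain ⟨r, hr, hr'⟩ := exists_pos_faceScale_eq (.strip x)
    show geomMean _ _ = _
    rw [extend_eq_fullWeight, extend_eq_fullWeight, reflect_strip, geomMean]
    have hr0 : (r : ℂ) ≠ 0 := by exact_mod_cast hr.ne'
    have h3 := congrArg Units.val h
    push_cast at h3
    rw [hr'] at h3
    have h4 : (fullWeight Y (.strip x.reflect) : ℂ) / fullWeight Y (.strip x) = ((r⁻¹ ^ 2 : ℝ) : ℂ) := by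
      rw [div_eq_iff (Units.ne_zero _), ← h3]
      push_cast
      field_simp
    rw [h4, show (1 / 2 : ℂ) = ((1 / 2 : ℝ) : ℂ) by push_cast; rfl,
      ← Complex.ofReal_cpow (by positivity), ← Real.sqrt_eq_rpow, Real.sqrt_sq (by positivity)]
    push_cast
    rw [hr', div_eq_mul_inv]

theorem stripVar_reflect (t : Fin k ⊕ Fin m → ℂˣ) (x : StripIdx ty w) (h1 : 1 ≤ (x.1.1 : ℕ))
    (h2 : (x.1.1 : ℕ) < ty.dim k) : stripVar t x.reflect = stripVar t x := by
  rcases x.eq_leftmostFace_or with hx | ⟨y, hy, hx⟩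
  · obtain ⟨i, hi⟩ := exists_stripIndex ty h1 h2
    rw [hx, stripVar_leftmostFace t _ i hi]
    refine stripVar_leftmostFace t _ i ?_
    · show ((x.1.1.rev : Fin (ty.dim k + 1)) : ℕ) = _ ∨ ((x.1.1.rev : Fin (ty.dim k + 1)) : ℕ) + _ = _
      rw [Fin.val_rev]
      rcases hi with hi | hi
      · right; omega
      · left; omega
  · rw [hx]; rfl

/-- The place of a coordinate face in its strip. -/
def coordStrip (ty : TypeBC) (w : Fin m → DoubleLetter k) : Fin k ⊕ Fin m → StripIdx ty w
  | .inl i => leftmostFace ⟨ty.dim k - (i + 1), by omega⟩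
  | .inr p => RungIdx.next ⟨(p, ⟨ty.dim k - (w p).abs, by omega⟩), Or.inr (by
      have := (w p).idx.2
      have := ty.two_mul_le_dim k
      simp only [DoubleLetter.abs]; omega)⟩

theorem coordFace_eq (a : Fin k ⊕ Fin m) : coordFace ty w a = .strip (coordStrip ty w a) := by
  cases a <;> rfl

theorem coordStrip_bounds (a : Fin k ⊕ Fin m) :
    ty.dim k ≤ 2 * ((coordStrip ty w a).1.1 : ℕ) ∧ 1 ≤ ((coordStrip ty w a).1.1 : ℕ) ∧
      ((coordStrip ty w a).1.1 : ℕ) < ty.dim k := by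
  have := ty.two_mul_le_dim k
  cases a with
  | inl i =>
    have := i.2
    simp only [coordStrip, leftmostFace]; omega
  | inr p =>
    have := (w p).idx.2
    simp only [coordStrip, RungIdx.next, DoubleLetter.abs]; omega

theorem stripVar_coordStrip (t : Fin k ⊕ Fin m → ℂˣ) (a : Fin k ⊕ Fin m) :
    stripVar t (coordStrip ty w a) = t a := by
  have := ty.two_mul_le_dim k
  cases a with
  | inl i => exact stripVar_leftmostFace t _ i (Or.inr (by have := i.2; simp only []; omega))
  | inr p => exact stripVar_next t _

theorem exists_eq_coordStrip (x : StripIdx ty w) (h0 : ty.dim k ≤ 2 * (x.1.1 : ℕ))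
    (h2 : (x.1.1 : ℕ) < ty.dim k) : ∃ a, x = coordStrip ty w a := by
  have hd := ty.two_mul_le_dim k
  rcases x.eq_leftmostFace_or with hx | ⟨y, hy, hx⟩
  · obtain ⟨i, hi⟩ := exists_stripIndex ty (r := x.1.1) (by omega) h2
    refine ⟨.inl i, hx.trans ?_⟩
    rw [show x.1.1 = ⟨ty.dim k - (i + 1), by omega⟩ from Fin.ext (by simp only []; omega)]
    rfl
  · refine ⟨.inr y.1.1, hx.trans (Subtype.ext (Prod.ext (Fin.ext ?_) rfl))⟩
    have h3 := y.2
    rw [hy] at h3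
    have h4 := (w y.1.1).idx.2
    simp only [coordStrip, RungIdx.next]
    rw [hy]
    unfold HasRung at h3
    simp only [DoubleLetter.abs] at h3 ⊢
    omega

/-- Faces below the midline are mirror images of faces above it, so the symmetry determines their
weights from the coordinates. -/
theorem exists_eq_coordStrip_or_reflect (x : StripIdx ty w) (h1 : 1 ≤ (x.1.1 : ℕ))
    (h2 : (x.1.1 : ℕ) < ty.dim k) : ∃ a, x = coordStrip ty w a ∨ x.reflect = coordStrip ty w a := by
  have hr : (x.reflect.1.1 : ℕ) = ty.dim k - x.1.1 := by
    simp only [StripIdx.reflect, Fin.val_rev]; omega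
  by_cases h0 : ty.dim k ≤ 2 * (x.1.1 : ℕ)
  · obtain ⟨a, ha⟩ := exists_eq_coordStrip x h0 h2
    exact ⟨a, Or.inl ha⟩
  · obtain ⟨a, ha⟩ := exists_eq_coordStrip x.reflect (by omega) (by omega)
    exact ⟨a, Or.inr ha⟩

theorem coordStrip_injective : Function.Injective (coordStrip ty w) := by
  have hd := ty.two_mul_le_dim k
  rintro (i | p) (j | q) h
  · have h1 := congrArg (fun x : StripIdx ty w => (x.1.1 : ℕ)) h
    simp only [coordStrip, leftmostFace] at h1
    have := i.2
    have := j.2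
    exact congrArg _ (Fin.ext (by omega))
  · exact absurd (congrArg (fun x : StripIdx ty w => x.1.2) h) (WithBot.coe_ne_bot (a := q)).symm
  · exact absurd (congrArg (fun x : StripIdx ty w => x.1.2) h) (WithBot.coe_ne_bot (a := p))
  · exact congrArg _ (WithBot.coe_injective (congrArg (fun x : StripIdx ty w => x.1.2) h))

theorem coordFace_injective : Function.Injective (coordFace ty w) := fun a b h => by
  rw [coordFace_eq, coordFace_eq] at h
  exact coordStrip_injective (WordFace.strip.inj h)

theorem range_coordFace :
    Set.range (coordFace ty w) = {f | f.IsUpper ∧ f ≠ (wordGraph ty w).top} := by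
  ext f
  constructor
  · rintro ⟨a, rfl⟩
    obtain ⟨h0, h1, h2⟩ := coordStrip_bounds (ty := ty) (w := w) a
    rw [coordFace_eq]
    exact ⟨h0, ((strip_ne_top_bot_iff _).mpr ⟨h1, h2⟩).1⟩
  · rintro ⟨h0, h1⟩
    cases f with
    | square q => exact h0.elim
    | strip x =>
      have h2 : (x.1.1 : ℕ) ≠ ty.dim k := fun h => h1 ((strip_eq_top_iff x).mpr h)
      obtain ⟨a, ha⟩ := exists_eq_coordStrip x h0 (by have := x.1.1.2; omega)
      exact ⟨a, (coordFace_eq a).trans (congrArg _ ha.symm)⟩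

/-- The weighting with the face weight coordinates `t`. -/
noncomputable def weightingOf (ty : TypeBC) (w : Fin m → DoubleLetter k) (t : Fin k ⊕ Fin m → ℂˣ) :
    (wordGraph ty w).ProjWeighting := fun f =>
  match f with
  | ⟨.strip x, _⟩ => faceScale (.strip x) * stripVar t x
  | ⟨.square _, _⟩ => 1

theorem fullWeight_weightingOf_square (t : Fin k ⊕ Fin m → ℂˣ) (q : SquareIdx ty w) :
    fullWeight (weightingOf ty w t) (.square q) = 1 :=
  fullWeight_of_proj _ ⟨_, square_ne_top_bot q⟩

theorem fullWeight_weightingOf_strip (t : Fin k ⊕ Fin m → ℂˣ) (x : StripIdx ty w)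
    (h1 : 1 ≤ (x.1.1 : ℕ)) (h2 : (x.1.1 : ℕ) < ty.dim k) :
    fullWeight (weightingOf ty w t) (.strip x) = faceScale (.strip x) * stripVar t x :=
  fullWeight_of_proj _ ⟨_, (strip_ne_top_bot_iff x).mpr ⟨h1, h2⟩⟩

theorem StripIdx.reflect_bounds (x : StripIdx ty w) (h1 : 1 ≤ (x.1.1 : ℕ))
    (h2 : (x.1.1 : ℕ) < ty.dim k) :
    1 ≤ (x.reflect.1.1 : ℕ) ∧ (x.reflect.1.1 : ℕ) < ty.dim k := by
  simp only [StripIdx.reflect, Fin.val_rev]; omega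

theorem isMS_weightingOf (t : Fin k ⊕ Fin m → ℂˣ) : IsMS (weightingOf ty w t) := by
  refine (isMS_iff _).mpr ⟨fullWeight_weightingOf_square t, fun x h1 h2 => ?_⟩
  obtain ⟨h3, h4⟩ := x.reflect_bounds h1 h2
  rw [fullWeight_weightingOf_strip t _ h3 h4, fullWeight_weightingOf_strip t x h1 h2,
    stripVar_reflect t x h1 h2, ← reflect_strip, faceScale_reflect, sq, mul_right_comm,
    inv_mul_cancel_left]

theorem faceCoord_weightingOf (t : Fin k ⊕ Fin m → ℂˣ) (a : Fin k ⊕ Fin m) :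
    faceCoord (weightingOf ty w t) (coordFace ty w a) = t a := by
  obtain ⟨-, h1, h2⟩ := coordStrip_bounds (ty := ty) (w := w) a
  rw [coordFace_eq, faceCoord_eq (isMS_weightingOf t) _ h1 h2, fullWeight_weightingOf_strip t _ h1 h2,
    stripVar_coordStrip, mul_div_cancel_left]

/-- A move-symmetric weighting is determined by its face weight coordinates. -/
theorem IsMS.eq_weightingOf {Y : (wordGraph ty w).ProjWeighting} (hY : IsMS Y)
    {t : Fin k ⊕ Fin m → ℂˣ} (ht : ∀ a, faceCoord Y (coordFace ty w a) = t a) :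
    Y = weightingOf ty w t := by
  obtain ⟨hq, hs⟩ := (isMS_iff Y).mp hY
  have hc : ∀ a, fullWeight Y (.strip (coordStrip ty w a)) =
      faceScale (.strip (coordStrip ty w a)) * t a := fun a => by
    obtain ⟨-, h1, h2⟩ := coordStrip_bounds (ty := ty) (w := w) a
    have h := ht a
    rw [coordFace_eq, faceCoord_eq hY _ h1 h2, Units.val_inj, div_eq_iff_eq_mul'] at h
    exact h
  funext f
  obtain ⟨f, hf⟩ := f
  refine (fullWeight_of_proj Y ⟨f, hf⟩).symm.trans ?_
  cases f with
  | square q => exact hq q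
  | strip x =>
    obtain ⟨h1, h2⟩ := (strip_ne_top_bot_iff x).mp hf
    show fullWeight Y (.strip x) = faceScale (.strip x) * stripVar t x
    obtain ⟨a, ha | ha⟩ := exists_eq_coordStrip_or_reflect x h1 h2
    · rw [ha, hc, stripVar_coordStrip]
    · rw [← hs x h1 h2, ← stripVar_reflect t x h1 h2, ha, hc, stripVar_coordStrip, ← ha,
        ← reflect_strip, faceScale_reflect, sq, mul_right_comm, inv_mul_cancel_left]

theorem IsMS.exists_coordinates {Y : (wordGraph ty w).ProjWeighting} (hY : IsMS Y) :
    ∃ t : Fin k ⊕ Fin m → ℂˣ, ∀ a, faceCoord Y (coordFace ty w a) = t a := by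
  refine ⟨fun a => fullWeight Y (coordFace ty w a) / faceScale (coordFace ty w a), fun a => ?_⟩
  obtain ⟨-, h1, h2⟩ := coordStrip_bounds (ty := ty) (w := w) a
  simp only [coordFace_eq]
  exact faceCoord_eq hY _ h1 h2

theorem exists_pos_extend_reflect (f : (wordGraph ty w).ProjFace) :
    ∃ c : ℝ, 0 < c ∧ ∀ Y : (wordGraph ty w).ProjWeighting, IsMS Y →
      PlabicGraph.extend Y (WordFace.reflect f.1) = c * Y f := by
  obtain ⟨f, hf⟩ := f
  cases f with
  | square q =>
    refine ⟨1, one_pos, fun Y _ => ?_⟩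
    have e : Y ⟨.square q, hf⟩ = fullWeight Y (.square q) := (fullWeight_of_proj Y ⟨_, hf⟩).symm
    refine (extend_eq_fullWeight Y _).trans ?_
    refine Eq.trans ?_ (congrArg (fun u : ℂˣ => ((1 : ℝ) : ℂ) * u) e.symm)
    rw [Complex.ofReal_one, one_mul]; rfl
  | strip x =>
    obtain ⟨h1, h2⟩ := (strip_ne_top_bot_iff x).mp hf
    obtain ⟨r, hr, hr'⟩ := exists_pos_faceScale_eq (.strip x)
    refine ⟨(r ^ 2)⁻¹, by positivity, fun Y hY => ?_⟩
    have e : Y ⟨.strip x, hf⟩ = fullWeight Y (.strip x) := (fullWeight_of_proj Y ⟨_, hf⟩).symm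
    refine (extend_eq_fullWeight Y _).trans ?_
    refine Eq.trans ?_ (congrArg (fun u : ℂˣ => (((r ^ 2)⁻¹ : ℝ) : ℂ) * u) e.symm)
    have h := congrArg Units.val (((isMS_iff Y).mp hY).2 x h1 h2)
    push_cast at h ⊢
    rw [hr'] at h
    show ((fullWeight Y (.strip x.reflect) : ℂˣ) : ℂ) = _ * ((fullWeight Y (.strip x) : ℂˣ) : ℂ)
    rw [← h]
    have : (r : ℂ) ≠ 0 := by exact_mod_cast hr.ne'
    field_simp

end Coordinates

theorem PlabicGraph.IsMeas.unique {n : ℕ} {Γ : PlabicGraph n} {Y : Γ.ProjWeighting} {g g' : PGL(n, ℂ)}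
    (h : PlabicGraph.IsMeas Y g) (h' : PlabicGraph.IsMeas Y g') : g = g' := by
  obtain ⟨⟨o, ho, wt, hwt⟩, h2⟩ := h
  obtain ⟨A, hA, rfl⟩ := (h2 o ho).2 wt hwt
  obtain ⟨A', hA', rfl⟩ := (h'.2 o ho).2 wt hwt
  rw [Units.ext (hA.trans hA'.symm)]

/-! ### Boundary measurements in face weight coordinates and the main theorem -/

section MainTheorem

variable {k : ℕ} {ty : TypeBC} {m : ℕ} {w : Fin m → DoubleLetter k}

/-- The boundary measurement of the weighting with the face weight coordinates `t` is the point with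
the Fock–Goncharov coordinates `t`. -/
theorem isMeas_weightingOf (hk : 1 ≤ k) (t : Fin k ⊕ Fin m → ℂˣ) :
    PlabicGraph.IsMeas (weightingOf ty w t) (fockGoncharov ty w t) := by
  have hd := ty.two_mul_le_dim k
  refine ⟨⟨wordOrientation ty w, isPerfect_wordOrientation ty w,
    edgeWeightOf (fullWeight (weightingOf ty w t)), ?_⟩, fun o ho => ?_⟩
  · rintro ⟨f, hf⟩
    cases f with
    | square q => exact wordFaceWeight_edgeWeightOf_square _ q
    | strip x =>
      obtain ⟨h1, h2⟩ := (strip_ne_top_bot_iff x).mp hf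
      exact (wordFaceWeight_edgeWeightOf_strip _ x h1 h2).trans (fullWeight_of_proj _ ⟨_, hf⟩)
  -- The condition on all perfect orientations concerns a single one, because the height function
  -- makes the perfect orientation unique.
  · obtain rfl := (isPerfect_wordOrientation ty w).eq_of_height wordHeight
      wordHeight_tailOf_lt_headOf ho
    refine ⟨PlabicGraph.isAcyclic_of_height wordHeight_tailOf_lt_headOf, fun wt hwt => ?_⟩
    exact exists_boundaryMatrix_eq (by omega) (fun q => hwt ⟨.square q, square_ne_top_bot q⟩)
      fun x h1 h2 => hwt ⟨.strip x, (strip_ne_top_bot_iff x).mpr ⟨h1, h2⟩⟩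

theorem setOf_isMeas_eq_range (hk : 1 ≤ k) :
    {g | ∃ Y : (wordGraph ty w).ProjWeighting, IsMS Y ∧ PlabicGraph.IsMeas Y g} =
      Set.range (fockGoncharov ty w) := by
  ext g
  constructor
  · rintro ⟨Y, hY, hg⟩
    obtain ⟨t, ht⟩ := hY.exists_coordinates
    obtain rfl := hY.eq_weightingOf ht
    exact ⟨t, (isMeas_weightingOf hk t).unique hg⟩
  · rintro ⟨t, rfl⟩
    exact ⟨_, isMS_weightingOf t, isMeas_weightingOf hk t⟩

end MainTheorem

theorem mainTheorem4 (ty : TypeBC) (k : ℕ) (hk : 1 ≤ k) (m : ℕ) (w : Fin m → DoubleLetter k)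
    (u v : Equiv.Perm (Fin (ty.dim k))) (hw : IsReducedWordOf ty w u v) :
    -- the faces `coordFace` are the faces on or above the midline, except the uppermost one
    (Function.Injective (coordFace ty w) ∧
      Set.range (coordFace ty w) = {f | f.IsUpper ∧ f ≠ (wordGraph ty w).top}) ∧
    -- weights of symmetric faces differ by positive factors depending only on the graph
    (∀ f : (wordGraph ty w).ProjFace, ∃ c : ℝ, 0 < c ∧ ∀ Y : (wordGraph ty w).ProjWeighting, IsMS Y →
      PlabicGraph.extend Y (WordFace.reflect f.1) = c * Y f) ∧
    -- the face weight coordinates are coordinates on projective move-symmetric weightings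
    (∀ t : Fin k ⊕ Fin m → ℂˣ, ∃! Y : (wordGraph ty w).ProjWeighting,
      IsMS Y ∧ ∀ a, faceCoord Y (coordFace ty w a) = t a) ∧
    -- the boundary measurement map is defined, takes values in the double Bruhat cell of the adjoint
    -- group, and turns the face weight coordinates into the Fock–Goncharov coordinates
    (∀ Y : (wordGraph ty w).ProjWeighting, IsMS Y →
      ∃ g ∈ doubleBruhatCell u v, PlabicGraph.IsMeas Y g ∧
        ∀ t : Fin k ⊕ Fin m → ℂˣ,
          fockGoncharov ty w t = g ↔ ∀ a, faceCoord Y (coordFace ty w a) = t a) ∧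
    -- these coordinates are defined on a dense subset of the double Bruhat cell
    IsZariskiDenseIn
      {g | ∃ Y : (wordGraph ty w).ProjWeighting, IsMS Y ∧ PlabicGraph.IsMeas Y g}
      (doubleBruhatCell u v) := by
  refine ⟨⟨coordFace_injective, range_coordFace⟩, exists_pos_extend_reflect, fun t => ?_,
    fun Y hY => ?_, ?_⟩
  · exact ⟨weightingOf ty w t, ⟨isMS_weightingOf t, faceCoord_weightingOf t⟩,
      fun Y hY => hY.1.eq_weightingOf hY.2⟩
  · obtain ⟨t, ht⟩ := hY.exists_coordinates
    obtain rfl := hY.eq_weightingOf ht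
    refine ⟨fockGoncharov ty w t, fockGoncharov_mem_doubleBruhatCell hw t, isMeas_weightingOf hk t,
      fun t' => ⟨fun h a => ?_, fun h => ?_⟩⟩
    -- Here reducedness enters: it makes the Fock–Goncharov variables of a point unique.
    · rw [ht, fockGoncharov_injective ty w hw.isAscending h]
    · congr 1
      funext a
      exact Units.ext ((h a).symm.trans (ht a))
  · rw [setOf_isMeas_eq_range hk]
    exact isZariskiDenseIn_range_fockGoncharov hw
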